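/- \textbf{Conventions.} A \emph{computable metric space} $\mathbb X=(X,d,(x_i)_{i\in\mathbb N})$ is a complete separable metric space with a dense sequence of \emph{basic points} $x_i$ such that $(i,j)\mapsto d(x_i,x_j)$ is a computable function $\mathbb N^2\to\mathbb R$; products carry the maximum metric and pairs of basic points. A \emph{Cauchy name} of $y$ is an $h\in\mathbb N^{\mathbb N}$ with $d(x_{h(j)},x_{h(i)})\le 2^{-i}$ for all $j\ge i$ and $x_{h(i)}\to y$. A map $f\colon A\to\mathbb Y$ with $A\subseteq\mathbb X$ is \emph{computable} if some partial computable $F\colon{\subseteq}\,\mathbb N^{\mathbb N}\to\mathbb N^{\mathbb N}$ maps every Cauchy name of every $x\in A$ to a Cauchy name of $f(x)$. A set is \emph{effectively closed} if its complement is the union of a computable set of open balls with basic centres and positive rational radii. A function $f\colon\mathbb X\to[0,\infty]$ is \emph{lower semicomputable} if $f=\sup_n g(n,\cdot)$ for a computable $g\colon\mathbb N\times\mathbb X\to\mathbb R$. Let $\mathcal M(\mathbb X)$ and $\mathcal M_1(\mathbb X)$ be the sets of finite Borel measures and of Borel probability measures on $\mathbb X$. For these two spaces the same notions are used with the metric $$d(\mu,\nu)=\sum_{i}2^{-i}\Bigl(1-\exp\Bigl(-\Bigl|\int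 f_i\,d\mu-\int f_i\,d\nu\Bigr|\Bigr)\Bigr),$$ where $(f_i)_{i\in\mathbb N}$ is a natural enumeration of the closure under $\max$, $\min$ and rational linear combinations of the constant $1$ and the bump functions $f_{x,r,s}$ ($x$ a basic point, $0<r<s$ rational; $f_{x,r,s}(y)$ equals $1$ if $d(x,y)\le r$, equals $(s-d(x,y))/(s-r)$ if $r<d(x,y)\le s$, and equals $0$ otherwise), and with the finite sums $\sum_j q_j\delta_{x_j}$ ($q_j>0$ rational, $x_j$ basic points; for $\mathcal M_1(\mathbb X)$ also $\sum_j q_j=1$) as basic points. A \emph{uniform Schnorr integral test} (for an oracle space $\mathbb A$ and a space $\mathbb X$) is a lower semicomputable function $t\colon\mathbb A\times\mathcal M(\mathbb X)\times\mathbb X\to[0,\infty]$ such that $\int t(a,\mu,x)\,d\mu(x)<\infty$ for all $a,\mu$ and $(a,\mu)\mapsto\int t(a,\mu,x)\,d\mu(x)$ is a computable map $\mathbb A\times\mathcal M(\mathbb X)\to\mathbb R$. A point $x$ is \emph{uniformly Schnorr $\mu$-random relative to the oracle $a$}, written $x\in\mathsf{SR}_\mu^a$, if $t(a,\mu,x)<\infty$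 for every uniform Schnorr integral test $t$. Here the oracle space may also be a product such as $\mathbb A\times\mathcal M_1(\mathbb X)$, and $\mathsf{SR}_\nu^{a,\mu}$ denotes randomness relative to the pair $(a,\mu)$. \textbf{Proposition (Randomness conservation).} Let $\mathbb A$, $\mathbb X$ and $\mathbb Y$ be computable metric spaces, let $K\subseteq\mathbb A\times\mathcal M_1(\mathbb X)$ be effectively closed, and let $T\colon K\times\mathbb X\to\mathbb Y$ be a computable map; write $T_\mu^a(x)=T(a,\mu,x)$. Then for every $(a,\mu)\in K$ the map $T_\mu^a\colon\mathbb X\to\mathbb Y$ is continuous, so that the pushforward measure $\mu_{T_\mu^a}=\mu\circ(T_\mu^a)^{-1}$ is defined, and for every $x\in\mathbb X$, $$x\in\mathsf{SR}_\mu^a\quad\text{implies}\quad T_\mu^a(x)\in\mathsf{SR}_{\mu_{T_\mu^a}}^{a,\mu}.$$ -/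

import Mathlib

open MeasureTheory Filter Topology
open scoped NNReal ENNReal

noncomputable section

/-! ## Rational numbers and computable real numbers -/

/-- A standard (surjective) coding of the rationals: the code `⟨⟨a, b⟩, c⟩` stands for
`(a - b) / (c + 1)`. -/
def ratOf (k : ℕ) : ℚ :=
  ((k.unpair.1.unpair.1 : ℚ) - (k.unpair.1.unpair.2 : ℚ)) / ((k.unpair.2 : ℚ) + 1)

/-- A standard (surjective) coding of the positive rationals: the code `⟨a, b⟩` stands for
`(a + 1) / (b + 1)`. -/
def posRatOf (k : ℕ) : ℚ≥0 :=
  ((k.unpair.1 : ℚ≥0) + 1) / ((k.unpair.2 : ℚ≥0) + 1)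

/-- A function `f : ℕ → ℝ` is computable: there is a computable double sequence of rationals
`g (n, i)` with `|g (n, j) - g (n, i)| ≤ 2 ^ (-i)` for `j ≥ i` and `f n = lim_i g (n, i)`. -/
def ComputableRealSeq (f : ℕ → ℝ) : Prop :=
  ∃ g : ℕ × ℕ → ℕ, Computable g ∧ ∀ n : ℕ,
    (∀ i j : ℕ, i ≤ j → |(ratOf (g (n, j)) : ℝ) - (ratOf (g (n, i)) : ℝ)| ≤ (2 : ℝ)⁻¹ ^ i) ∧
    Tendsto (fun i => (ratOf (g (n, i)) : ℝ)) atTop (𝓝 (f n))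

/-! ## Computable metric spaces -/

/-- A computable metric space: a complete separable metric space with a dense sequence of basic
points `pt i` such that `(i, j) ↦ dist (pt i) (pt j)` is computable. -/
class ComputableMetricSpace (X : Type*) extends MetricSpace X where
  pt : ℕ → X
  complete : CompleteSpace X
  dense : DenseRange pt
  computable_dist :
    ComputableRealSeq (fun n => dist (pt n.unpair.1) (pt n.unpair.2))

/-- The data (distance function and sequence of basic points) through which the notions of
computable analysis below are defined. It is used only for the concrete instances that follow:
computable metric spaces, `ℕ`, `ℝ`, products, and the spaces of measures. -/
class MetricPresentation (X : Type*) where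
  d : X → X → ℝ
  basic : ℕ → X

open MetricPresentation

instance ComputableMetricSpace.toMetricPresentation {X : Type*} [ComputableMetricSpace X] :
    MetricPresentation X where
  d := dist
  basic := ComputableMetricSpace.pt

instance MetricPresentation.instNat : MetricPresentation ℕ where
  d := dist
  basic n := n

instance MetricPresentation.instReal : MetricPresentation ℝ where
  d := dist
  basic n := (ratOf n : ℝ)

/-- The product carries the maximum metric and pairs of basic points. -/
instance MetricPresentation.instProd {X Y : Type*} [MetricPresentation X]
    [MetricPresentation Y] : MetricPresentation (X × Y) where
  d p q := max (d p.1 q.1) (d p.2 q.2)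
  basic n := (basic n.unpair.1, basic n.unpair.2)

/-! ## Computable functions, effectively closed sets, lower semicomputable functions -/

/-- `h` is a Cauchy name of `x`. -/
def IsCauchyName {X : Type*} [MetricPresentation X] (h : ℕ → ℕ) (x : X) : Prop :=
  (∀ i j : ℕ, i ≤ j → d (basic (h j) : X) (basic (h i)) ≤ (2 : ℝ)⁻¹ ^ i) ∧
  Tendsto (fun i => d (basic (h i)) x) atTop (𝓝 0)

/-- Partial computable maps on Baire space. The total computable function `φ` plays the role of
a machine with oracle `h`: `φ (w, n)` is the output (if any) on input `n` of the computation that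
runs for `w.length` steps and may read only the finite initial segment `w` of the oracle. The
value of `F h` at `n` is the first output that appears, and `F h` is defined iff there is an
output for every `n`. -/
def PartialComputable (F : (ℕ → ℕ) →. (ℕ → ℕ)) : Prop :=
  ∃ φ : List ℕ × ℕ → Option ℕ, Computable φ ∧ ∀ h g : ℕ → ℕ,
    g ∈ F h ↔ ∀ n : ℕ, ∃ k : ℕ, φ ((List.range k).map h, n) = some (g n) ∧
      ∀ j < k, φ ((List.range j).map h, n) = none

/-- The restriction of `f` to `A` is a computable map `A → Y`. -/
def ComputableMapOn {X Y : Type*} [MetricPresentation X] [MetricPresentation Y]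
    (f : X → Y) (A : Set X) : Prop :=
  ∃ F : (ℕ → ℕ) →. (ℕ → ℕ), PartialComputable F ∧
    ∀ x ∈ A, ∀ h : ℕ → ℕ, IsCauchyName h x → ∃ g ∈ F h, IsCauchyName g (f x)

/-- `f : X → Y` is computable. -/
def ComputableMap {X Y : Type*} [MetricPresentation X] [MetricPresentation Y]
    (f : X → Y) : Prop :=
  ComputableMapOn f Set.univ

/-- The standard enumeration of the basic open balls. -/
def basicBall (X : Type*) [MetricPresentation X] (n : ℕ) : Set X :=
  {x | d (basic n.unpair.1) x < (posRatOf n.unpair.2 : ℝ)}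

/-- Effectively open (`Σ⁰₁`) sets: unions of computable sets of basic open balls. -/
def EffectivelyOpen {X : Type*} [MetricPresentation X] (U : Set X) : Prop :=
  ∃ S : Set ℕ, ComputablePred (fun n => n ∈ S) ∧ U = ⋃ n ∈ S, basicBall X n

/-- Effectively closed (`Π⁰₁`) sets. -/
def EffectivelyClosed {X : Type*} [MetricPresentation X] (C : Set X) : Prop :=
  EffectivelyOpen Cᶜ

/-- `f : X → [0, ∞]` is lower semicomputable: `f = sup_n g_n` for a computable sequence of
computable functions `g_n : X → ℝ`. -/
def LowerSemicomputable {X : Type*} [MetricPresentation X] (f : X → ℝ≥0∞) : Prop :=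
  ∃ g : ℕ × X → ℝ, ComputableMap g ∧ ∀ x, (f x : EReal) = ⨆ n : ℕ, (g (n, x) : EReal)

/-! ## The spaces of finite measures and of probability measures -/

/-- The basic bump function with centre `c` and radii `r < s`. -/
def bump {X : Type*} [MetricPresentation X] (c : X) (r s : ℝ) (y : X) : ℝ :=
  if d c y ≤ r then 1 else if d c y ≤ s then (s - d c y) / (s - r) else 0

/-- Formal expressions for the basic functions: the bump functions and the constant `1`, closed
under maximum, minimum and rational linear combinations. -/
inductive BasicTerm : Type
  | one : BasicTerm
  | bump (c r s : ℕ) : BasicTerm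
  | max (f g : BasicTerm) : BasicTerm
  | min (f g : BasicTerm) : BasicTerm
  | add (f g : BasicTerm) : BasicTerm
  | smul (q : ℕ) (f : BasicTerm) : BasicTerm

/-- The function denoted by an expression. In `bump c r s` the radii are `posRatOf r` and
`posRatOf r + posRatOf s`. -/
def BasicTerm.eval (X : Type*) [MetricPresentation X] : BasicTerm → X → ℝ
  | .one, _ => 1
  | .bump c r s, y => _root_.bump (basic c) (posRatOf r : ℝ) ((posRatOf r + posRatOf s : ℚ≥0) : ℝ) y
  | .max f g, y => Max.max (f.eval X y) (g.eval X y)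
  | .min f g, y => Min.min (f.eval X y) (g.eval X y)
  | .add f g, y => f.eval X y + g.eval X y
  | .smul q f, y => (ratOf q : ℝ) * f.eval X y

/-- A natural (surjective) enumeration of the expressions. -/
def BasicTerm.ofNat : ℕ → BasicTerm
  | 0 => .one
  | n + 1 =>
    have hm : n / 5 < n + 1 := by omega
    have h1 : (n / 5).unpair.1 < n + 1 := lt_of_le_of_lt (Nat.unpair_left_le _) hm
    have h2 : (n / 5).unpair.2 < n + 1 := lt_of_le_of_lt (Nat.unpair_right_le _) hm
    match n % 5 with
    | 0 => .bump (n / 5).unpair.1 (n / 5).unpair.2.unpair.1 (n / 5).unpair.2.unpair.2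
    | 1 => .max (BasicTerm.ofNat (n / 5).unpair.1) (BasicTerm.ofNat (n / 5).unpair.2)
    | 2 => .min (BasicTerm.ofNat (n / 5).unpair.1) (BasicTerm.ofNat (n / 5).unpair.2)
    | 3 => .add (BasicTerm.ofNat (n / 5).unpair.1) (BasicTerm.ofNat (n / 5).unpair.2)
    | _ => .smul (n / 5).unpair.1 (BasicTerm.ofNat (n / 5).unpair.2)

/-- The enumeration `f_i` of the basic functions on `X`. -/
def basicFunction (X : Type*) [MetricPresentation X] (i : ℕ) : X → ℝ :=
  (BasicTerm.ofNat i).eval X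

/-- The distance `∑ i, 2 ^ (-i) * (1 - exp (-|∫ f_i dμ - ∫ f_i dν|))` of two measures. -/
def measureDist {X : Type*} [MetricPresentation X] [MeasurableSpace X] (μ ν : Measure X) : ℝ :=
  ∑' i : ℕ, (2 : ℝ)⁻¹ ^ i *
    (1 - Real.exp (-|(∫ x, basicFunction X i x ∂μ) - ∫ x, basicFunction X i x ∂ν|))

/-- The unit mass at `x`. -/
def diracFinite {X : Type*} [MeasurableSpace X] (x : X) : FiniteMeasure X :=
  ⟨Measure.dirac x, inferInstance⟩

/-- The measure `q₁ δ_{x₁} + ⋯ + q_n δ_{x_n}` with positive rationals `q_j` and basic points `x_j`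
that is coded by a list of naturals; the entry `⟨a, b⟩` codes `posRatOf a` and `basic b`. -/
def basicMeasure (X : Type*) [MetricPresentation X] [MeasurableSpace X] (l : List ℕ) :
    FiniteMeasure X :=
  (l.map fun k => ((posRatOf k.unpair.1 : ℚ≥0) : ℝ≥0) •
    diracFinite (basic k.unpair.2 : X)).sum

/-- The space `𝓜(X)` of finite Borel measures. -/
instance MetricPresentation.instFiniteMeasure {X : Type*} [MetricPresentation X]
    [MeasurableSpace X] : MetricPresentation (FiniteMeasure X) where
  d μ ν := measureDist (μ : Measure X) (ν : Measure X)
  basic n := basicMeasure X (Denumerable.ofNat (List ℕ) n)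

/-- The space `𝓜₁(X)` of Borel probability measures. The basic points are the rational convex
combinations of unit masses at basic points, obtained by dividing the basic measures that are
coded by nonempty lists by their total masses. -/
instance MetricPresentation.instProbabilityMeasure {X : Type*} [MetricPresentation X]
    [MeasurableSpace X] : MetricPresentation (ProbabilityMeasure X) where
  d μ ν := measureDist (μ : Measure X) (ν : Measure X)
  basic n :=
    haveI : Nonempty X := ⟨basic 0⟩
    (basicMeasure X (n.unpair.1 :: Denumerable.ofNat (List ℕ) n.unpair.2)).normalize

/-! ## Uniform Schnorr randomness -/

/-- Uniform Schnorr integral tests `t : 𝔸 × 𝓜(X) × X → [0, ∞]`. -/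
structure IsUniformSchnorrTest {A X : Type*} [MetricPresentation A] [MetricPresentation X]
    [MeasurableSpace X] (t : A × FiniteMeasure X × X → ℝ≥0∞) : Prop where
  lowerSemicomputable : LowerSemicomputable t
  integral_lt_top : ∀ (a : A) (μ : FiniteMeasure X), ∫⁻ x, t (a, μ, x) ∂(μ : Measure X) < ∞
  computable_integral : ComputableMap
    (fun p : A × FiniteMeasure X => (∫⁻ x, t (p.1, p.2, x) ∂(p.2 : Measure X)).toReal)

/-- The set of points that are uniformly Schnorr `μ`-random relative to the oracle `a`. -/
def SR {A X : Type*} [MetricPresentation A] [MetricPresentation X] [MeasurableSpace X]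
    (a : A) (μ : FiniteMeasure X) : Set X :=
  {x | ∀ t : A × FiniteMeasure X × X → ℝ≥0∞, IsUniformSchnorrTest t → t (a, μ, x) < ∞}

end

/-! A test `t` for the image measure pulls back to `s(a, μ, x) = t((a, μ), μ_T, T(x))`. For `(a, μ)`
in `K` this is lower semicomputable, and the change of variables gives `∫ s dμ = ∫ t dμ_T`, which is
finite and computable because `μ_T` is computable from `(a, μ)`. If `s` were a test, finiteness of
`s` at a random `x` would be finiteness of `t` at `T(x)`. But `s` is under control only over `K`,
whereas a test needs finite computable integrals for every oracle and every finite measure. The core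
is therefore an extension theorem, `exists_integrable_extension`.

Extension: the set of parameters remains co-c.e. closed among pairs with finite measures
(`sd_compl_finiteMeasureParams`). Over it, `s` is the supremum of an increasing sequence of
computable functions `h n ≥ 0` that are defined for all parameters; let `S n` be their integrals,
which may grow without control off `K`. There is a computable increasing sequence `v n` with
supremum `1 / ∫ s` on `K` and `∞` off `K` (`exists_rc_inverse_approx`). Each increment `h (n + 1) -
h n` is multiplied by a continuous factor of the parameter that is `1` while `v (n + 1) * S (n + 1)
≤ 1` and `0` once this product reaches `1 + 2⁻ⁿ`. On `K` the product never exceeds `1`, so nothing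
changes. In general, `1 + 2⁻ᴺ < D * v N` implies that after stage `N` the integral grows by at most
`max 0 (D - S N)` (`dampedSum_le`). This gives finiteness and upper approximations of the new
integral: `D` decreases to `∫ s` on `K`, and to `0` off `K`.

Effectivity: names are eliminated at the outset. A map is computable iff preimages of basic balls
are uniformly r.e. unions of finite intersections of basic balls (`ComputableMapOn.sdMap`,
`SDMap.computableMapOn`). In this language, computing a measure amounts to computing its integrals
of all basic functions (`IsMeasurePres.rc_integral`, `IsMeasurePres.sdMap`), and integrals of
bounded nonnegative lower semicomputable functions are lower semicomputable in the measure
(`Lo.integral`). -/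

open MetricPresentation

/-! ## Automation for primitive recursive functions -/

section PrimrecAutomation

attribute [fun_prop] Primrec
attribute [fun_prop] Primrec.comp Primrec.id Primrec.const

variable {α β γ : Type*} [Primcodable α] [Primcodable β] [Primcodable γ]

@[fun_prop]
theorem Primrec.fst_comp {f : α → β × γ} (hf : Primrec f) : Primrec fun a => (f a).1 :=
  Primrec.fst.comp hf

@[fun_prop]
theorem Primrec.snd_comp {f : α → β × γ} (hf : Primrec f) : Primrec fun a => (f a).2 :=
  Primrec.snd.comp hf

@[fun_prop]
theorem Primrec.mk_comp {f : α → β} {g : α → γ} (hf : Primrec f) (hg : Primrec g) :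
    Primrec fun a => (f a, g a) := Primrec.pair hf hg

@[fun_prop]
theorem Primrec.add_comp {f g : α → ℕ} (hf : Primrec f) (hg : Primrec g) :
    Primrec fun a => f a + g a := Primrec.nat_add.comp hf hg

@[fun_prop]
theorem Primrec.sub_comp {f g : α → ℕ} (hf : Primrec f) (hg : Primrec g) :
    Primrec fun a => f a - g a := Primrec.nat_sub.comp hf hg

@[fun_prop]
theorem Primrec.mul_comp {f g : α → ℕ} (hf : Primrec f) (hg : Primrec g) :
    Primrec fun a => f a * g a := Primrec.nat_mul.comp hf hg

@[fun_prop]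
theorem Primrec.div_comp {f g : α → ℕ} (hf : Primrec f) (hg : Primrec g) :
    Primrec fun a => f a / g a := Primrec.nat_div.comp hf hg

@[fun_prop]
theorem Primrec.mod_comp {f g : α → ℕ} (hf : Primrec f) (hg : Primrec g) :
    Primrec fun a => f a % g a := Primrec.nat_mod.comp hf hg

@[fun_prop]
theorem Primrec.pow_comp {f g : α → ℕ} (hf : Primrec f) (hg : Primrec g) :
    Primrec fun a => f a ^ g a :=
  (Primrec₂.unpaired'.1 Nat.Primrec.pow : Primrec₂ ((· ^ ·) : ℕ → ℕ → ℕ)).comp hf hg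

@[fun_prop]
theorem Primrec.natPair_comp {f g : α → ℕ} (hf : Primrec f) (hg : Primrec g) :
    Primrec fun a => Nat.pair (f a) (g a) := Primrec₂.natPair.comp hf hg

@[fun_prop]
theorem Primrec.unpair_comp {f : α → ℕ} (hf : Primrec f) : Primrec fun a => Nat.unpair (f a) :=
  Primrec.unpair.comp hf

@[fun_prop]
theorem Primrec.length_comp {f : α → List β} (hf : Primrec f) : Primrec fun a => (f a).length :=
  Primrec.list_length.comp hf

@[fun_prop]
theorem Primrec.append_comp {f g : α → List β} (hf : Primrec f) (hg : Primrec g) :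
    Primrec fun a => f a ++ g a := Primrec.list_append.comp hf hg

@[fun_prop]
theorem Primrec.cons_comp {f : α → β} {g : α → List β} (hf : Primrec f) (hg : Primrec g) :
    Primrec fun a => f a :: g a := Primrec.list_cons.comp hf hg

@[fun_prop]
theorem Primrec.flatten_comp {f : α → List (List β)} (hf : Primrec f) :
    Primrec fun a => (f a).flatten := Primrec.list_flatten.comp hf

@[fun_prop]
theorem Primrec.range_comp {f : α → ℕ} (hf : Primrec f) :
    Primrec fun a => List.range (f a) := Primrec.list_range.comp hf

@[fun_prop]
theorem Primrec.take_comp {f : α → ℕ} {g : α → List β} (hf : Primrec f) (hg : Primrec g) :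
    Primrec fun a => (g a).take (f a) := Primrec.list_take.comp hf hg

@[fun_prop]
theorem Primrec.getD_comp {f : α → List β} {g : α → ℕ} {d : β} (hf : Primrec f)
    (hg : Primrec g) : Primrec fun a => (f a).getD (g a) d :=
  (Primrec.list_getD d).comp hf hg

@[fun_prop]
theorem Primrec.encode_comp {f : α → β} (hf : Primrec f) :
    Primrec fun a => Encodable.encode (f a) := Primrec.encode.comp hf

@[fun_prop]
theorem Primrec.decode_comp {f : α → ℕ} (hf : Primrec f) :
    Primrec fun a => (Encodable.decode (f a) : Option β) := Primrec.decode.comp hf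

@[fun_prop]
theorem Primrec.ofNat_comp {δ : Type*} [Denumerable δ] {f : α → ℕ} (hf : Primrec f) :
    Primrec fun a => Denumerable.ofNat δ (f a) := (Primrec.ofNat δ).comp hf

@[fun_prop]
theorem Primrec.some_comp {f : α → β} (hf : Primrec f) :
    Primrec fun a => some (f a) := Primrec.option_some.comp hf

end PrimrecAutomation

/-! ## Recursively enumerable predicates -/

/-- Recursively enumerable predicates, in Kleene normal form. -/
def RE {α : Type*} [Primcodable α] (p : α → Prop) : Prop :=
  ∃ q : α × ℕ → Prop, PrimrecPred q ∧ ∀ a, p a ↔ ∃ n, q (a, n)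

namespace RE

variable {α β γ : Type*} [Primcodable α] [Primcodable β] [Primcodable γ]

theorem of_primrec {p : α → Prop} (h : PrimrecPred p) : RE p :=
  ⟨fun x => p x.1, h.comp Primrec.fst, fun _ => by simp⟩

theorem congr {p q : α → Prop} (h : RE p) (H : ∀ a, q a ↔ p a) : RE q := by
  obtain ⟨r, hr, h⟩ := h
  exact ⟨r, hr, fun a => (H a).trans (h a)⟩

theorem comp {p : β → Prop} (h : RE p) {f : α → β} (hf : Primrec f) : RE fun a => p (f a) := by
  obtain ⟨q, hq, h⟩ := h
  exact ⟨fun x => q (f x.1, x.2), hq.comp (by fun_prop), fun a => h _⟩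

theorem eq {f g : α → β} (hf : Primrec f) (hg : Primrec g) : RE fun a => f a = g a :=
  of_primrec (Primrec.eq.comp hf hg)

theorem nat_lt {f g : α → ℕ} (hf : Primrec f) (hg : Primrec g) : RE fun a => f a < g a :=
  of_primrec (Primrec.nat_lt.comp hf hg)

theorem and {p q : α → Prop} (hp : RE p) (hq : RE q) : RE fun a => p a ∧ q a := by
  obtain ⟨p', hp', hp⟩ := hp
  obtain ⟨q', hq', hq⟩ := hq
  refine ⟨fun x => p' (x.1, x.2.unpair.1) ∧ q' (x.1, x.2.unpair.2),
    (hp'.comp (by fun_prop)).and (hq'.comp (by fun_prop)), fun a => ?_⟩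
  simp only [hp, hq]
  constructor
  · rintro ⟨⟨m, hm⟩, n, hn⟩
    exact ⟨Nat.pair m n, by simpa using ⟨hm, hn⟩⟩
  · rintro ⟨n, h1, h2⟩
    exact ⟨⟨_, h1⟩, _, h2⟩

theorem or {p q : α → Prop} (hp : RE p) (hq : RE q) : RE fun a => p a ∨ q a := by
  obtain ⟨p', hp', hp⟩ := hp
  obtain ⟨q', hq', hq⟩ := hq
  refine ⟨fun x => p' x ∨ q' x, hp'.or hq', fun a => ?_⟩
  simp only [hp, hq, exists_or]

theorem ex {p : α → β → Prop} (hp : RE fun x : α × β => p x.1 x.2) :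
    RE fun a => ∃ b, p a b := by
  obtain ⟨p', hp', hp⟩ := hp
  classical
  obtain ⟨_, hp'⟩ := id hp'
  refine ⟨fun x => ((Encodable.decode x.2.unpair.1 : Option β).map
    fun b => decide (p' ((x.1, b), x.2.unpair.2))) = some true, ?_, fun a => ?_⟩
  · refine Primrec.eq.comp ?_ (Primrec.const _)
    refine Primrec.option_map (by fun_prop) ?_
    exact hp'.comp (f := fun p' => decide _)
      (g := fun y : (α × ℕ) × β => ((y.1.1, y.2), y.1.2.unpair.2)) (by fun_prop)
  · constructor
    · rintro ⟨b, hb⟩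
      obtain ⟨n, hn⟩ := (hp (a, b)).1 hb
      exact ⟨Nat.pair (Encodable.encode b) n, by simpa using hn⟩
    · rintro ⟨n, hn⟩
      simp only [Option.map_eq_some_iff, decide_eq_true_eq] at hn
      obtain ⟨b, -, hb⟩ := hn
      exact ⟨b, (hp (a, b)).2 ⟨_, hb⟩⟩

/-- Finitely many witnesses have a common bound, and quantification below that bound is primitive
recursive. -/
theorem forall_lt {p : α → ℕ → Prop} (hp : RE fun x : α × ℕ => p x.1 x.2) {f : α → ℕ}
    (hf : Primrec f) : RE fun a => ∀ j < f a, p a j := by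
  obtain ⟨p', hp', hp⟩ := hp
  have h1 : PrimrecRel fun (n : ℕ) (y : α × ℕ) => p' (y, n) :=
    hp'.comp (f := fun y : ℕ × (α × ℕ) => (y.2, y.1)) (by fun_prop)
  have h2 := h1.exists_mem_list
  have h3 : PrimrecRel fun (j : ℕ) (y : α × ℕ) => ∃ n ∈ List.range y.2, p' ((y.1, j), n) :=
    PrimrecPred.comp h2 (f := fun z : ℕ × (α × ℕ) => (List.range z.2.2, (z.2.1, z.1)))
      (by fun_prop)
  have h4 := h3.forall_mem_list
  refine ⟨fun x => ∀ j < f x.1, ∃ n < x.2, p' ((x.1, j), n),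
    (PrimrecPred.comp h4 (f := fun x : α × ℕ => (List.range (f x.1), x)) (by fun_prop)).of_eq
      fun x => by simp, fun a => ?_⟩
  constructor
  · intro h
    choose! g hg using fun j hj => (hp (a, j)).1 (h j hj)
    refine ⟨(Finset.range (f a)).sup g + 1, fun j hj => ⟨g j, ?_, hg j hj⟩⟩
    exact Nat.lt_succ_of_le (Finset.le_sup (f := g) (Finset.mem_range.2 hj))
  · rintro ⟨B, h⟩ j hj
    obtain ⟨n, -, hn⟩ := h j hj
    exact (hp (a, j)).2 ⟨n, hn⟩

/-- The witness is a running time: `evaln` with a step bound is primitive recursive. -/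
theorem graph {f : α → β} (hf : Computable f) : RE fun x : α × β => f x.1 = x.2 := by
  obtain ⟨c, hc⟩ := Nat.Partrec.Code.exists_code.1 hf
  refine ⟨fun x => Nat.Partrec.Code.evaln x.2 c (Encodable.encode x.1.1)
      = some (Encodable.encode x.1.2), ?_, fun x => ?_⟩
  · refine Primrec.eq.comp ?_ (by fun_prop)
    exact Nat.Partrec.Code.primrec_evaln.comp (g := fun x : (α × β) × ℕ =>
      ((x.2, c), Encodable.encode x.1.1)) (by fun_prop)
  · have := @Nat.Partrec.Code.evaln_complete c (Encodable.encode x.1) (Encodable.encode x.2)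
    simp only [Option.mem_def] at this
    rw [← this, hc]
    simp [eq_comm]

theorem of_computablePred {p : α → Prop} (h : ComputablePred p) : RE p := by
  obtain ⟨_, h⟩ := h
  exact ((graph h).comp (f := fun a : α => (a, true)) (by fun_prop)).congr fun a => by simp

end RE

/-! ## Rational-valued primitive recursive functions -/

/-- The code of `(a - b) / (c + 1)`. -/
def ratCode (a b c : ℕ) : ℕ := Nat.pair (Nat.pair a b) c

theorem ratOf_ratCode (a b c : ℕ) :
    ((ratOf (ratCode a b c) : ℚ) : ℝ) = ((a : ℝ) - b) / (c + 1) := by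
  simp [ratOf, ratCode]

theorem ratOf_cast (k : ℕ) : ((ratOf k : ℚ) : ℝ) =
    ((k.unpair.1.unpair.1 : ℝ) - k.unpair.1.unpair.2) / (k.unpair.2 + 1) := by
  simp [ratOf]

theorem posRatOf_cast (k : ℕ) : ((posRatOf k : ℚ≥0) : ℝ) =
    ((k.unpair.1 : ℝ) + 1) / (k.unpair.2 + 1) := by
  simp [posRatOf]

theorem posRatOf_pos (k : ℕ) : (0 : ℝ) < ((posRatOf k : ℚ≥0) : ℝ) := by
  rw [posRatOf_cast]; positivity

theorem exists_ratOf (q : ℚ) : ∃ k, (ratOf k : ℝ) = q := by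
  have hd : ((q.den - 1 : ℕ) : ℝ) + 1 = q.den := by
    have := q.den_pos
    rw [← Nat.cast_add_one, Nat.sub_add_cancel this]
  refine ⟨ratCode q.num.toNat (-q.num).toNat (q.den - 1), ?_⟩
  rw [ratOf_ratCode, hd]
  have h : ((q.num.toNat : ℤ) - ((-q.num).toNat : ℤ)) = q.num := Int.toNat_sub_toNat_neg q.num
  have h' : ((q.num.toNat : ℝ) - ((-q.num).toNat : ℝ)) = q.num := by exact_mod_cast h
  rw [h', Rat.cast_def]

theorem exists_ratOf_btwn {x y : ℝ} (h : x < y) : ∃ k, x < (ratOf k : ℝ) ∧ (ratOf k : ℝ) < y := by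
  obtain ⟨q, h1, h2⟩ := exists_rat_btwn h
  obtain ⟨k, hk⟩ := exists_ratOf q
  exact ⟨k, by rwa [hk], by rwa [hk]⟩

theorem exists_posRatOf_btwn {x y : ℝ} (hx : 0 ≤ x) (h : x < y) :
    ∃ k, x < (posRatOf k : ℝ) ∧ (posRatOf k : ℝ) < y := by
  obtain ⟨q, h1, h2⟩ := exists_rat_btwn h
  have hq : 0 < q := by exact_mod_cast hx.trans_lt h1
  have hd : ((q.den - 1 : ℕ) : ℝ) + 1 = q.den := by
    have := q.den_pos
    rw [← Nat.cast_add_one, Nat.sub_add_cancel this]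
  have hn : ((q.num.toNat - 1 : ℕ) : ℝ) + 1 = q.num := by
    have h0 : 0 < q.num := Rat.num_pos.2 hq
    have h1 : 0 < q.num.toNat := by omega
    rw [← Nat.cast_add_one, Nat.sub_add_cancel h1]
    exact_mod_cast Int.toNat_of_nonneg h0.le
  have hk : (posRatOf (Nat.pair (q.num.toNat - 1) (q.den - 1)) : ℝ) = q := by
    rw [posRatOf_cast]
    simp only [Nat.unpair_pair]
    rw [hd, hn, Rat.cast_def]
  exact ⟨_, by rwa [hk], by rwa [hk]⟩

theorem abs_ratOf_le (k : ℕ) : |(ratOf k : ℝ)| ≤ k.unpair.1 := by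
  rw [ratOf_cast, abs_div, abs_of_pos (by positivity : (0 : ℝ) < (k.unpair.2 : ℝ) + 1)]
  refine (div_le_self (abs_nonneg _) (by linarith [Nat.cast_nonneg (α := ℝ) k.unpair.2])).trans ?_
  have h1 : (k.unpair.1.unpair.1 : ℝ) ≤ k.unpair.1 := by exact_mod_cast Nat.unpair_left_le _
  have h2 : (k.unpair.1.unpair.2 : ℝ) ≤ k.unpair.1 := by exact_mod_cast Nat.unpair_right_le _
  have h3 := Nat.cast_nonneg (α := ℝ) k.unpair.1.unpair.1
  have h4 := Nat.cast_nonneg (α := ℝ) k.unpair.1.unpair.2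
  rw [abs_le]; constructor <;> linarith

theorem abs_ratOf_le_self (k : ℕ) : |(ratOf k : ℝ)| ≤ k :=
  (abs_ratOf_le k).trans (by exact_mod_cast Nat.unpair_left_le k)

/-- Functions with rational values whose codes are given by a primitive recursive function. -/
@[fun_prop]
def QComp {α : Type*} [Primcodable α] (f : α → ℝ) : Prop :=
  ∃ g : α → ℕ, Primrec g ∧ ∀ a, f a = (ratOf (g a) : ℝ)

namespace QComp

variable {α β : Type*} [Primcodable α] [Primcodable β]

theorem of_code {f : α → ℝ} {a b c : α → ℕ} (ha : Primrec a) (hb : Primrec b) (hc : Primrec c)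
    (h : ∀ x, f x = ((a x : ℝ) - b x) / (c x + 1)) : QComp f :=
  ⟨fun x => ratCode (a x) (b x) (c x), by unfold ratCode; fun_prop, fun x => by
    rw [ratOf_ratCode, h]⟩

@[fun_prop]
theorem ratOf {f : α → ℕ} (hf : Primrec f) : QComp fun a => (ratOf (f a) : ℝ) :=
  ⟨f, hf, fun _ => rfl⟩

@[fun_prop]
theorem posRatOf {f : α → ℕ} (hf : Primrec f) : QComp fun a => (posRatOf (f a) : ℝ) :=
  of_code (a := fun x => (f x).unpair.1 + 1) (b := fun _ => 0) (c := fun x => (f x).unpair.2)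
    (by fun_prop) (by fun_prop) (by fun_prop) fun x => by
      rw [posRatOf_cast]; push_cast; ring

@[fun_prop]
theorem natCast {f : α → ℕ} (hf : Primrec f) : QComp fun a => (f a : ℝ) :=
  of_code (a := f) (b := fun _ => 0) (c := fun _ => 0)
    (by fun_prop) (by fun_prop) (by fun_prop) fun x => by simp

@[fun_prop]
theorem zero : QComp fun _ : α => (0 : ℝ) := by
  simpa using natCast (Primrec.const (α := α) 0)

@[fun_prop]
theorem one : QComp fun _ : α => (1 : ℝ) := by
  simpa using natCast (Primrec.const (α := α) 1)

@[fun_prop]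
theorem two : QComp fun _ : α => (2 : ℝ) := by
  simpa using natCast (Primrec.const (α := α) 2)

@[fun_prop]
theorem inv_two_pow {f : α → ℕ} (hf : Primrec f) : QComp fun a => (2 : ℝ)⁻¹ ^ f a :=
  of_code (a := fun _ => 1) (b := fun _ => 0) (c := fun x => 2 ^ f x - 1)
    (by fun_prop) (by fun_prop) (by fun_prop) fun x => by
      have : 1 ≤ 2 ^ f x := Nat.one_le_two_pow
      push_cast [this]; simp

@[fun_prop]
theorem inv_succ {f : α → ℕ} (hf : Primrec f) : QComp fun a => ((f a : ℝ) + 1)⁻¹ :=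
  of_code (a := fun _ => 1) (b := fun _ => 0) (c := f)
    (by fun_prop) (by fun_prop) (by fun_prop) fun x => by simp

@[fun_prop]
theorem neg {f : α → ℝ} (hf : QComp f) : QComp fun a => -f a := by
  obtain ⟨f', hf', hf⟩ := hf
  refine of_code (a := fun x => (f' x).unpair.1.unpair.2) (b := fun x => (f' x).unpair.1.unpair.1)
    (c := fun x => (f' x).unpair.2) (by fun_prop) (by fun_prop) (by fun_prop) fun x => ?_
  rw [hf, ratOf_cast]; ring

end QComp

/-- Addition of codes of rationals. -/
def addCode (k l : ℕ) : ℕ :=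
  ratCode (k.unpair.1.unpair.1 * (l.unpair.2 + 1) + l.unpair.1.unpair.1 * (k.unpair.2 + 1))
    (k.unpair.1.unpair.2 * (l.unpair.2 + 1) + l.unpair.1.unpair.2 * (k.unpair.2 + 1))
    (k.unpair.2 * l.unpair.2 + k.unpair.2 + l.unpair.2)

/-- Multiplication of codes of rationals. -/
def mulCode (k l : ℕ) : ℕ :=
  ratCode
    (k.unpair.1.unpair.1 * l.unpair.1.unpair.1 + k.unpair.1.unpair.2 * l.unpair.1.unpair.2)
    (k.unpair.1.unpair.1 * l.unpair.1.unpair.2 + k.unpair.1.unpair.2 * l.unpair.1.unpair.1)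
    (k.unpair.2 * l.unpair.2 + k.unpair.2 + l.unpair.2)

/-- Denominators are stored minus one, and `(c + 1) * (d + 1) = (c * d + c + d) + 1`. -/
theorem ratOf_addCode (k l : ℕ) : (ratOf (addCode k l) : ℝ) = ratOf k + ratOf l := by
  rw [addCode, ratOf_ratCode, ratOf_cast, ratOf_cast,
    div_add_div _ _ (by positivity) (by positivity)]
  push_cast
  congr 1 <;> ring

theorem ratOf_mulCode (k l : ℕ) : (ratOf (mulCode k l) : ℝ) = ratOf k * ratOf l := by
  rw [mulCode, ratOf_ratCode, ratOf_cast, ratOf_cast, div_mul_div_comm]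
  push_cast
  congr 1 <;> ring

namespace QComp

variable {α β : Type*} [Primcodable α] [Primcodable β]

@[fun_prop]
theorem _root_.Primrec.addCode_comp {f g : α → ℕ} (hf : Primrec f) (hg : Primrec g) :
    Primrec fun a => addCode (f a) (g a) := by
  unfold addCode ratCode; fun_prop

@[fun_prop]
theorem _root_.Primrec.mulCode_comp {f g : α → ℕ} (hf : Primrec f) (hg : Primrec g) :
    Primrec fun a => mulCode (f a) (g a) := by
  unfold mulCode ratCode; fun_prop

@[fun_prop]
theorem add {f g : α → ℝ} (hf : QComp f) (hg : QComp g) : QComp fun a => f a + g a := by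
  obtain ⟨f', hf', hf⟩ := hf
  obtain ⟨g', hg', hg⟩ := hg
  exact ⟨fun a => addCode (f' a) (g' a), by fun_prop, fun a => by simp only [ratOf_addCode, hf, hg]⟩

@[fun_prop]
theorem sub {f g : α → ℝ} (hf : QComp f) (hg : QComp g) : QComp fun a => f a - g a := by
  simp only [sub_eq_add_neg]; fun_prop

@[fun_prop]
theorem mul {f g : α → ℝ} (hf : QComp f) (hg : QComp g) : QComp fun a => f a * g a := by
  obtain ⟨f', hf', hf⟩ := hf
  obtain ⟨g', hg', hg⟩ := hg
  exact ⟨fun a => mulCode (f' a) (g' a), by fun_prop, fun a => by simp only [ratOf_mulCode, hf, hg]⟩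

@[fun_prop]
theorem comp {f : β → ℝ} (hf : QComp f) {g : α → β} (hg : Primrec g) :
    QComp fun a => f (g a) := by
  obtain ⟨f', hf', hf⟩ := hf
  exact ⟨fun a => f' (g a), by fun_prop, fun a => hf _⟩

@[fun_prop]
theorem pow {f : α → ℝ} (hf : QComp f) {n : α → ℕ} (hn : Primrec n) :
    QComp fun a => f a ^ n a := by
  obtain ⟨f', hf', hf⟩ := hf
  refine ⟨fun a => Nat.rec (ratCode 1 0 0) (fun _ r => mulCode r (f' a)) (n a),
    Primrec.nat_rec' hn (Primrec.const _)
      (Primrec.to₂ (f := fun q : α × ℕ × ℕ => mulCode q.2.2 (f' q.1)) (by fun_prop)), fun a => ?_⟩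
  beta_reduce
  induction n a with
  | zero => simp [ratOf_ratCode]
  | succ m ih => rw [pow_succ, ih, ratOf_mulCode, hf]

theorem sum {f : α × ℕ → ℝ} (hf : QComp f) {n : α → ℕ} (hn : Primrec n) :
    QComp fun a => ∑ i ∈ Finset.range (n a), f (a, i) := by
  obtain ⟨f', hf', hf⟩ := hf
  refine ⟨fun a => Nat.rec (ratCode 0 0 0) (fun i r => addCode r (f' (a, i))) (n a),
    Primrec.nat_rec' hn (Primrec.const _)
      (Primrec.to₂ (f := fun q : α × ℕ × ℕ => addCode q.2.2 (f' (q.1, q.2.1))) (by fun_prop)), fun a => ?_⟩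
  beta_reduce
  induction n a with
  | zero => simp [ratOf_ratCode]
  | succ m ih => rw [Finset.sum_range_succ, ih, ratOf_addCode, hf]

/-- Cross-multiplying and moving the subtracted parts to the other side leaves a comparison of
natural numbers. -/
theorem primrec_lt {f g : α → ℝ} (hf : QComp f) (hg : QComp g) :
    PrimrecPred fun a => f a < g a := by
  obtain ⟨f', hf', hf⟩ := hf
  obtain ⟨g', hg', hg⟩ := hg
  have : PrimrecPred fun a =>
      (f' a).unpair.1.unpair.1 * ((g' a).unpair.2 + 1) +
        (g' a).unpair.1.unpair.2 * ((f' a).unpair.2 + 1) <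
      (g' a).unpair.1.unpair.1 * ((f' a).unpair.2 + 1) +
        (f' a).unpair.1.unpair.2 * ((g' a).unpair.2 + 1) :=
    Primrec.nat_lt.comp (by fun_prop) (by fun_prop)
  refine this.of_eq fun a => ?_
  rw [hf, hg, ratOf_cast, ratOf_cast, div_lt_div_iff₀ (by positivity) (by positivity),
    ← Nat.cast_lt (α := ℝ)]
  push_cast
  constructor <;> intro h <;> linarith

theorem primrec_le {f g : α → ℝ} (hf : QComp f) (hg : QComp g) :
    PrimrecPred fun a => f a ≤ g a :=
  (hg.primrec_lt hf).not.of_eq fun _ => not_lt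

theorem ite {p : α → Prop} [DecidablePred p] (hp : PrimrecPred p) {f g : α → ℝ} (hf : QComp f)
    (hg : QComp g) : QComp fun a => if p a then f a else g a := by
  obtain ⟨f', hf', hf⟩ := hf
  obtain ⟨g', hg', hg⟩ := hg
  exact ⟨fun a => if p a then f' a else g' a, Primrec.ite hp hf' hg', fun a => by
    by_cases h : p a <;> simp [h, hf, hg]⟩

theorem re_lt {f g : α → ℝ} (hf : QComp f) (hg : QComp g) : RE fun a => f a < g a :=
  .of_primrec (hf.primrec_lt hg)

theorem re_le {f g : α → ℝ} (hf : QComp f) (hg : QComp g) : RE fun a => f a ≤ g a :=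
  .of_primrec (hf.primrec_le hg)

end QComp

/-! ## Semidecidable predicates of a point -/

/-- The intersection of the basic balls coded by a list. -/
def nb (X : Type*) [MetricPresentation X] (l : List ℕ) : Set X :=
  {x | ∀ b ∈ l, x ∈ basicBall X b}

/-- A family of predicates on `X` is semidecidable on `A` if it is given on `A` by a uniformly
recursively enumerable family of finite intersections of basic balls. -/
def SD {α X : Type*} [Primcodable α] [MetricPresentation X] (A : Set X) (U : α → X → Prop) :
    Prop :=
  ∃ R : α × List ℕ → Prop, RE R ∧ ∀ a, ∀ x ∈ A, U a x ↔ ∃ l, R (a, l) ∧ x ∈ nb X l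

namespace SD

variable {α β X Y : Type*} [Primcodable α] [Primcodable β] [MetricPresentation X]
  [MetricPresentation Y] {A B : Set X}

theorem congr {U V : α → X → Prop} (h : SD A U) (H : ∀ a, ∀ x ∈ A, V a x ↔ U a x) : SD A V := by
  obtain ⟨R, hR, h⟩ := h
  exact ⟨R, hR, fun a x hx => (H a x hx).trans (h a x hx)⟩

theorem mono {U : α → X → Prop} (h : SD B U) (hAB : A ⊆ B) : SD A U := by
  obtain ⟨R, hR, h⟩ := h
  exact ⟨R, hR, fun a x hx => h a x (hAB hx)⟩

theorem of_re {p : α → Prop} (h : RE p) : SD A fun a (_ : X) => p a :=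
  ⟨fun y => p y.1, h.comp (by fun_prop), fun a x _ =>
    ⟨fun h => ⟨[], h, by simp [nb]⟩, fun ⟨_, h, _⟩ => h⟩⟩

theorem ball {f : α → ℕ} (hf : Primrec f) : SD A fun a (x : X) => x ∈ basicBall X (f a) :=
  ⟨fun y => y.2 = [f y.1], .eq (by fun_prop) (by fun_prop), fun a x _ => by simp [nb]⟩

theorem comp {U : β → X → Prop} (h : SD A U) {f : α → β} (hf : Primrec f) :
    SD A fun a x => U (f a) x := by
  obtain ⟨R, hR, h⟩ := h
  exact ⟨fun y => R (f y.1, y.2), hR.comp (by fun_prop), fun a x hx => h _ x hx⟩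

theorem and {U V : α → X → Prop} (hU : SD A U) (hV : SD A V) :
    SD A fun a x => U a x ∧ V a x := by
  obtain ⟨R, hR, hU⟩ := hU
  obtain ⟨S, hS, hV⟩ := hV
  refine ⟨fun y => ∃ m : List ℕ × List ℕ, y.2 = m.1 ++ m.2 ∧ R (y.1, m.1) ∧ S (y.1, m.2),
    .ex <| .and (.eq (by fun_prop) (by fun_prop)) <| .and
      (hR.comp (f := fun z : (α × List ℕ) × (List ℕ × List ℕ) => (z.1.1, z.2.1)) (by fun_prop))
      (hS.comp (f := fun z : (α × List ℕ) × (List ℕ × List ℕ) => (z.1.1, z.2.2)) (by fun_prop)),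
    fun a x hx => ?_⟩
  simp only [hU a x hx, hV a x hx]
  constructor
  · rintro ⟨⟨l, hl, hxl⟩, m, hm, hxm⟩
    refine ⟨l ++ m, ⟨(l, m), rfl, hl, hm⟩, fun b hb => ?_⟩
    exact (List.mem_append.1 hb).elim (hxl b) (hxm b)
  · rintro ⟨_, ⟨⟨l, m⟩, rfl, hl, hm⟩, h⟩
    exact ⟨⟨l, hl, fun b hb => h b (by simp [hb])⟩, m, hm, fun b hb => h b (by simp [hb])⟩

theorem or {U V : α → X → Prop} (hU : SD A U) (hV : SD A V) :
    SD A fun a x => U a x ∨ V a x := by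
  obtain ⟨R, hR, hU⟩ := hU
  obtain ⟨S, hS, hV⟩ := hV
  refine ⟨fun y => R y ∨ S y, hR.or hS, fun a x hx => ?_⟩
  simp only [hU a x hx, hV a x hx, or_and_right, exists_or]

theorem ex {U : α → β → X → Prop} (h : SD A fun (p : α × β) x => U p.1 p.2 x) :
    SD A fun a x => ∃ b, U a b x := by
  obtain ⟨R, hR, h⟩ := h
  refine ⟨fun y => ∃ b, R ((y.1, b), y.2), .ex (hR.comp
    (f := fun z : (α × List ℕ) × β => ((z.1.1, z.2), z.1.2)) (by fun_prop)), fun a x hx => ?_⟩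
  constructor
  · rintro ⟨b, hb⟩
    obtain ⟨l, hl, hx⟩ := (h (a, b) x hx).1 hb
    exact ⟨l, ⟨b, hl⟩, hx⟩
  · rintro ⟨l, ⟨b, hl⟩, hxl⟩
    exact ⟨b, (h (a, b) x hx).2 ⟨l, hl, hxl⟩⟩

/-- The lists that witness the single conditions are concatenated, which intersects the
neighbourhoods. The default `[]` is harmless because it imposes no condition on the point. -/
theorem forall_lt {U : α → ℕ → X → Prop} (h : SD A fun (p : α × ℕ) x => U p.1 p.2 x)
    {f : α → ℕ} (hf : Primrec f) : SD A fun a x => ∀ j < f a, U a j x := by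
  obtain ⟨R, hR, h⟩ := h
  refine ⟨fun y => ∃ L : List (List ℕ), y.2 = L.flatten ∧ ∀ j < f y.1, R ((y.1, j), L.getD j []),
    .ex (.and (.eq (by fun_prop) (by fun_prop)) (.forall_lt (hR.comp
      (f := fun z : ((α × List ℕ) × List (List ℕ)) × ℕ => ((z.1.1.1, z.2), z.1.2.getD z.2 []))
      (by fun_prop)) (by fun_prop))), fun a x hx => ?_⟩
  constructor
  · intro H
    choose! m hm hxm using fun j hj => (h (a, j) x hx).1 (H j hj)
    refine ⟨_, ⟨(List.range (f a)).map m, rfl, fun j hj => ?_⟩, ?_⟩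
    · simpa [List.getD_eq_getElem?_getD, hj] using hm j hj
    · intro b hb
      simp only [List.mem_flatten, List.mem_map, List.mem_range] at hb
      obtain ⟨_, ⟨j, hj, rfl⟩, hb⟩ := hb
      exact hxm j hj b hb
  · rintro ⟨_, ⟨L, rfl, hL⟩, hxL⟩ j hj
    refine (h (a, j) x hx).2 ⟨_, hL j hj, fun b hb => hxL b ?_⟩
    rw [List.mem_flatten]
    by_cases hjL : j < L.length
    · exact ⟨L[j], by simp, by simpa [List.getD_eq_getElem?_getD, hjL] using hb⟩
    · simp [List.getD_eq_getElem?_getD, hjL] at hb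

/-- The same r.e. family is read at all points. What it says off `A` is arbitrary; this is the
source of the uncontrolled values that are damped later. -/
theorem exists_univ {U : α → X → Prop} (h : SD A U) :
    ∃ V : α → X → Prop, SD Set.univ V ∧ ∀ a, ∀ x ∈ A, U a x ↔ V a x := by
  obtain ⟨R, hR, h⟩ := h
  exact ⟨fun a x => ∃ l, R (a, l) ∧ x ∈ nb X l, ⟨R, hR, fun _ _ _ => Iff.rfl⟩, h⟩

end SD

/-- Maps for which preimages of basic balls are semidecidable. -/
def SDMap {X Y : Type*} [MetricPresentation X] [MetricPresentation Y] (A : Set X) (f : X → Y) :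
    Prop :=
  SD A fun (b : ℕ) x => f x ∈ basicBall Y b

section Subst

variable {α X Y Z : Type*} [Primcodable α] [MetricPresentation X]
  [MetricPresentation Y] [MetricPresentation Z] {A : Set X} {B : Set Y}

/-- That `f x` lies in the intersection coded by a list is a bounded conjunction of preimages of
balls. -/
theorem SD.subst {U : α → Y → Prop} (hU : SD B U) {f : X → Y} (hf : SDMap A f)
    (hAB : Set.MapsTo f A B) : SD A fun a x => U a (f x) := by
  obtain ⟨R, hR, h⟩ := hU
  have h1 : SD A fun a x => ∃ l : List ℕ, R (a, l) ∧
      ∀ j < l.length, f x ∈ basicBall Y (l.getD j 0) :=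
    .ex <| .and (.of_re hR) <| .forall_lt
      (hf.comp (f := fun p : (α × List ℕ) × ℕ => p.1.2.getD p.2 0) (by fun_prop)) (by fun_prop)
  refine h1.congr fun a x hx => (h a (f x) (hAB hx)).trans (exists_congr fun l => ?_)
  refine and_congr_right fun _ => ⟨fun hl j hj => hl _ ?_, fun hl b hb => ?_⟩
  · simp [List.getD_eq_getElem?_getD, hj]
  · obtain ⟨j, hj, rfl⟩ := List.getElem_of_mem hb
    simpa [List.getD_eq_getElem?_getD, hj] using hl j hj

theorem SDMap.comp {g : Y → Z} (hg : SDMap B g) {f : X → Y} (hf : SDMap A f)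
    (hAB : Set.MapsTo f A B) : SDMap A fun x => g (f x) :=
  SD.subst hg hf hAB

theorem SDMap.id : SDMap A fun x : X => x := SD.ball (by fun_prop)

end Subst

/-! ## Effectively presented spaces -/

/-- The properties of a presentation on which the theory below rests. -/
class EffPres (X : Type*) [MetricPresentation X] : Prop where
  d_self (x : X) : d x x = 0
  d_comm (x y : X) : d x y = d y x
  d_triangle (x y z : X) : d x z ≤ d x y + d y z
  exists_basic (x : X) {ε : ℝ} (hε : 0 < ε) : ∃ n, d (basic n) x < ε
  re_dist_lt : RE fun p : (ℕ × ℕ) × ℕ => d (basic p.1.1 : X) (basic p.1.2) < ratOf p.2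
  re_lt_dist : RE fun p : (ℕ × ℕ) × ℕ => (ratOf p.2 : ℝ) < d (basic p.1.1 : X) (basic p.1.2)

namespace EffPres

variable {α X : Type*} [Primcodable α] [MetricPresentation X] [EffPres X]

theorem d_nonneg (x y : X) : 0 ≤ d x y := by
  have := d_triangle x y x
  rw [d_self, d_comm y x] at this
  linarith

variable (X) in
theorem re_dist_lt' {c c' : α → ℕ} {q : α → ℝ} (hc : Primrec c) (hc' : Primrec c')
    (hq : QComp q) : RE fun a => d (basic (c a) : X) (basic (c' a)) < q a := by
  obtain ⟨g, hg, hq⟩ := hq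
  exact ((re_dist_lt (X := X)).comp (f := fun a => ((c a, c' a), g a)) (by fun_prop)).congr
    fun a => by simp [hq]

variable (X) in
theorem re_lt_dist' {c c' : α → ℕ} {q : α → ℝ} (hc : Primrec c) (hc' : Primrec c')
    (hq : QComp q) : RE fun a => q a < d (basic (c a) : X) (basic (c' a)) := by
  obtain ⟨g, hg, hq⟩ := hq
  exact ((re_lt_dist (X := X)).comp (f := fun a => ((c a, c' a), g a)) (by fun_prop)).congr
    fun a => by simp [hq]

theorem exists_ball (x : X) {ε : ℝ} (hε : 0 < ε) :
    ∃ b : ℕ, x ∈ basicBall X b ∧ (posRatOf b.unpair.2 : ℝ) < ε := by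
  obtain ⟨c, hc⟩ := exists_basic x hε
  obtain ⟨r, h1, h2⟩ := exists_posRatOf_btwn (d_nonneg _ _) hc
  exact ⟨Nat.pair c r, by simpa [basicBall] using h1, by simpa using h2⟩

end EffPres

theorem ComputableRealSeq.abs_sub_le {f : ℕ → ℝ} {g : ℕ × ℕ → ℕ} {n : ℕ}
    (h1 : ∀ i j : ℕ, i ≤ j → |(ratOf (g (n, j)) : ℝ) - (ratOf (g (n, i)) : ℝ)| ≤ (2 : ℝ)⁻¹ ^ i)
    (h2 : Tendsto (fun i => (ratOf (g (n, i)) : ℝ)) atTop (𝓝 (f n))) (i : ℕ) :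
    |f n - ratOf (g (n, i))| ≤ (2 : ℝ)⁻¹ ^ i :=
  le_of_tendsto (h2.sub_const _).abs (eventually_atTop.2 ⟨i, fun j hj => h1 i j hj⟩)

/-- The `i`-th approximation has error at most `2⁻ⁱ`, so a strict inequality is eventually confirmed
with this margin. Completeness uses `2 * 2⁻ⁱ`: once for the error and once for the margin. -/
theorem ComputableRealSeq.re {f : ℕ → ℝ} (hf : ComputableRealSeq f) :
    (RE fun p : ℕ × ℕ => f p.1 < ratOf p.2) ∧ RE fun p : ℕ × ℕ => (ratOf p.2 : ℝ) < f p.1 := by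
  obtain ⟨g, hg, H⟩ := hf
  have hb := fun n i => ComputableRealSeq.abs_sub_le (H n).1 (H n).2 i
  have hlim : Tendsto (fun i : ℕ => 2 * (2 : ℝ)⁻¹ ^ i) atTop (𝓝 0) := by
    simpa using (tendsto_pow_atTop_nhds_zero_of_lt_one (r := (2 : ℝ)⁻¹) (by norm_num)
      (by norm_num)).const_mul 2
  have hgr : RE fun z : (ℕ × ℕ) × (ℕ × ℕ) => g (z.1.1, z.2.1) = z.2.2 :=
    (RE.graph hg).comp (f := fun z : (ℕ × ℕ) × (ℕ × ℕ) => ((z.1.1, z.2.1), z.2.2)) (by fun_prop)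
  constructor
  · have : RE fun p : ℕ × ℕ => ∃ m : ℕ × ℕ, g (p.1, m.1) = m.2 ∧
        (ratOf m.2 : ℝ) + 2⁻¹ ^ m.1 < ratOf p.2 :=
      .ex <| hgr.and (QComp.re_lt (by fun_prop) (by fun_prop))
    refine this.congr fun ⟨n, q⟩ => ⟨fun h => ?_, ?_⟩
    · obtain ⟨i, hi⟩ := (hlim.eventually_lt_const (sub_pos.2 h)).exists
      refine ⟨(i, g (n, i)), rfl, ?_⟩
      have := abs_le.1 (hb n i)
      simp only at hi ⊢
      linarith
    · rintro ⟨⟨i, m⟩, hm, h⟩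
      have := abs_le.1 (hb n i)
      simp only at hm h ⊢
      rw [hm] at this
      linarith
  · have : RE fun p : ℕ × ℕ => ∃ m : ℕ × ℕ, g (p.1, m.1) = m.2 ∧
        (ratOf p.2 : ℝ) < ratOf m.2 - 2⁻¹ ^ m.1 :=
      .ex <| hgr.and (QComp.re_lt (by fun_prop) (by fun_prop))
    refine this.congr fun ⟨n, q⟩ => ⟨fun h => ?_, ?_⟩
    · obtain ⟨i, hi⟩ := (hlim.eventually_lt_const (sub_pos.2 h)).exists
      refine ⟨(i, g (n, i)), rfl, ?_⟩
      have := abs_le.1 (hb n i)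
      simp only at hi ⊢
      linarith
    · rintro ⟨⟨i, m⟩, hm, h⟩
      have := abs_le.1 (hb n i)
      simp only at hm h ⊢
      rw [hm] at this
      linarith

instance ComputableMetricSpace.effPres {X : Type*} [ComputableMetricSpace X] : EffPres X where
  d_self := dist_self
  d_comm := dist_comm
  d_triangle := dist_triangle
  exists_basic x ε hε := by
    obtain ⟨n, hn⟩ := (ComputableMetricSpace.dense (X := X)).exists_dist_lt x hε
    exact ⟨n, (dist_comm _ _).trans_lt hn⟩
  re_dist_lt := ((ComputableMetricSpace.computable_dist (X := X)).re.1.comp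
    (f := fun p : (ℕ × ℕ) × ℕ => (Nat.pair p.1.1 p.1.2, p.2)) (by fun_prop)).congr fun p => by
      simp [MetricPresentation.d, MetricPresentation.basic]
  re_lt_dist := ((ComputableMetricSpace.computable_dist (X := X)).re.2.comp
    (f := fun p : (ℕ × ℕ) × ℕ => (Nat.pair p.1.1 p.1.2, p.2)) (by fun_prop)).congr fun p => by
      simp [MetricPresentation.d, MetricPresentation.basic]

theorem QComp.abs_sub {α : Type*} [Primcodable α] {f g : α → ℝ} (hf : QComp f) (hg : QComp g) :
    QComp fun a => |f a - g a| := by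
  classical
  have h := QComp.ite (hf.primrec_lt hg) (hg.sub hf) (hf.sub hg)
  refine (funext fun a => ?_ : (fun a => |f a - g a|) = _) ▸ h
  split_ifs with hlt
  · rw [abs_of_neg (by linarith), neg_sub]
  · rw [abs_of_nonneg (by linarith)]

instance MetricPresentation.instNat_effPres : EffPres ℕ where
  d_self := dist_self
  d_comm := dist_comm
  d_triangle := dist_triangle
  exists_basic x ε hε := ⟨x, by simpa [MetricPresentation.d, MetricPresentation.basic] using hε⟩
  re_dist_lt := (QComp.re_lt (.abs_sub (f := fun p : (ℕ × ℕ) × ℕ => (p.1.1 : ℝ))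
      (g := fun p => (p.1.2 : ℝ)) (by fun_prop) (by fun_prop))
      (g := fun p => ratOf p.2) (by fun_prop)).congr fun _ => by
    simp only [MetricPresentation.d, MetricPresentation.basic, Nat.dist_eq]
  re_lt_dist := (QComp.re_lt (f := fun p : (ℕ × ℕ) × ℕ => (ratOf p.2 : ℝ))
      (g := fun p => |(p.1.1 : ℝ) - (p.1.2 : ℝ)|) (by fun_prop)
      (.abs_sub (by fun_prop) (by fun_prop))).congr fun _ => by
    simp only [MetricPresentation.d, MetricPresentation.basic, Nat.dist_eq]

instance MetricPresentation.instReal_effPres : EffPres ℝ where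
  d_self := dist_self
  d_comm := dist_comm
  d_triangle := dist_triangle
  exists_basic x ε hε := by
    obtain ⟨k, h1, h2⟩ := exists_ratOf_btwn (lt_add_of_pos_right x hε)
    refine ⟨k, ?_⟩
    simp only [MetricPresentation.d, MetricPresentation.basic, Real.dist_eq]
    rw [abs_of_pos] <;> linarith
  re_dist_lt := (QComp.re_lt (.abs_sub (f := fun p : (ℕ × ℕ) × ℕ => (ratOf p.1.1 : ℝ))
      (g := fun p => (ratOf p.1.2 : ℝ)) (by fun_prop) (by fun_prop))
      (g := fun p => ratOf p.2) (by fun_prop)).congr fun _ => by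
    simp only [MetricPresentation.d, MetricPresentation.basic, Real.dist_eq]
  re_lt_dist := (QComp.re_lt (f := fun p : (ℕ × ℕ) × ℕ => (ratOf p.2 : ℝ))
      (g := fun p => |(ratOf p.1.1 : ℝ) - (ratOf p.1.2 : ℝ)|) (by fun_prop)
      (.abs_sub (by fun_prop) (by fun_prop))).congr fun _ => by
    simp only [MetricPresentation.d, MetricPresentation.basic, Real.dist_eq]

instance MetricPresentation.instProd_effPres {X Y : Type*} [MetricPresentation X] [EffPres X]
    [MetricPresentation Y] [EffPres Y] : EffPres (X × Y) where
  d_self x := by simp [MetricPresentation.d, EffPres.d_self]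
  d_comm x y := by simp [MetricPresentation.d, EffPres.d_comm]
  d_triangle x y z := max_le
    ((EffPres.d_triangle _ y.1 _).trans (add_le_add (le_max_left _ _) (le_max_left _ _)))
    ((EffPres.d_triangle _ y.2 _).trans (add_le_add (le_max_right _ _) (le_max_right _ _)))
  exists_basic x ε hε := by
    obtain ⟨m, hm⟩ := EffPres.exists_basic x.1 hε
    obtain ⟨n, hn⟩ := EffPres.exists_basic x.2 hε
    exact ⟨Nat.pair m n, by simpa [MetricPresentation.d, MetricPresentation.basic] using ⟨hm, hn⟩⟩
  re_dist_lt := ((EffPres.re_dist_lt' X (c := fun p : (ℕ × ℕ) × ℕ => p.1.1.unpair.1)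
      (c' := fun p => p.1.2.unpair.1) (q := fun p => ratOf p.2)
      (by fun_prop) (by fun_prop) (by fun_prop)).and
    (EffPres.re_dist_lt' Y (c := fun p : (ℕ × ℕ) × ℕ => p.1.1.unpair.2)
      (c' := fun p => p.1.2.unpair.2) (q := fun p => ratOf p.2)
      (by fun_prop) (by fun_prop) (by fun_prop))).congr fun p => max_lt_iff
  re_lt_dist := ((EffPres.re_lt_dist' X (c := fun p : (ℕ × ℕ) × ℕ => p.1.1.unpair.1)
      (c' := fun p => p.1.2.unpair.1) (q := fun p => ratOf p.2)
      (by fun_prop) (by fun_prop) (by fun_prop)).or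
    (EffPres.re_lt_dist' Y (c := fun p : (ℕ × ℕ) × ℕ => p.1.1.unpair.2)
      (c' := fun p => p.1.2.unpair.2) (q := fun p => ratOf p.2)
      (by fun_prop) (by fun_prop) (by fun_prop))).congr fun p => lt_max_iff

/-! ## Computable maps and semidecidability -/

/-- The code of the radius `2 ^ (-n)`. -/
def radCode (n : ℕ) : ℕ := Nat.pair 0 (2 ^ n - 1)

theorem posRatOf_radCode (n : ℕ) : ((posRatOf (radCode n) : ℚ≥0) : ℝ) = 2⁻¹ ^ n := by
  have : 1 ≤ 2 ^ n := Nat.one_le_two_pow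
  rw [posRatOf_cast, radCode]
  push_cast [Nat.unpair_pair, this]
  simp

@[fun_prop]
theorem Primrec.radCode_comp {α : Type*} [Primcodable α] {f : α → ℕ} (hf : Primrec f) :
    Primrec fun a => radCode (f a) := by
  unfold radCode; fun_prop

theorem mem_basicBall_pair {X : Type*} [MetricPresentation X] {c r : ℕ} {x : X} :
    x ∈ basicBall X (Nat.pair c r) ↔ d (basic c) x < (posRatOf r : ℝ) := by
  simp [basicBall]

theorem mem_basicBall {X : Type*} [MetricPresentation X] {b : ℕ} {x : X} :
    x ∈ basicBall X b ↔ d (basic b.unpair.1) x < (posRatOf b.unpair.2 : ℝ) := Iff.rfl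

theorem exists_inv_two_pow_lt {ε : ℝ} (hε : 0 < ε) : ∃ n : ℕ, (2 : ℝ)⁻¹ ^ n < ε :=
  exists_pow_lt_of_lt_one hε (by norm_num)

theorem inv_two_pow_anti {m n : ℕ} (h : m ≤ n) : (2 : ℝ)⁻¹ ^ n ≤ 2⁻¹ ^ m :=
  pow_le_pow_of_le_one (by norm_num) (by norm_num) h

/-! ### Cauchy names and their finite initial segments -/

section Names

variable {X : Type*} [MetricPresentation X] [EffPres X]

theorem IsCauchyName.d_le {h : ℕ → ℕ} {x : X} (hx : IsCauchyName h x) (i : ℕ) :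
    d (basic (h i)) x ≤ 2⁻¹ ^ i := by
  refine le_of_forall_pos_le_add fun ε hε => ?_
  obtain ⟨j, hj, hij⟩ := ((hx.2.eventually_lt_const hε).and (eventually_ge_atTop i)).exists
  have h1 := EffPres.d_triangle (basic (h i)) (basic (h j)) x
  have h2 := hx.1 i j hij
  rw [EffPres.d_comm] at h2
  linarith

theorem isCauchyName_of_le {h : ℕ → ℕ} {x : X}
    (h1 : ∀ i j : ℕ, i ≤ j → d (basic (h j) : X) (basic (h i)) ≤ 2⁻¹ ^ i)
    (h2 : ∀ᶠ i in atTop, d (basic (h i)) x ≤ 2⁻¹ ^ i) : IsCauchyName h x :=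
  ⟨h1, squeeze_zero' (Eventually.of_forall fun i => EffPres.d_nonneg _ _) h2
    (tendsto_pow_atTop_nhds_zero_of_lt_one (by norm_num) (by norm_num))⟩

/-- Halved errors add up to less than `2⁻ⁱ`. The strict form of the conclusion matters: strict
inequalities between basic points can be enumerated. -/
theorem isCauchyName_of_lt {h : ℕ → ℕ} {x : X}
    (hx : ∀ i, d (basic (h i)) x < 2⁻¹ ^ (i + 1)) :
    IsCauchyName h x ∧ ∀ i j : ℕ, i ≤ j → d (basic (h j) : X) (basic (h i)) < 2⁻¹ ^ i := by
  have key : ∀ i j : ℕ, i ≤ j → d (basic (h j) : X) (basic (h i)) < 2⁻¹ ^ i := fun i j hij => by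
    have h1 := EffPres.d_triangle (basic (h j)) x (basic (h i))
    rw [EffPres.d_comm x] at h1
    have h2 := hx i
    have h3 := hx j
    have h4 := inv_two_pow_anti (Nat.succ_le_succ hij)
    have h5 : (2 : ℝ)⁻¹ ^ (i + 1) + 2⁻¹ ^ (i + 1) = 2⁻¹ ^ i := by rw [pow_succ]; ring
    simp only [Nat.succ_eq_add_one] at h4
    linarith
  exact ⟨isCauchyName_of_le (fun i j hij => (key i j hij).le) (Eventually.of_forall fun i =>
    (hx i).le.trans (inv_two_pow_anti (Nat.le_succ i))), key⟩

/-- A finite sequence of basic points that satisfies the conditions on a Cauchy name strictly and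
is compatible with `x` can be extended to a Cauchy name of `x`. -/
theorem exists_isCauchyName_extending {w : List ℕ} {x : X}
    (hw : ∀ j < w.length, ∀ i < j,
      d (basic (w.getD j 0) : X) (basic (w.getD i 0)) < 2⁻¹ ^ i)
    (hx : ∀ i < w.length, d (basic (w.getD i 0)) x < 2⁻¹ ^ i) :
    ∃ h : ℕ → ℕ, IsCauchyName h x ∧ (List.range w.length).map h = w := by
  -- A common slack `δ`: later entries chosen within `δ` of `x` satisfy the Cauchy condition against
  -- every entry of `w`.
  obtain ⟨δ, hδ, hδw⟩ : ∃ δ > 0, ∀ i < w.length, d (basic (w.getD i 0)) x + δ < 2⁻¹ ^ i := by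
    have : ∀ᶠ δ in 𝓝[>] (0 : ℝ), ∀ i ∈ Finset.range w.length,
        d (basic (w.getD i 0)) x + δ < 2⁻¹ ^ i := by
      refine (Finset.eventually_all _).2 fun i hi => nhdsWithin_le_nhds ?_
      have := hx i (Finset.mem_range.1 hi)
      filter_upwards [gt_mem_nhds (sub_pos.2 this)] with δ hδ
      linarith
    obtain ⟨δ, h1, h2⟩ := (this.and self_mem_nhdsWithin).exists
    exact ⟨δ, h2, fun i hi => h1 i (Finset.mem_range.2 hi)⟩
  choose a ha using fun i : ℕ => EffPres.exists_basic x (ε := min δ (2⁻¹ ^ (i + 1)))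
    (by positivity)
  have hlt : ∀ i < w.length, (if i < w.length then w.getD i 0 else a i) = w.getD i 0 :=
    fun i hi => if_pos hi
  refine ⟨fun i => if i < w.length then w.getD i 0 else a i, isCauchyName_of_le ?_ ?_, ?_⟩
  · intro i j hij
    rcases hij.eq_or_lt with rfl | hij
    · rw [EffPres.d_self]; positivity
    by_cases hj : j < w.length
    · simp only [hj, hij.trans hj, if_true]
      exact (hw j hj i hij).le
    · have h1 := ha j
      rw [lt_min_iff] at h1
      by_cases hi : i < w.length
      · simp only [hj, hi, if_true, if_false]
        have h2 := EffPres.d_triangle (basic (a j)) x (basic (w.getD i 0))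
        rw [EffPres.d_comm x] at h2
        linarith [hδw i hi]
      · simp only [hj, hi, if_false]
        have h2 := EffPres.d_triangle (basic (a j)) x (basic (a i))
        rw [EffPres.d_comm x] at h2
        have h3 := ha i
        rw [lt_min_iff] at h3
        have h4 := inv_two_pow_anti (Nat.succ_le_succ hij.le)
        have h5 : (2 : ℝ)⁻¹ ^ (i + 1) + 2⁻¹ ^ (i + 1) = 2⁻¹ ^ i := by rw [pow_succ]; ring
        simp only [Nat.succ_eq_add_one] at h4
        linarith
  · filter_upwards [eventually_ge_atTop w.length] with i hi
    simp only [not_lt.2 hi, if_false]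
    have h3 := ha i
    rw [lt_min_iff] at h3
    exact h3.2.le.trans (inv_two_pow_anti (Nat.le_succ i))
  · refine List.ext_getElem (by simp) fun i h1 h2 => ?_
    simp [List.getD_eq_getElem?_getD, h2]

end Names

theorem List.getD_map_range {h : ℕ → ℕ} {k i : ℕ} (hi : i < k) :
    ((List.range k).map h).getD i 0 = h i := by
  simp [List.getD_eq_getElem?_getD, hi]

theorem List.take_map_range {h : ℕ → ℕ} {k i : ℕ} (hi : i ≤ k) :
    ((List.range k).map h).take i = (List.range i).map h := by
  rw [← List.map_take, List.take_range, min_eq_left hi]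

/-! ### From machines on names to semidecidable preimages -/

section Forward

variable {X Y : Type*} [MetricPresentation X] [EffPres X] [MetricPresentation Y] [EffPres Y]
  {A : Set X} {f : X → Y}

/-- To enumerate the preimage of a ball, search for a finite word on which the machine produces an
`n`-th output `m` such that the ball around `m` of radius `2⁻ⁿ` lies formally in the target. If the
word is strictly Cauchy and strictly compatible with `x`, it extends to a name of `x`, so `m` really
approximates `f x`. Conversely, a sufficiently fast name of `x` provides such a word. -/
theorem ComputableMapOn.sdMap (hf : ComputableMapOn f A) : SDMap A f := by
  obtain ⟨F, ⟨φ, hφ, hF⟩, H⟩ := hf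
  have hgr {α : Type} [Primcodable α] {w : α → List ℕ} {n : α → ℕ} {o : α → Option ℕ}
      (hw : Primrec w) (hn : Primrec n) (ho : Primrec o) : RE fun a => φ (w a, n a) = o a :=
    (RE.graph hφ).comp (f := fun a => ((w a, n a), o a)) (by fun_prop)
  have key : SD A fun (b : ℕ) (x : X) => ∃ p : List ℕ × ℕ × ℕ,
      (φ (p.1, p.2.1) = some p.2.2 ∧ (∀ j < p.1.length, φ (p.1.take j, p.2.1) = none) ∧
        (∀ j < p.1.length, ∀ i < j,
          d (basic (p.1.getD j 0) : X) (basic (p.1.getD i 0)) < 2⁻¹ ^ i) ∧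
        d (basic b.unpair.1 : Y) (basic p.2.2) < (posRatOf b.unpair.2 : ℝ) - 2⁻¹ ^ p.2.1) ∧
      ∀ i < p.1.length, x ∈ basicBall X (Nat.pair (p.1.getD i 0) (radCode i)) := by
    refine .ex <| .and (.of_re ?_) (.forall_lt (.ball (by fun_prop)) (by fun_prop))
    refine .and (hgr (by fun_prop) (by fun_prop) (by fun_prop)) <| .and
      (.forall_lt (hgr (by fun_prop) (by fun_prop) (by fun_prop)) (by fun_prop)) <| .and
      (.forall_lt (.forall_lt (EffPres.re_dist_lt' X (by fun_prop) (by fun_prop) (by fun_prop))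
        (by fun_prop)) (by fun_prop))
      (EffPres.re_dist_lt' Y (by fun_prop) (by fun_prop) (by fun_prop))
  refine key.congr fun b x hx => ⟨fun hb => ?_, ?_⟩
  · choose h hh using fun i : ℕ => EffPres.exists_basic x (ε := 2⁻¹ ^ (i + 1)) (by positivity)
    obtain ⟨hname, hstrict⟩ := isCauchyName_of_lt hh
    obtain ⟨g, hg, hgname⟩ := H x hx h hname
    rw [mem_basicBall] at hb
    obtain ⟨n, hn⟩ := exists_inv_two_pow_lt (half_pos (sub_pos.2 hb))
    obtain ⟨k, hk, hk'⟩ := (hF h g).1 hg n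
    refine ⟨((List.range k).map h, n, g n), ⟨hk, fun j hj => ?_, fun j hj i hi => ?_, ?_⟩,
      fun i hi => ?_⟩
    · simp only [List.length_map, List.length_range] at hj
      simp only [List.take_map_range hj.le]
      exact hk' j hj
    · simp only [List.length_map, List.length_range] at hj
      simp only [List.getD_map_range hj, List.getD_map_range (hi.trans hj)]
      exact hstrict i j hi.le
    · have h1 := hgname.d_le n
      have h2 := EffPres.d_triangle (basic b.unpair.1) (f x) (basic (g n))
      rw [EffPres.d_comm (f x)] at h2
      simp only
      linarith
    · simp only [List.length_map, List.length_range] at hi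
      rw [mem_basicBall_pair, posRatOf_radCode, List.getD_map_range hi]
      have := hh i
      exact this.trans_le (inv_two_pow_anti (Nat.le_succ i))
  · rintro ⟨⟨w, n, m⟩, ⟨h1, h2, h3, h4⟩, h5⟩
    simp only at h1 h2 h3 h4 h5
    simp only [mem_basicBall_pair, posRatOf_radCode] at h5
    obtain ⟨h, hname, hw⟩ := exists_isCauchyName_extending h3 h5
    obtain ⟨g, hg, hgname⟩ := H x hx h hname
    obtain ⟨k, hk, hk'⟩ := (hF h g).1 hg n
    -- Both lengths are the first at which an output appears along `h`; hence the search insists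
    -- that proper prefixes give no output.
    have hkw : k = w.length := by
      rcases lt_trichotomy k w.length with hlt | heq | hlt
      · have := h2 k hlt
        rw [← hw, List.take_map_range hlt.le, hk] at this
        simp at this
      · exact heq
      · have := hk' _ hlt
        rw [hw, h1] at this
        simp at this
    rw [hkw, hw, h1, Option.some_inj] at hk
    have h6 := hgname.d_le n
    rw [← hk] at h6
    rw [mem_basicBall]
    have h7 := EffPres.d_triangle (basic b.unpair.1) (basic m) (f x)
    linarith

end Forward

/-! ### From semidecidable preimages to machines on names -/

section Backward

/-- The partial map on Baire space given by the machine `φ`. -/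
theorem exists_partial_map (φ : List ℕ × ℕ → Option ℕ) :
    ∃ F : (ℕ → ℕ) →. (ℕ → ℕ), ∀ h g : ℕ → ℕ,
      g ∈ F h ↔ ∀ n : ℕ, ∃ k : ℕ, φ ((List.range k).map h, n) = some (g n) ∧
        ∀ j < k, φ ((List.range j).map h, n) = none := by
  classical
  have huniq : ∀ (h g g' : ℕ → ℕ), (∀ n : ℕ, ∃ k : ℕ, φ ((List.range k).map h, n) = some (g n) ∧
        ∀ j < k, φ ((List.range j).map h, n) = none) →
      (∀ n : ℕ, ∃ k : ℕ, φ ((List.range k).map h, n) = some (g' n) ∧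
        ∀ j < k, φ ((List.range j).map h, n) = none) → g = g' := by
    intro h g g' H H'
    funext n
    obtain ⟨k, h1, h2⟩ := H n
    obtain ⟨k', h1', h2'⟩ := H' n
    rcases lt_trichotomy k k' with hlt | rfl | hlt
    · simp [h2' k hlt] at h1
    · simpa [h1] using h1'
    · simp [h2 k' hlt] at h1'
  refine ⟨fun h => ⟨∃ g : ℕ → ℕ, ∀ n : ℕ, ∃ k : ℕ, φ ((List.range k).map h, n) = some (g n) ∧
        ∀ j < k, φ ((List.range j).map h, n) = none, fun H => H.choose⟩, fun h g => ?_⟩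
  constructor
  · rintro ⟨H, rfl⟩
    exact H.choose_spec
  · intro H
    have hdom : ∃ g : ℕ → ℕ, ∀ n : ℕ, ∃ k : ℕ, φ ((List.range k).map h, n) = some (g n) ∧
        ∀ j < k, φ ((List.range j).map h, n) = none := ⟨g, H⟩
    exact ⟨hdom, huniq h _ _ hdom.choose_spec H⟩

/-- Uniform selection of values from a recursively enumerable relation. -/
theorem exists_partialComputable_selection {Q : List ℕ × ℕ × ℕ → Prop} (hQ : RE Q) :
    ∃ F : (ℕ → ℕ) →. (ℕ → ℕ), PartialComputable F ∧ ∀ h : ℕ → ℕ,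
      (∀ n, ∃ k m, Q ((List.range k).map h, n, m)) →
      ∃ g ∈ F h, ∀ n, ∃ k, Q ((List.range k).map h, n, g n) := by
  obtain ⟨q, ⟨_, hq⟩, H⟩ := hQ
  -- A candidate `j` codes a prefix length, a value and a witness. The prefix length is at most `j`,
  -- so a candidate below the length of the available word refers only to values already read.
  set cand : List ℕ × ℕ → ℕ → Option ℕ := fun x j =>
    if q ((x.1.take j.unpair.1, x.2, j.unpair.2.unpair.1), j.unpair.2.unpair.2) then
      some j.unpair.2.unpair.1 else none with hcand
  have hcand' : Primrec₂ cand := by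
    refine Primrec.ite (PrimrecPred.comp ⟨_, hq⟩ (f := fun y : (List ℕ × ℕ) × ℕ =>
      ((y.1.1.take y.2.unpair.1, y.1.2, y.2.unpair.2.unpair.1), y.2.unpair.2.unpair.2))
      (by fun_prop)) (by fun_prop) (by fun_prop)
  set φ : List ℕ × ℕ → Option ℕ := fun x =>
    ((List.range x.1.length).filterMap (cand x)).head? with hφ
  have hφ' : Primrec φ :=
    Primrec.list_head?.comp (Primrec.listFilterMap (by fun_prop) hcand')
  have hsound : ∀ (h : ℕ → ℕ) (k n m : ℕ), φ ((List.range k).map h, n) = some m →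
      ∃ l, Q ((List.range l).map h, n, m) := by
    intro h k n m hm
    obtain ⟨j, hj, hjm⟩ := List.mem_filterMap.1 (List.mem_of_head? hm)
    simp only [List.length_map, List.length_range, List.mem_range] at hj
    simp only [hcand, Option.ite_none_right_eq_some, Option.some_inj] at hjm
    obtain ⟨hjq, rfl⟩ := hjm
    rw [List.take_map_range ((Nat.unpair_left_le j).trans hj.le)] at hjq
    exact ⟨_, (H _).2 ⟨_, hjq⟩⟩
  obtain ⟨F, hF⟩ := exists_partial_map φ
  refine ⟨F, ⟨φ, hφ'.to_comp, hF⟩, fun h hh => ?_⟩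
  have hdef : ∀ n, ∃ k, (φ ((List.range k).map h, n)).isSome := by
    intro n
    obtain ⟨l, m, hl⟩ := hh n
    obtain ⟨s, hs⟩ := (H _).1 hl
    set j := Nat.pair l (Nat.pair m s) with hj
    refine ⟨j + 1, ?_⟩
    have : m ∈ (List.range ((List.range (j + 1)).map h).length).filterMap
        (cand ((List.range (j + 1)).map h, n)) := by
      refine List.mem_filterMap.2 ⟨j, by simp, ?_⟩
      simp only [hcand, hj, Nat.unpair_pair]
      rw [List.take_map_range (by have := Nat.left_le_pair l (Nat.pair m s); omega), if_pos hs]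
    simp only [hφ]
    rw [List.isSome_head?]
    simpa using List.ne_nil_of_mem this
  classical
  have hmin : ∀ n, ∃ m k, φ ((List.range k).map h, n) = some m ∧
      ∀ j < k, φ ((List.range j).map h, n) = none := by
    intro n
    obtain ⟨m, hm⟩ := Option.isSome_iff_exists.1 (Nat.find_spec (hdef n))
    exact ⟨m, _, hm, fun j hj => by simpa using Nat.find_min (hdef n) hj⟩
  choose g hg using hmin
  refine ⟨g, (hF h g).2 hg, fun n => ?_⟩
  obtain ⟨k, hk, -⟩ := hg n
  exact hsound h k n _ hk

variable {X Y : Type*} [MetricPresentation X] [EffPres X] [MetricPresentation Y] [EffPres Y]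
  {A : Set X} {f : X → Y}

/-- The machine looks for a basic point whose ball of radius `2⁻⁽ⁿ⁺¹⁾` is confirmed to contain `f
x`. Membership of `x` in a ball is confirmed by a name entry `h i` whose distance to the centre is
less than the radius minus `2⁻ⁱ`. Any choice of outputs is then a Cauchy name by
`isCauchyName_of_lt`. -/
theorem SDMap.computableMapOn (hf : SDMap A f) : ComputableMapOn f A := by
  obtain ⟨R, hR, H⟩ := hf
  have hQ : RE fun x : List ℕ × ℕ × ℕ => ∃ l : List ℕ,
      R (Nat.pair x.2.2 (radCode (x.2.1 + 1)), l) ∧ ∀ j < l.length, ∃ i : ℕ, i < x.1.length ∧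
        d (basic (x.1.getD i 0) : X) (basic (l.getD j 0).unpair.1) <
          (posRatOf (l.getD j 0).unpair.2 : ℝ) - 2⁻¹ ^ i := by
    refine .ex <| .and (hR.comp (f := fun y : (List ℕ × ℕ × ℕ) × List ℕ =>
        (Nat.pair y.1.2.2 (radCode (y.1.2.1 + 1)), y.2)) (by fun_prop)) ?_
    refine .forall_lt ?_ (by fun_prop)
    refine .ex ?_
    exact .and (.nat_lt (by fun_prop) (by fun_prop))
        (EffPres.re_dist_lt' X (by fun_prop) (by fun_prop) (by fun_prop))
  obtain ⟨F, hF, hsel⟩ := exists_partialComputable_selection hQ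
  refine ⟨F, hF, fun x hx h hname => ?_⟩
  have htot : ∀ n, ∃ k m, ∃ l : List ℕ, R (Nat.pair m (radCode (n + 1)), l) ∧
      ∀ j < l.length, ∃ i : ℕ, i < ((List.range k).map h).length ∧
        d (basic (((List.range k).map h).getD i 0) : X) (basic (l.getD j 0).unpair.1) <
          (posRatOf (l.getD j 0).unpair.2 : ℝ) - 2⁻¹ ^ i := fun n => by
    obtain ⟨m, hm⟩ := EffPres.exists_basic (f x) (ε := 2⁻¹ ^ (n + 1)) (by positivity)
    rw [← posRatOf_radCode, ← mem_basicBall_pair] at hm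
    obtain ⟨l, hl, hxl⟩ := (H _ x hx).1 hm
    have h1 : ∀ b ∈ l, ∃ i : ℕ, d (basic (h i) : X) (basic b.unpair.1) <
        (posRatOf b.unpair.2 : ℝ) - 2⁻¹ ^ i := by
      intro b hb
      have h2 := hxl b hb
      rw [mem_basicBall] at h2
      obtain ⟨i, hi⟩ := exists_inv_two_pow_lt (half_pos (sub_pos.2 h2))
      refine ⟨i, ?_⟩
      have h3 := EffPres.d_triangle (basic (h i)) x (basic b.unpair.1)
      rw [EffPres.d_comm x] at h3
      linarith [hname.d_le i]
    choose! i hi using h1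
    -- The sum bounds all the finitely many indices used, so this prefix contains every entry
    -- needed.
    refine ⟨(l.map i).sum + 1, m, l, hl, fun j hj => ?_⟩
    have hmem : l.getD j 0 ∈ l := by simp [List.getD_eq_getElem?_getD, hj]
    have hlt : i (l.getD j 0) < (l.map i).sum + 1 :=
      Nat.lt_succ_of_le (List.le_sum_of_mem (List.mem_map_of_mem hmem))
    refine ⟨i (l.getD j 0), by simpa using hlt, ?_⟩
    simp only [List.getD_map_range hlt]
    exact hi _ hmem
  obtain ⟨g, hg, hgQ⟩ := hsel h htot
  refine ⟨g, hg, (isCauchyName_of_lt fun n => ?_).1⟩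
  obtain ⟨k, l, hl, hlx⟩ := hgQ n
  have := (H _ x hx).2 ⟨l, hl, fun b hb => ?_⟩
  · simpa [mem_basicBall_pair, posRatOf_radCode] using this
  · obtain ⟨j, hj, rfl⟩ := List.getElem_of_mem hb
    obtain ⟨i, hi, hij⟩ := hlx j hj
    simp only [List.length_map, List.length_range] at hi
    simp only [List.getD_map_range hi, List.getD_eq_getElem _ _ hj] at hij
    rw [mem_basicBall]
    have h1 := EffPres.d_triangle (basic l[j].unpair.1) (basic (h i)) x
    rw [EffPres.d_comm _ (basic (h i))] at h1
    linarith [hname.d_le i]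

end Backward

/-! ## Lower semicomputable and computable real-valued families -/

/-- Uniform lower semicomputability on `A`. -/
def Lo {α X : Type*} [Primcodable α] [MetricPresentation X] (A : Set X) (f : α → X → ℝ) : Prop :=
  SD A fun (p : α × ℕ) x => (ratOf p.2 : ℝ) < f p.1 x

/-- Uniform computability on `A`. -/
def RC {α X : Type*} [Primcodable α] [MetricPresentation X] (A : Set X) (f : α → X → ℝ) : Prop :=
  Lo A f ∧ Lo A fun a x => -f a x

section

variable {α β X Y : Type*} [Primcodable α] [Primcodable β] [MetricPresentation X]
  [MetricPresentation Y] {A B : Set X} {f g : α → X → ℝ}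

namespace Lo

theorem congr (h : Lo A f) (H : ∀ a, ∀ x ∈ A, g a x = f a x) : Lo A g :=
  SD.congr h fun a x hx => by rw [H _ x hx]

theorem mono (h : Lo B f) (hAB : A ⊆ B) : Lo A f := SD.mono h hAB

theorem comp {f : β → X → ℝ} (h : Lo A f) {u : α → β} (hu : Primrec u) :
    Lo A fun a x => f (u a) x :=
  SD.comp h (f := fun p : α × ℕ => (u p.1, p.2)) (by fun_prop)

theorem lt (h : Lo A f) {q : α → ℝ} (hq : QComp q) : SD A fun a x => q a < f a x := by
  obtain ⟨c, hc, hq⟩ := hq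
  exact (SD.comp h (f := fun a => (a, c a)) (by fun_prop)).congr fun a x _ => by rw [hq]

theorem const {q : α → ℝ} (hq : QComp q) : Lo A fun a (_ : X) => q a :=
  SD.of_re (QComp.re_lt (by fun_prop) (hq.comp Primrec.fst))

theorem add (hf : Lo A f) (hg : Lo A g) : Lo A fun a x => f a x + g a x := by
  have : SD A fun (p : α × ℕ) x => ∃ r : ℕ × ℕ, (ratOf p.2 : ℝ) ≤ ratOf r.1 + ratOf r.2 ∧
      (ratOf r.1 : ℝ) < f p.1 x ∧ (ratOf r.2 : ℝ) < g p.1 x :=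
    .ex <| .and (.of_re (QComp.re_le (by fun_prop) (by fun_prop))) <| .and
      (SD.comp hf (f := fun z : (α × ℕ) × (ℕ × ℕ) => (z.1.1, z.2.1)) (by fun_prop))
      (SD.comp hg (f := fun z : (α × ℕ) × (ℕ × ℕ) => (z.1.1, z.2.2)) (by fun_prop))
  refine SD.congr this fun ⟨a, k⟩ x hx => ⟨fun h => ?_, ?_⟩
  · simp only at h ⊢
    obtain ⟨r, h1, h2⟩ := exists_ratOf_btwn (sub_lt_iff_lt_add.2 h)
    obtain ⟨s, h3, h4⟩ := exists_ratOf_btwn (sub_lt_comm.1 h1)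
    exact ⟨(r, s), by linarith, h2, h4⟩
  · rintro ⟨⟨r, s⟩, h1, h2, h3⟩
    simp only at *
    linarith

theorem max (hf : Lo A f) (hg : Lo A g) : Lo A fun a x => max (f a x) (g a x) :=
  SD.congr (SD.or hf hg) fun _ _ _ => lt_max_iff

theorem min (hf : Lo A f) (hg : Lo A g) : Lo A fun a x => min (f a x) (g a x) :=
  SD.congr (SD.and hf hg) fun _ _ _ => lt_min_iff

/-- Suprema over a countable index set. -/
theorem of_ex {h : α → β → X → ℝ} (hh : Lo A fun (p : α × β) x => h p.1 p.2 x)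
    (H : ∀ a, ∀ x ∈ A, ∀ q : ℝ, q < f a x ↔ ∃ b, q < h a b x) : Lo A f :=
  SD.congr (SD.ex (U := fun (p : α × ℕ) b x => (ratOf p.2 : ℝ) < h p.1 b x)
    (SD.comp hh (f := fun z : (α × ℕ) × β => ((z.1.1, z.2), z.1.2)) (by fun_prop)))
    fun a x hx => H _ x hx _

theorem sum {h : α → ℕ → X → ℝ} (hh : Lo A fun (p : α × ℕ) x => h p.1 p.2 x) {n : α → ℕ}
    (hn : Primrec n) : Lo A fun a x => ∑ i ∈ Finset.range (n a), h a i x := by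
  have h1 : SD A fun (p : α × ℕ) x => ∃ L : List ℕ,
      (ratOf p.2 : ℝ) < ∑ i ∈ Finset.range (n p.1), (ratOf (L.getD i 0) : ℝ) ∧
      ∀ i < n p.1, (ratOf (L.getD i 0) : ℝ) < h p.1 i x := by
    refine .ex <| .and (.of_re (QComp.re_lt (by fun_prop)
      (.sum (f := fun z : ((α × ℕ) × List ℕ) × ℕ => (ratOf (z.1.2.getD z.2 0) : ℝ))
        (by fun_prop) (by fun_prop)))) (.forall_lt ?_ (by fun_prop))
    exact SD.comp hh (f := fun z : ((α × ℕ) × List ℕ) × ℕ => ((z.1.1.1, z.2), z.1.2.getD z.2 0))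
      (by fun_prop)
  refine SD.congr h1 fun ⟨a, k⟩ x hx => ⟨fun hlt => ?_, ?_⟩
  · simp only at hlt ⊢
    set δ := (∑ i ∈ Finset.range (n a), h a i x) - ratOf k with hδ
    have hδ0 : 0 < δ := sub_pos.2 hlt
    -- Dividing by `n a + 1` covers the empty sum and makes the total loss `n a * ε` strictly less
    -- than `δ`.
    set ε := δ / (n a + 1) with hε
    have hε0 : 0 < ε := by positivity
    choose c hc using fun i => exists_ratOf_btwn (sub_lt_self (h a i x) hε0)
    refine ⟨(List.range (n a)).map c, ?_, fun i hi => ?_⟩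
    · have h2 : ∑ i ∈ Finset.range (n a), (h a i x - ε) ≤ ∑ i ∈ Finset.range (n a),
          (ratOf (((List.range (n a)).map c).getD i 0) : ℝ) :=
        Finset.sum_le_sum fun i hi => by
          rw [List.getD_map_range (Finset.mem_range.1 hi)]
          exact (hc i).1.le
      refine lt_of_lt_of_le ?_ h2
      rw [Finset.sum_sub_distrib, Finset.sum_const, Finset.card_range, nsmul_eq_mul]
      have : (n a : ℝ) * ε < δ := by
        rw [hε, mul_div_assoc', div_lt_iff₀ (by positivity)]
        linarith
      linarith
    · rw [List.getD_map_range hi]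
      exact (hc i).2
  · rintro ⟨L, h2, h3⟩
    refine h2.trans_le (Finset.sum_le_sum fun i hi => (h3 i (Finset.mem_range.1 hi)).le)

/-- Nonnegative rational lower bounds of the factors multiply. Negative bounds are accepted
separately, because a vanishing factor has no nonnegative strict lower bound. -/
theorem mul_nonneg (hf : Lo A f) (hg : Lo A g) (hf0 : ∀ a, ∀ x ∈ A, 0 ≤ f a x)
    (hg0 : ∀ a, ∀ x ∈ A, 0 ≤ g a x) : Lo A fun a x => f a x * g a x := by
  have : SD A fun (p : α × ℕ) x => (ratOf p.2 : ℝ) < 0 ∨ ∃ r : ℕ × ℕ,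
      (0 ≤ (ratOf r.1 : ℝ) ∧ 0 ≤ (ratOf r.2 : ℝ) ∧ (ratOf p.2 : ℝ) ≤ ratOf r.1 * ratOf r.2) ∧
      (ratOf r.1 : ℝ) < f p.1 x ∧ (ratOf r.2 : ℝ) < g p.1 x :=
    .or (.of_re (QComp.re_lt (by fun_prop) (by fun_prop))) <| .ex <| .and
      (.of_re (.and (QComp.re_le (by fun_prop) (by fun_prop)) (.and
        (QComp.re_le (by fun_prop) (by fun_prop)) (QComp.re_le (by fun_prop) (by fun_prop)))))
      (.and (SD.comp hf (f := fun z : (α × ℕ) × (ℕ × ℕ) => (z.1.1, z.2.1)) (by fun_prop))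
        (SD.comp hg (f := fun z : (α × ℕ) × (ℕ × ℕ) => (z.1.1, z.2.2)) (by fun_prop)))
  refine SD.congr this fun ⟨a, k⟩ x hx => ⟨fun h => ?_, ?_⟩
  · simp only at h ⊢
    refine (lt_or_ge (ratOf k : ℝ) 0).imp_right fun hk => ?_
    have hf1 := hf0 a x hx
    have hg1 := hg0 a x hx
    have hf2 : 0 < f a x := hf1.lt_of_ne fun h0 => by rw [← h0] at h; linarith
    have hg2 : 0 < g a x := hg1.lt_of_ne fun h0 => by rw [← h0] at h; linarith
    obtain ⟨r, h1, h2⟩ := exists_ratOf_btwn ((div_lt_iff₀ hg2).2 h)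
    have hr : 0 < (ratOf r : ℝ) := lt_of_le_of_lt (by positivity) h1
    rw [div_lt_iff₀ hg2, mul_comm, ← div_lt_iff₀ hr] at h1
    obtain ⟨s, h3, h4⟩ := exists_ratOf_btwn h1
    have hs : 0 < (ratOf s : ℝ) := lt_of_le_of_lt (by positivity) h3
    rw [div_lt_iff₀ hr] at h3
    exact ⟨(r, s), ⟨hr.le, hs.le, by linarith⟩, h2, h4⟩
  · rintro (h | ⟨⟨r, s⟩, ⟨h1, h2, h3⟩, h4, h5⟩)
    · exact h.trans_le (_root_.mul_nonneg (hf0 _ _ hx) (hg0 _ _ hx))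
    · simp only at *
      exact h3.trans_lt (mul_lt_mul'' h4 h5 h1 h2)

theorem neg_mul_nonneg (hf : Lo A fun a x => -f a x) (hg : Lo A fun a x => -g a x)
    (hf0 : ∀ a, ∀ x ∈ A, 0 ≤ f a x) (hg0 : ∀ a, ∀ x ∈ A, 0 ≤ g a x) :
    Lo A fun a x => -(f a x * g a x) := by
  have : SD A fun (p : α × ℕ) x => ∃ r : ℕ × ℕ,
      ((ratOf p.2 : ℝ) ≤ -(ratOf r.1 * ratOf r.2)) ∧
      -(ratOf r.1 : ℝ) < -f p.1 x ∧ -(ratOf r.2 : ℝ) < -g p.1 x := by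
    refine .ex <| .and (.of_re (QComp.re_le (by fun_prop) (by fun_prop))) (.and ?_ ?_)
    · exact (hf.comp (u := fun z : (α × ℕ) × (ℕ × ℕ) => z.1.1) (by fun_prop)).lt (by fun_prop)
    · exact (hg.comp (u := fun z : (α × ℕ) × (ℕ × ℕ) => z.1.1) (by fun_prop)).lt (by fun_prop)
  refine SD.congr this fun ⟨a, k⟩ x hx => ⟨fun h => ?_, ?_⟩
  · simp only at h ⊢
    have hf1 := hf0 a x hx
    have hg1 := hg0 a x hx
    have hcont : Tendsto (fun ε : ℝ => (f a x + ε) * (g a x + ε)) (𝓝[>] 0)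
        (𝓝 ((f a x + 0) * (g a x + 0))) :=
      (Continuous.tendsto (by fun_prop) 0).mono_left nhdsWithin_le_nhds
    obtain ⟨ε, h1, h2⟩ := ((hcont.eventually_lt_const (u := -(ratOf k : ℝ))
      (by simp only [add_zero]; linarith)).and self_mem_nhdsWithin).exists
    have hε : 0 < ε := h2
    obtain ⟨r, h3, h4⟩ := exists_ratOf_btwn (lt_add_of_pos_right (f a x) hε)
    obtain ⟨s, h5, h6⟩ := exists_ratOf_btwn (lt_add_of_pos_right (g a x) hε)
    refine ⟨(r, s), ?_, by simpa using h3, by simpa using h5⟩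
    have := mul_lt_mul'' h4 h6 (hf1.trans h3.le) (hg1.trans h5.le)
    simp only
    linarith
  · rintro ⟨⟨r, s⟩, h1, h2, h3⟩
    simp only [neg_lt_neg_iff] at *
    have := mul_lt_mul'' h2 h3 (hf0 _ _ hx) (hg0 _ _ hx)
    linarith

theorem subst {f : α → Y → ℝ} {B : Set Y} (h : Lo B f) {m : X → Y} (hm : SDMap A m)
    (hAB : Set.MapsTo m A B) : Lo A fun a x => f a (m x) :=
  SD.subst h hm hAB

end Lo

namespace RC

theorem congr (h : RC A f) (H : ∀ a, ∀ x ∈ A, g a x = f a x) : RC A g :=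
  ⟨h.1.congr H, h.2.congr fun a x hx => by rw [H a x hx]⟩

theorem mono (h : RC B f) (hAB : A ⊆ B) : RC A f := ⟨h.1.mono hAB, h.2.mono hAB⟩

theorem comp {f : β → X → ℝ} (h : RC A f) {u : α → β} (hu : Primrec u) :
    RC A fun a x => f (u a) x :=
  ⟨h.1.comp hu, h.2.comp hu⟩

theorem const {q : α → ℝ} (hq : QComp q) : RC A fun a (_ : X) => q a :=
  ⟨.const hq, .const hq.neg⟩

theorem neg (hf : RC A f) : RC A fun a x => -f a x :=
  ⟨hf.2, hf.1.congr fun _ _ _ => neg_neg _⟩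

theorem add (hf : RC A f) (hg : RC A g) : RC A fun a x => f a x + g a x :=
  ⟨hf.1.add hg.1, (hf.2.add hg.2).congr fun _ _ _ => neg_add _ _⟩

theorem sub (hf : RC A f) (hg : RC A g) : RC A fun a x => f a x - g a x :=
  (hf.add hg.neg).congr fun _ _ _ => sub_eq_add_neg _ _

theorem max (hf : RC A f) (hg : RC A g) : RC A fun a x => max (f a x) (g a x) :=
  ⟨hf.1.max hg.1, (hf.2.min hg.2).congr fun _ _ _ => (min_neg_neg _ _).symm⟩

theorem min (hf : RC A f) (hg : RC A g) : RC A fun a x => min (f a x) (g a x) :=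
  ⟨hf.1.min hg.1, (hf.2.max hg.2).congr fun _ _ _ => (max_neg_neg _ _).symm⟩

theorem abs (hf : RC A f) : RC A fun a x => |f a x| := hf.max hf.neg

theorem sum {h : α → ℕ → X → ℝ} (hh : RC A fun (p : α × ℕ) x => h p.1 p.2 x) {n : α → ℕ}
    (hn : Primrec n) : RC A fun a x => ∑ i ∈ Finset.range (n a), h a i x :=
  ⟨.sum hh.1 hn, (Lo.sum (h := fun a i x => -h a i x) hh.2 hn).congr fun _ _ _ => by simp⟩

/-- Splitting both factors into positive and negative parts reduces the claim to nonnegative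
factors, for which lower and upper bounds multiply. -/
theorem mul (hf : RC A f) (hg : RC A g) : RC A fun a x => f a x * g a x := by
  have h0 : RC A fun (_ : α) (_ : X) => (0 : ℝ) := .const (by fun_prop)
  have key : ∀ {u v : α → X → ℝ}, RC A u → RC A v →
      RC A fun a x => Max.max (u a x) 0 * Max.max (v a x) 0 := fun hu hv =>
    ⟨.mul_nonneg (hu.max h0).1 (hv.max h0).1 (fun _ _ _ => le_max_right _ _)
      (fun _ _ _ => le_max_right _ _),
    .neg_mul_nonneg (hu.max h0).2 (hv.max h0).2 (fun _ _ _ => le_max_right _ _)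
      (fun _ _ _ => le_max_right _ _)⟩
  refine (((key hf hg).add (key hf.neg hg.neg)).sub
    ((key hf hg.neg).add (key hf.neg hg))).congr fun a x _ => ?_
  have e : ∀ y : ℝ, y = Max.max y 0 - Max.max (-y) 0 := fun y => by
    rcases le_total 0 y with h | h
    · rw [max_eq_left h, max_eq_right (by linarith)]; ring
    · rw [max_eq_right h, max_eq_left (by linarith)]; ring
  nth_rewrite 1 [e (f a x), e (g a x)]
  ring

theorem lt (hf : RC A f) (hg : RC A g) : SD A fun a x => f a x < g a x :=
  ((hg.sub hf).1.lt (q := fun _ => 0) (by fun_prop)).congr fun _ _ _ => sub_pos.symm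

theorem subst {f : α → Y → ℝ} {B : Set Y} (h : RC B f) {m : X → Y} (hm : SDMap A m)
    (hAB : Set.MapsTo m A B) : RC A fun a x => f a (m x) :=
  ⟨h.1.subst hm hAB, h.2.subst hm hAB⟩

end RC

/-! ## The function `1 - exp (-x)` -/

theorem one_add_div_pow_le_exp {y : ℝ} {n : ℕ} (h : -y < n + 1) :
    (1 + y * ((n : ℝ) + 1)⁻¹) ^ (n + 1) ≤ Real.exp y := by
  have hn : (0 : ℝ) < n + 1 := by positivity
  have h0 : 0 ≤ 1 + y * ((n : ℝ) + 1)⁻¹ := by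
    rw [← div_eq_mul_inv]
    have : -1 < y / ((n : ℝ) + 1) := by rw [lt_div_iff₀ hn]; linarith
    linarith
  calc _ ≤ Real.exp (y * ((n : ℝ) + 1)⁻¹) ^ (n + 1) := by
        gcongr
        rw [add_comm]
        exact Real.add_one_le_exp _
    _ = Real.exp y := by
        rw [← Real.exp_nat_mul]
        congr 1
        push_cast
        field_simp

/-- The powers `(1 + y / (n + 1)) ^ (n + 1)` are rational for rational `y` and converge to the
exponential. They are lower bounds as soon as the base is positive, which is what `-y < n + 1`
ensures. -/
theorem lt_exp_iff {c y : ℝ} :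
    c < Real.exp y ↔ ∃ n : ℕ, -y < n + 1 ∧ c < (1 + y * ((n : ℝ) + 1)⁻¹) ^ (n + 1) := by
  constructor
  · intro h
    have h1 := (tendsto_add_atTop_iff_nat 1).2 (Real.tendsto_one_add_div_pow_exp y)
    obtain ⟨N, hN⟩ := exists_nat_gt (-y)
    obtain ⟨n, h2, h3⟩ := ((h1.eventually_const_lt h).and (eventually_ge_atTop N)).exists
    refine ⟨n, hN.trans (by exact_mod_cast Nat.lt_succ_of_le h3), ?_⟩
    rw [← div_eq_mul_inv]
    exact_mod_cast h2
  · rintro ⟨n, h1, h2⟩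
    exact h2.trans_le (one_add_div_pow_le_exp h1)

theorem QComp.re_lt_exp {c y : α → ℝ} (hc : QComp c) (hy : QComp y) :
    RE fun a => c a < Real.exp (y a) := by
  have : RE fun a => ∃ n : ℕ, -y a < n + 1 ∧
      c a < (1 + y a * ((n : ℝ) + 1)⁻¹) ^ (n + 1) :=
    .ex <| .and (QComp.re_lt (by fun_prop) (by fun_prop)) (QComp.re_lt (by fun_prop) (by fun_prop))
  exact this.congr fun a => lt_exp_iff

/-- Upper bounds of `exp y` are reciprocals of lower bounds of `exp (-y)`. -/
theorem QComp.re_exp_lt {c y : α → ℝ} (hc : QComp c) (hy : QComp y) :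
    RE fun a => Real.exp (y a) < c a := by
  have : RE fun a => ∃ r : ℕ, (1 : ℝ) ≤ c a * _root_.ratOf r ∧ 0 < c a ∧
      (_root_.ratOf r : ℝ) < Real.exp (-y a) := by
    exact .ex <| .and (QComp.re_le (by fun_prop) (by fun_prop)) <| .and
      (QComp.re_lt (by fun_prop) (by fun_prop)) (QComp.re_lt_exp (by fun_prop) (by fun_prop))
  refine this.congr fun a => ?_
  have he := Real.exp_pos (y a)
  constructor
  · intro h
    have hc0 : 0 < c a := he.trans h
    have : (c a)⁻¹ < Real.exp (-y a) := by
      rw [Real.exp_neg]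
      exact inv_strictAnti₀ he h
    obtain ⟨r, h1, h2⟩ := exists_ratOf_btwn this
    refine ⟨r, ?_, hc0, h2⟩
    rw [inv_lt_iff_one_lt_mul₀ hc0] at h1
    exact (mul_comm _ _).subst (motive := fun z => 1 ≤ z) h1.le
  · rintro ⟨r, h1, h2, h3⟩
    rw [Real.exp_neg] at h3
    have h4 : c a * _root_.ratOf r < c a * (Real.exp (y a))⁻¹ := by gcongr
    have h5 := h1.trans_lt h4
    rwa [← div_eq_mul_inv, one_lt_div he] at h5

/-- The function is increasing and continuous, so rational bounds of `f` transfer to bounds of the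
value without loss in the limit. -/
theorem RC.one_sub_exp_neg (hf : RC A f) : RC A fun a x => 1 - Real.exp (-f a x) := by
  constructor
  · have : SD A fun (p : α × ℕ) x => ∃ r : ℕ, (Real.exp (-ratOf r) < 1 - ratOf p.2) ∧
        (ratOf r : ℝ) < f p.1 x :=
      .ex <| .and (.of_re (QComp.re_exp_lt (by fun_prop) (by fun_prop)))
        (SD.comp hf.1 (f := fun z : (α × ℕ) × ℕ => (z.1.1, z.2)) (by fun_prop))
    refine SD.congr this fun ⟨a, k⟩ x hx => ⟨fun h => ?_, ?_⟩
    · have hc : Continuous fun y : ℝ => Real.exp (-y) := by fun_prop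
      have h1 := (hc.tendsto (f a x)).eventually_lt_const (u := 1 - (ratOf k : ℝ))
        (by simp only at h; linarith)
      obtain ⟨ε, hε, hb⟩ := Metric.eventually_nhds_iff.1 h1
      obtain ⟨r, h2, h3⟩ := exists_ratOf_btwn (sub_lt_self (f a x) hε)
      refine ⟨r, hb ?_, h3⟩
      rw [Real.dist_eq, abs_lt]
      constructor <;> linarith
    · rintro ⟨r, h1, h2⟩
      have := Real.exp_lt_exp.2 (neg_lt_neg h2)
      simp only at *
      linarith
  · have : SD A fun (p : α × ℕ) x => ∃ r : ℕ, (1 + (ratOf p.2 : ℝ) < Real.exp (-ratOf r)) ∧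
        -(ratOf r : ℝ) < -f p.1 x :=
      .ex <| .and (.of_re (QComp.re_lt_exp (by fun_prop) (by fun_prop)))
        ((hf.2.comp (u := fun z : (α × ℕ) × ℕ => z.1.1) (by fun_prop)).lt (by fun_prop))
    refine SD.congr this fun ⟨a, k⟩ x hx => ⟨fun h => ?_, ?_⟩
    · have hc : Continuous fun y : ℝ => Real.exp (-y) := by fun_prop
      have h1 := (hc.tendsto (f a x)).eventually_const_lt (u := 1 + (ratOf k : ℝ))
        (by simp only at h; linarith)
      obtain ⟨ε, hε, hb⟩ := Metric.eventually_nhds_iff.1 h1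
      obtain ⟨r, h2, h3⟩ := exists_ratOf_btwn (lt_add_of_pos_right (f a x) hε)
      refine ⟨r, hb ?_, neg_lt_neg h2⟩
      rw [Real.dist_eq, abs_lt]
      constructor <;> linarith
    · rintro ⟨r, h1, h2⟩
      have := Real.exp_lt_exp.2 h2
      simp only at *
      linarith

end

/-! ## Distances, projections, sections -/

section

variable {X Y Z : Type*} [MetricPresentation X] [MetricPresentation Y] [MetricPresentation Z]
  {A : Set Z}

theorem mem_basicBall_prod {b : ℕ} {p : X × Y} : p ∈ basicBall (X × Y) b ↔
    p.1 ∈ basicBall X (Nat.pair b.unpair.1.unpair.1 b.unpair.2) ∧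
    p.2 ∈ basicBall Y (Nat.pair b.unpair.1.unpair.2 b.unpair.2) := by
  rw [mem_basicBall_pair, mem_basicBall_pair]
  exact ⟨fun h => max_lt_iff.1 h, fun h => max_lt_iff.2 h⟩

theorem SDMap.prodMk {f : Z → X} {g : Z → Y} (hf : SDMap A f) (hg : SDMap A g) :
    SDMap A fun z => (f z, g z) :=
  SD.congr (SD.and
    (SD.comp hf (f := fun b : ℕ => Nat.pair b.unpair.1.unpair.1 b.unpair.2) (by fun_prop))
    (SD.comp hg (f := fun b : ℕ => Nat.pair b.unpair.1.unpair.2 b.unpair.2) (by fun_prop)))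
    fun _ _ _ => mem_basicBall_prod

theorem mem_basicBall_real {b : ℕ} {y : ℝ} : y ∈ basicBall ℝ b ↔
    ratOf b.unpair.1 - (posRatOf b.unpair.2 : ℝ) < y ∧
      y < ratOf b.unpair.1 + (posRatOf b.unpair.2 : ℝ) := by
  have : y ∈ basicBall ℝ b ↔ |(ratOf b.unpair.1 : ℝ) - y| < (posRatOf b.unpair.2 : ℝ) := Iff.rfl
  rw [this, abs_lt]
  constructor <;> rintro ⟨h2, h3⟩ <;> constructor <;> linarith

theorem SDMap.rc {f : Z → ℝ} (h : SDMap A f) : RC A fun (_ : Unit) x => f x := by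
  constructor
  · have : SD A fun (p : Unit × ℕ) x => ∃ b : ℕ,
        (ratOf p.2 : ℝ) ≤ ratOf b.unpair.1 - (posRatOf b.unpair.2 : ℝ) ∧ f x ∈ basicBall ℝ b :=
      .ex <| .and (.of_re (QComp.re_le (by fun_prop) (by fun_prop)))
        (SD.comp h (f := fun z : (Unit × ℕ) × ℕ => z.2) (by fun_prop))
    refine SD.congr this fun ⟨_, k⟩ x _ => ⟨fun h => ?_, ?_⟩
    · obtain ⟨b, h1, h2⟩ := EffPres.exists_ball (f x) (half_pos (sub_pos.2 h))
      refine ⟨b, ?_, h1⟩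
      rw [mem_basicBall_real] at h1
      simp only at *
      linarith
    · rintro ⟨b, h1, h2⟩
      rw [mem_basicBall_real] at h2
      simp only at *
      linarith
  · have : SD A fun (p : Unit × ℕ) x => ∃ b : ℕ,
        ratOf b.unpair.1 + (posRatOf b.unpair.2 : ℝ) ≤ -ratOf p.2 ∧ f x ∈ basicBall ℝ b :=
      .ex <| .and (.of_re (QComp.re_le (by fun_prop) (by fun_prop)))
        (SD.comp h (f := fun z : (Unit × ℕ) × ℕ => z.2) (by fun_prop))
    refine SD.congr this fun ⟨_, k⟩ x _ => ⟨fun h => ?_, ?_⟩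
    · obtain ⟨b, h1, h2⟩ := EffPres.exists_ball (f x) (half_pos (sub_pos.2 h))
      refine ⟨b, ?_, h1⟩
      rw [mem_basicBall_real] at h1
      simp only at *
      linarith
    · rintro ⟨b, h1, h2⟩
      rw [mem_basicBall_real] at h2
      simp only at *
      linarith

theorem RC.sdMap {f : Z → ℝ} (h : RC A fun (_ : Unit) x => f x) : SDMap A f := by
  have h1 : SD A fun (b : ℕ) x => (ratOf b.unpair.1 - (posRatOf b.unpair.2 : ℝ) < f x) ∧
      -(ratOf b.unpair.1 + (posRatOf b.unpair.2 : ℝ)) < -f x :=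
    .and ((h.1.comp (u := fun _ : ℕ => ()) (by fun_prop)).lt (by fun_prop))
      ((h.2.comp (u := fun _ : ℕ => ()) (by fun_prop)).lt (by fun_prop))
  refine h1.congr fun b x _ => ?_
  rw [mem_basicBall_real]
  constructor <;> rintro ⟨h2, h3⟩ <;> constructor <;> linarith

end

section

variable {α X Y Z : Type*} [Primcodable α] [MetricPresentation X] [EffPres X]
  [MetricPresentation Y] [EffPres Y] [MetricPresentation Z] {A : Set Z}

theorem RC.dist {A : Set X} : RC A fun (c : ℕ) (x : X) => d (basic c) x := by
  constructor
  · have : SD A fun (p : ℕ × ℕ) (x : X) => ∃ b : ℕ, (ratOf p.2 + (posRatOf b.unpair.2 : ℝ) <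
        d (basic p.1 : X) (basic b.unpair.1)) ∧ x ∈ basicBall X b :=
      .ex <| .and (.of_re (EffPres.re_lt_dist' X (by fun_prop) (by fun_prop) (by fun_prop)))
        (.ball (by fun_prop))
    refine SD.congr this fun ⟨c, k⟩ x hx => ⟨fun h => ?_, ?_⟩
    · obtain ⟨b, h1, h2⟩ := EffPres.exists_ball x (half_pos (sub_pos.2 h))
      refine ⟨b, ?_, h1⟩
      rw [mem_basicBall] at h1
      have := EffPres.d_triangle (basic c) (basic b.unpair.1) x
      simp only at *
      linarith
    · rintro ⟨b, h1, h2⟩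
      rw [mem_basicBall, EffPres.d_comm] at h2
      have := EffPres.d_triangle (basic c) x (basic b.unpair.1)
      simp only at *
      linarith
  · have : SD A fun (p : ℕ × ℕ) (x : X) => ∃ r : ℕ, ((posRatOf r : ℝ) ≤ -ratOf p.2) ∧
        x ∈ basicBall X (Nat.pair p.1 r) :=
      .ex <| .and (.of_re (QComp.re_le (by fun_prop) (by fun_prop))) (.ball (by fun_prop))
    refine SD.congr this fun ⟨c, k⟩ x hx => ⟨fun h => ?_, ?_⟩
    · simp only at h
      obtain ⟨r, h1, h2⟩ := exists_posRatOf_btwn (EffPres.d_nonneg _ _) (lt_neg_of_lt_neg h)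
      exact ⟨r, h2.le, mem_basicBall_pair.2 h1⟩
    · rintro ⟨r, h1, h2⟩
      rw [mem_basicBall_pair] at h2
      simp only at *
      linarith

theorem SDMap.fst : SDMap Set.univ (Prod.fst : X × Y → X) := by
  have : SD Set.univ fun (b : ℕ) (x : X × Y) => ∃ b' : ℕ,
      d (basic b.unpair.1 : X) (basic b'.unpair.1.unpair.1) <
        (posRatOf b.unpair.2 : ℝ) - (posRatOf b'.unpair.2 : ℝ) ∧ x ∈ basicBall (X × Y) b' :=
    .ex <| .and (.of_re (EffPres.re_dist_lt' X (by fun_prop) (by fun_prop) (by fun_prop)))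
      (.ball (by fun_prop))
  refine SD.congr this fun b x _ => ⟨fun h => ?_, ?_⟩
  · rw [mem_basicBall] at h
    obtain ⟨b', h1, h2⟩ := EffPres.exists_ball x (half_pos (sub_pos.2 h))
    refine ⟨b', ?_, h1⟩
    have h3 : d (basic b'.unpair.1.unpair.1) x.1 < (posRatOf b'.unpair.2 : ℝ) :=
      (max_lt_iff.1 h1).1
    have h4 := EffPres.d_triangle (basic b.unpair.1) x.1 (basic b'.unpair.1.unpair.1)
    rw [EffPres.d_comm x.1] at h4
    linarith
  · rintro ⟨b', h1, h2⟩
    have h3 : d (basic b'.unpair.1.unpair.1) x.1 < (posRatOf b'.unpair.2 : ℝ) :=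
      (max_lt_iff.1 h2).1
    have h4 := EffPres.d_triangle (basic b.unpair.1) (basic b'.unpair.1.unpair.1) x.1
    rw [mem_basicBall]
    linarith

theorem SDMap.snd : SDMap Set.univ (Prod.snd : X × Y → Y) := by
  have : SD Set.univ fun (b : ℕ) (x : X × Y) => ∃ b' : ℕ,
      d (basic b.unpair.1 : Y) (basic b'.unpair.1.unpair.2) <
        (posRatOf b.unpair.2 : ℝ) - (posRatOf b'.unpair.2 : ℝ) ∧ x ∈ basicBall (X × Y) b' :=
    .ex <| .and (.of_re (EffPres.re_dist_lt' Y (by fun_prop) (by fun_prop) (by fun_prop)))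
      (.ball (by fun_prop))
  refine SD.congr this fun b x _ => ⟨fun h => ?_, ?_⟩
  · rw [mem_basicBall] at h
    obtain ⟨b', h1, h2⟩ := EffPres.exists_ball x (half_pos (sub_pos.2 h))
    refine ⟨b', ?_, h1⟩
    have h3 : d (basic b'.unpair.1.unpair.2) x.2 < (posRatOf b'.unpair.2 : ℝ) :=
      (max_lt_iff.1 h1).2
    have h4 := EffPres.d_triangle (basic b.unpair.1) x.2 (basic b'.unpair.1.unpair.2)
    rw [EffPres.d_comm x.2] at h4
    linarith
  · rintro ⟨b', h1, h2⟩
    have h3 : d (basic b'.unpair.1.unpair.2) x.2 < (posRatOf b'.unpair.2 : ℝ) :=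
      (max_lt_iff.1 h2).2
    have h4 := EffPres.d_triangle (basic b.unpair.1) (basic b'.unpair.1.unpair.2) x.2
    rw [mem_basicBall]
    linarith

/-- Restriction to a basic point in the first coordinate. -/
theorem SD.section_basic {U : α → X × Z → Prop} (h : SD Set.univ U) :
    SD Set.univ fun (p : α × ℕ) z => U p.1 (basic p.2, z) := by
  obtain ⟨R, hR, H⟩ := h
  have h1 : SD Set.univ fun (p : α × ℕ) z => ∃ l : List ℕ, R (p.1, l) ∧ ∀ j < l.length,
      d (basic (l.getD j 0).unpair.1.unpair.1 : X) (basic p.2) <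
        (posRatOf (l.getD j 0).unpair.2 : ℝ) ∧
      z ∈ basicBall Z (Nat.pair (l.getD j 0).unpair.1.unpair.2 (l.getD j 0).unpair.2) := by
    refine .ex <| .and (.of_re (hR.comp
      (f := fun z : (α × ℕ) × List ℕ => (z.1.1, z.2)) (by fun_prop))) (.forall_lt ?_ (by fun_prop))
    exact .and (.of_re (EffPres.re_dist_lt' X (by fun_prop) (by fun_prop) (by fun_prop)))
      (.ball (by fun_prop))
  refine h1.congr fun p z _ => (H p.1 _ trivial).trans (exists_congr fun l =>
    and_congr_right fun _ => ⟨fun h j hj => ?_, fun h b hb => ?_⟩)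
  · have := h (l.getD j 0) (by simp [List.getD_eq_getElem?_getD, hj])
    rwa [mem_basicBall_prod, mem_basicBall_pair] at this
  · obtain ⟨j, hj, rfl⟩ := List.getElem_of_mem hb
    have := h j hj
    rw [List.getD_eq_getElem _ _ hj] at this
    rwa [mem_basicBall_prod, mem_basicBall_pair]

theorem SD.re_basic {U : α → X → Prop} (h : SD Set.univ U) :
    RE fun p : α × ℕ => U p.1 (basic p.2) := by
  obtain ⟨R, hR, H⟩ := h
  have h1 : RE fun p : α × ℕ => ∃ l : List ℕ, R (p.1, l) ∧ ∀ j < l.length,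
      d (basic (l.getD j 0).unpair.1 : X) (basic p.2) <
        (posRatOf (l.getD j 0).unpair.2 : ℝ) := by
    refine .ex <| .and (hR.comp
      (f := fun z : (α × ℕ) × List ℕ => (z.1.1, z.2)) (by fun_prop)) (.forall_lt ?_ (by fun_prop))
    exact EffPres.re_dist_lt' X (by fun_prop) (by fun_prop) (by fun_prop)
  refine h1.congr fun p => (H p.1 _ trivial).trans (exists_congr fun l =>
    and_congr_right fun _ => ⟨fun h j hj => ?_, fun h b hb => ?_⟩)
  · exact h (l.getD j 0) (by simp [List.getD_eq_getElem?_getD, hj])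
  · obtain ⟨j, hj, rfl⟩ := List.getElem_of_mem hb
    have := h j hj
    rwa [List.getD_eq_getElem _ _ hj] at this

theorem RC.re_basic {f : α → X → ℝ} (h : RC Set.univ f) :
    RC A fun (p : α × ℕ) _ => f p.1 (basic p.2) :=
  ⟨.of_re (h.1.re_basic.comp (f := fun p : (α × ℕ) × ℕ => ((p.1.1, p.2), p.1.2)) (by fun_prop)),
    .of_re (h.2.re_basic.comp (f := fun p : (α × ℕ) × ℕ => ((p.1.1, p.2), p.1.2))
      (by fun_prop))⟩

theorem RC.section_nat {f : α → ℕ × Z → ℝ} (h : RC Set.univ f) :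
    RC Set.univ fun (p : α × ℕ) z => f p.1 (p.2, z) :=
  ⟨(SD.section_basic h.1).comp (f := fun p : (α × ℕ) × ℕ => ((p.1.1, p.2), p.1.2)) (by fun_prop),
    (SD.section_basic h.2).comp (f := fun p : (α × ℕ) × ℕ => ((p.1.1, p.2), p.1.2))
      (by fun_prop)⟩

/-- The space `ℕ` is discrete: a ball of radius `1 / 2` determines the number. -/
theorem SD.unsection_nat {U : α → ℕ → X → Prop}
    (h : SD Set.univ fun (p : α × ℕ) x => U p.1 p.2 x) :
    SD Set.univ fun a (p : ℕ × X) => U a p.1 p.2 := by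
  have h1 : SD Set.univ fun a (p : ℕ × X) => ∃ n : ℕ,
      p.1 ∈ basicBall ℕ (Nat.pair n (radCode 1)) ∧ U a n p.2 := by
    refine .ex <| .and ?_ ?_
    · exact SD.comp SDMap.fst (f := fun z : α × ℕ => Nat.pair z.2 (radCode 1)) (by fun_prop)
    · exact h.subst SDMap.snd (fun _ _ => trivial)
  refine h1.congr fun a p _ => ⟨fun h => ⟨p.1, ?_, h⟩, ?_⟩
  · rw [mem_basicBall_pair]
    exact (EffPres.d_self p.1).trans_lt (posRatOf_pos _)
  · rintro ⟨n, h1, h2⟩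
    rw [mem_basicBall_pair, posRatOf_radCode] at h1
    have : n = p.1 := by
      by_contra hne
      have h3 : (1 : ℝ) ≤ Dist.dist n p.1 := Nat.pairwise_one_le_dist hne
      have h4 : Dist.dist n p.1 < (2 : ℝ)⁻¹ ^ 1 := h1
      norm_num at h4
      linarith
    rwa [← this]

theorem RC.unsection_nat {f : ℕ → X → ℝ} (h : RC Set.univ f) :
    RC Set.univ fun (_ : Unit) (p : ℕ × X) => f p.1 p.2 :=
  ⟨SD.unsection_nat (U := fun (q : Unit × ℕ) n x => (ratOf q.2 : ℝ) < f n x)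
    (SD.comp h.1 (f := fun z : (Unit × ℕ) × ℕ => (z.2, z.1.2)) (by fun_prop)),
  SD.unsection_nat (U := fun (q : Unit × ℕ) n x => (ratOf q.2 : ℝ) < -f n x)
    (SD.comp h.2 (f := fun z : (Unit × ℕ) × ℕ => (z.2, z.1.2)) (by fun_prop))⟩

end

/-! ## The basic functions -/

section

variable {α X : Type*} [Primcodable α] [MetricPresentation X] {A : Set X}

/-- `P a m q x` is to be read as "`q` has been found as an approximation with error `2⁻ᵐ`". The
choice of `q` need not be unique, which is why this is phrased as a semidecidable relation. -/
theorem RC.of_approx {f : α → X → ℝ} {P : α → ℕ → ℕ → X → Prop}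
    (hP : SD A fun (p : α × ℕ × ℕ) x => P p.1 p.2.1 p.2.2 x)
    (hs : ∀ a, ∀ x ∈ A, ∀ m q, P a m q x → |f a x - ratOf q| ≤ 2⁻¹ ^ m)
    (ht : ∀ a, ∀ x ∈ A, ∀ m, ∃ q, P a m q x) : RC A f := by
  constructor
  · have : SD A fun (p : α × ℕ) x => ∃ m : ℕ × ℕ,
        ((ratOf p.2 : ℝ) < ratOf m.2 - 2⁻¹ ^ m.1) ∧ P p.1 m.1 m.2 x :=
      .ex <| .and (.of_re (QComp.re_lt (by fun_prop) (by fun_prop)))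
        (hP.comp (f := fun z : (α × ℕ) × (ℕ × ℕ) => (z.1.1, z.2.1, z.2.2)) (by fun_prop))
    refine SD.congr this fun ⟨a, k⟩ x hx => ⟨fun h => ?_, ?_⟩
    · obtain ⟨m, hm⟩ := exists_inv_two_pow_lt (half_pos (sub_pos.2 h))
      obtain ⟨q, hq⟩ := ht a x hx m
      have := abs_le.1 (hs a x hx m q hq)
      refine ⟨(m, q), ?_, hq⟩
      simp only at *
      linarith
    · rintro ⟨⟨m, q⟩, h1, h2⟩
      have := abs_le.1 (hs a x hx m q h2)
      simp only at *
      linarith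
  · have : SD A fun (p : α × ℕ) x => ∃ m : ℕ × ℕ,
        ((ratOf p.2 : ℝ) < -(ratOf m.2 + 2⁻¹ ^ m.1)) ∧ P p.1 m.1 m.2 x :=
      .ex <| .and (.of_re (QComp.re_lt (by fun_prop) (by fun_prop)))
        (hP.comp (f := fun z : (α × ℕ) × (ℕ × ℕ) => (z.1.1, z.2.1, z.2.2)) (by fun_prop))
    refine SD.congr this fun ⟨a, k⟩ x hx => ⟨fun h => ?_, ?_⟩
    · obtain ⟨m, hm⟩ := exists_inv_two_pow_lt (half_pos (sub_pos.2 h))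
      obtain ⟨q, hq⟩ := ht a x hx m
      have := abs_le.1 (hs a x hx m q hq)
      refine ⟨(m, q), ?_, hq⟩
      simp only at *
      linarith
    · rintro ⟨⟨m, q⟩, h1, h2⟩
      have := abs_le.1 (hs a x hx m q h2)
      simp only at *
      linarith

end

theorem QComp.max {α : Type*} [Primcodable α] {f g : α → ℝ} (hf : QComp f) (hg : QComp g) :
    QComp fun a => max (f a) (g a) := by
  classical
  simp only [max_def]
  exact .ite (hf.primrec_le hg) hg hf

theorem QComp.min {α : Type*} [Primcodable α] {f g : α → ℝ} (hf : QComp f) (hg : QComp g) :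
    QComp fun a => min (f a) (g a) := by
  classical
  simp only [min_def]
  exact .ite (hf.primrec_le hg) hf hg

theorem QComp.re_eq {α : Type*} [Primcodable α] {f g : α → ℝ} (hf : QComp f) (hg : QComp g) :
    RE fun a => f a = g a :=
  ((hf.re_le hg).and (hg.re_le hf)).congr fun _ => le_antisymm_iff

@[fun_prop]
theorem QComp.inv_posRatOf {α : Type*} [Primcodable α] {f : α → ℕ} (hf : Primrec f) :
    QComp fun a => ((_root_.posRatOf (f a) : ℚ≥0) : ℝ)⁻¹ :=
  of_code (a := fun x => (f x).unpair.2 + 1) (b := fun _ => 0) (c := fun x => (f x).unpair.1)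
    (by fun_prop) (by fun_prop) (by fun_prop) fun x => by
      rw [posRatOf_cast, inv_div]; push_cast; ring

/-- The clamped form avoids a case distinction on a real comparison, which could not be decided. -/
theorem bump_eq_clamp {X : Type*} [MetricPresentation X] (c : X) {r s : ℝ} (h : r < s) (y : X) :
    bump c r s y = max 0 (min 1 ((s - d c y) * (s - r)⁻¹)) := by
  have hsr : 0 < s - r := sub_pos.2 h
  unfold bump
  rw [← div_eq_mul_inv]
  split_ifs with h1 h2
  · rw [min_eq_left, max_eq_right zero_le_one]
    rw [le_div_iff₀ hsr]; linarith
  · rw [min_eq_right, max_eq_right]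
    · apply div_nonneg <;> linarith
    · rw [div_le_iff₀ hsr]; push Not at h1; linarith
  · push Not at h2
    rw [max_eq_left]
    exact (min_le_right _ _).trans (div_nonpos_of_nonpos_of_nonneg (by linarith) hsr.le)

/-- The bump function with code `k = ⟨c, ⟨r, s⟩⟩`. -/
noncomputable def codedBump (X : Type*) [MetricPresentation X] (k : ℕ) : X → ℝ :=
  (BasicTerm.bump k.unpair.1 k.unpair.2.unpair.1 k.unpair.2.unpair.2).eval X

section

variable {α X : Type*} [Primcodable α] [MetricPresentation X]

theorem codedBump_eq (k : ℕ) (x : X) : codedBump X k x =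
    max 0 (min 1 (((posRatOf k.unpair.2.unpair.1 : ℝ) + (posRatOf k.unpair.2.unpair.2 : ℝ) -
      d (basic k.unpair.1) x) * ((posRatOf k.unpair.2.unpair.2 : ℚ≥0) : ℝ)⁻¹)) := by
  have hpos := posRatOf_pos k.unpair.2.unpair.2
  have : ((posRatOf k.unpair.2.unpair.1 : ℚ≥0) : ℝ) <
      ((posRatOf k.unpair.2.unpair.1 + posRatOf k.unpair.2.unpair.2 : ℚ≥0) : ℝ) := by
    push_cast; linarith
  rw [codedBump, BasicTerm.eval, bump_eq_clamp _ this]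
  push_cast
  simp

theorem codedBump_nonneg (k : ℕ) (x : X) : 0 ≤ codedBump X k x := by
  rw [codedBump_eq]; exact le_max_left _ _

theorem codedBump_le_one (k : ℕ) (x : X) : codedBump X k x ≤ 1 := by
  rw [codedBump_eq]; exact max_le zero_le_one (min_le_left _ _)

theorem rc_codedBump [EffPres X] {A : Set X} : RC A fun k (x : X) => codedBump X k x := by
  have h := (RC.dist (X := X) (A := A)).comp (u := fun k : ℕ => k.unpair.1) (by fun_prop)
  have h2 := ((RC.const (α := ℕ) (A := A) (q := fun k => (posRatOf k.unpair.2.unpair.1 : ℝ) +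
    (posRatOf k.unpair.2.unpair.2 : ℝ)) (by fun_prop)).sub h).mul
    (.const (q := fun k => ((posRatOf k.unpair.2.unpair.2 : ℚ≥0) : ℝ)⁻¹) (by fun_prop))
  exact ((RC.const (q := fun _ => 0) (by fun_prop)).max
    ((RC.const (q := fun _ => 1) (by fun_prop)).min h2)).congr fun k x _ => codedBump_eq k x

/-- One step of the recursion that defines the values `v` of the basic functions from the values
`b` of the bump functions. -/
noncomputable def termStep (v b : ℕ → ℝ) (j : ℕ) : ℝ :=
  if j = 0 then 1
  else if (j - 1) % 5 = 0 then b ((j - 1) / 5)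
  else if (j - 1) % 5 = 1 then max (v ((j - 1) / 5).unpair.1) (v ((j - 1) / 5).unpair.2)
  else if (j - 1) % 5 = 2 then min (v ((j - 1) / 5).unpair.1) (v ((j - 1) / 5).unpair.2)
  else if (j - 1) % 5 = 3 then v ((j - 1) / 5).unpair.1 + v ((j - 1) / 5).unpair.2
  else ratOf ((j - 1) / 5).unpair.1 * v ((j - 1) / 5).unpair.2

theorem basicFunction_eq_termStep (j : ℕ) (x : X) : basicFunction X j x =
    termStep (fun k => basicFunction X k x) (fun k => codedBump X k x) j := by
  rcases j with _ | n
  · simp [basicFunction, termStep, BasicTerm.ofNat, BasicTerm.eval]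
  · have h5 : n % 5 < 5 := Nat.mod_lt _ (by norm_num)
    simp only [basicFunction, termStep, codedBump]
    rw [BasicTerm.ofNat]
    simp only [Nat.add_one_ne_zero, if_false, Nat.add_sub_cancel]
    generalize n % 5 = r at h5 ⊢
    interval_cases r <;> simp [BasicTerm.eval]

/-- The error may double with each code. A sum with code `n + 1` has summands with codes at most
`n`, and twice `2 ^ n` is `2 ^ (n + 1)`. A scalar coded by `q` is at most `q ≤ 2 ^ q`, and `q + k ≤
n` by the growth of the pairing function, so the exponents add up within the bound. Maxima and
minima do not increase the error. -/
theorem termStep_sub_le {v w b b' : ℕ → ℝ} {δ : ℝ} {j : ℕ} (hδ : 0 ≤ δ)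
    (hv : ∀ k < j, |v k - w k| ≤ δ * 2 ^ k) (hb : ∀ k < j, |b k - b' k| ≤ δ) :
    |termStep v b j - termStep w b' j| ≤ δ * 2 ^ j := by
  have h2 : ∀ {m n : ℕ}, m ≤ n → δ * (2 : ℝ) ^ m ≤ δ * 2 ^ n := fun h =>
    mul_le_mul_of_nonneg_left (pow_le_pow_right₀ (by norm_num) h) hδ
  rcases j with _ | n
  · simpa [termStep] using hδ
  have hn : n / 5 < n + 1 := by omega
  have ha := lt_of_le_of_lt (Nat.unpair_left_le (n / 5)) hn
  have hb' := lt_of_le_of_lt (Nat.unpair_right_le (n / 5)) hn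
  have hva := hv _ ha
  have hvb := hv _ hb'
  have hva' := hva.trans (h2 ha.le)
  have hvb' := hvb.trans (h2 hb'.le)
  have hab : (n / 5).unpair.1 + (n / 5).unpair.2 ≤ n := by
    have := Nat.add_le_pair (n / 5).unpair.1 (n / 5).unpair.2
    rw [Nat.pair_unpair] at this
    omega
  simp only [termStep, Nat.add_one_ne_zero, if_false, Nat.add_sub_cancel]
  split_ifs
  · exact (hb _ hn).trans (by simpa using h2 (Nat.zero_le (n + 1)))
  · exact (abs_max_sub_max_le_max _ _ _ _).trans (max_le hva' hvb')
  · exact (abs_min_sub_min_le_max _ _ _ _).trans (max_le hva' hvb')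
  · rw [add_sub_add_comm]
    refine (abs_add_le _ _).trans ((add_le_add (hva.trans (h2 (n := n) (by omega)))
      (hvb.trans (h2 (n := n) (by omega)))).trans ?_)
    rw [pow_succ]; linarith
  · rw [← mul_sub, abs_mul]
    have h1 : |(ratOf (n / 5).unpair.1 : ℝ)| ≤ 2 ^ (n / 5).unpair.1 :=
      (abs_ratOf_le_self _).trans (by exact_mod_cast Nat.lt_two_pow_self.le)
    calc _ ≤ (2 : ℝ) ^ (n / 5).unpair.1 * (δ * 2 ^ (n / 5).unpair.2) := by gcongr
      _ = δ * 2 ^ ((n / 5).unpair.1 + (n / 5).unpair.2) := by rw [pow_add]; ring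
      _ ≤ _ := h2 (by omega)

theorem abs_termStep_le {v b : ℕ → ℝ} {j : ℕ} (hv : ∀ k < j, |v k| ≤ 2 ^ k)
    (hb : ∀ k < j, |b k| ≤ 1) : |termStep v b j| ≤ 2 ^ j := by
  rcases j with _ | n
  · simp [termStep]
  have h := termStep_sub_le (v := v) (w := fun _ => 0) (b := b) (b' := fun _ => 0)
    (j := n + 1) zero_le_one (fun k hk => by simpa using hv k hk) fun k hk => by simpa using hb k hk
  have h0 : termStep (fun _ => 0) (fun _ => 0) (n + 1) = 0 := by simp [termStep]
  simpa [h0] using h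

theorem abs_basicFunction_le (j : ℕ) (x : X) : |basicFunction X j x| ≤ 2 ^ j := by
  induction j using Nat.strong_induction_on with
  | _ j ih =>
    rw [basicFunction_eq_termStep]
    refine abs_termStep_le ih fun k _ => ?_
    rw [abs_of_nonneg (codedBump_nonneg _ _)]
    exact codedBump_le_one _ _

theorem QComp.termStep {v b : α × ℕ → ℝ} (hv : QComp v) (hb : QComp b) {j : α → ℕ}
    (hj : Primrec j) :
    QComp fun a => termStep (fun k => v (a, k)) (fun k => b (a, k)) (j a) := by
  have hmod : ∀ i, PrimrecPred fun a => (j a - 1) % 5 = i := fun i =>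
    Primrec.eq.comp (by fun_prop) (by fun_prop)
  have h1 : QComp fun a => v (a, ((j a - 1) / 5).unpair.1) :=
    hv.comp (g := fun a => (a, ((j a - 1) / 5).unpair.1)) (by fun_prop)
  have h2 : QComp fun a => v (a, ((j a - 1) / 5).unpair.2) :=
    hv.comp (g := fun a => (a, ((j a - 1) / 5).unpair.2)) (by fun_prop)
  have h3 : QComp fun a => b (a, (j a - 1) / 5) :=
    hb.comp (g := fun a => (a, (j a - 1) / 5)) (by fun_prop)
  exact .ite (Primrec.eq.comp hj (Primrec.const 0)) .one <| .ite (hmod 0) h3 <|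
    .ite (hmod 1) (h1.max h2) <| .ite (hmod 2) (h1.min h2) <| .ite (hmod 3) (h1.add h2)
    ((QComp.ratOf (by fun_prop)).mul h2)

/-- The nested recursion is unwound into a finite table: rational approximations of the bump
functions, and the values obtained from them by exact rational arithmetic. Bump errors below
`2⁻⁽ᵐ⁺ⁱ⁾` give an error of at most `2⁻ᵐ` at code `i`. -/
theorem rc_basicFunction [EffPres X] {A : Set X} :
    RC A fun j (x : X) => basicFunction X j x := by
  have hstep : QComp fun a : (List ℕ × List ℕ) × ℕ => _root_.termStep
      (fun k => (ratOf (a.1.1.getD k 0) : ℝ)) (fun k => (ratOf (a.1.2.getD k 0) : ℝ)) a.2 :=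
    .termStep (v := fun z : ((List ℕ × List ℕ) × ℕ) × ℕ => (ratOf (z.1.1.1.getD z.2 0) : ℝ))
      (b := fun z => (ratOf (z.1.1.2.getD z.2 0) : ℝ)) (by fun_prop) (by fun_prop) (by fun_prop)
  have hP : SD A fun (p : ℕ × ℕ × ℕ) (x : X) => ∃ T : List ℕ × List ℕ,
      (p.2.2 = T.1.getD p.1 0 ∧ ∀ j < p.1 + 1, (ratOf (T.1.getD j 0) : ℝ) = _root_.termStep
        (fun k => (ratOf (T.1.getD k 0) : ℝ)) (fun k => (ratOf (T.2.getD k 0) : ℝ)) j) ∧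
      ∀ j < p.1, |codedBump X j x - ratOf (T.2.getD j 0)| < 2⁻¹ ^ (p.2.1 + p.1) := by
    refine .ex <| .and (.of_re (.and (.eq (by fun_prop) (by fun_prop)) (.forall_lt
      (QComp.re_eq (by fun_prop) ?_) (by fun_prop)))) (.forall_lt ?_ (by fun_prop))
    · exact hstep.comp (g := fun z : ((ℕ × ℕ × ℕ) × (List ℕ × List ℕ)) × ℕ => (z.1.2, z.2))
        (by fun_prop)
    · exact (((rc_codedBump.comp (by fun_prop)).sub (.const (by fun_prop))).abs).lt
        (.const (by fun_prop))
  refine .of_approx (P := fun i m q x => ∃ T : List ℕ × List ℕ,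
      (q = T.1.getD i 0 ∧ ∀ j < i + 1, (ratOf (T.1.getD j 0) : ℝ) = _root_.termStep
        (fun k => (ratOf (T.1.getD k 0) : ℝ)) (fun k => (ratOf (T.2.getD k 0) : ℝ)) j) ∧
      ∀ j < i, |codedBump X j x - ratOf (T.2.getD j 0)| < 2⁻¹ ^ (m + i)) hP ?_ ?_
  · rintro i x - m q ⟨⟨L, B⟩, ⟨rfl, hL⟩, hB⟩
    simp only at hL hB ⊢
    have key : ∀ j ≤ i, |basicFunction X j x - ratOf (L.getD j 0)| ≤
        2⁻¹ ^ (m + i) * 2 ^ j := by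
      intro j
      induction j using Nat.strong_induction_on with
      | _ j ih =>
        intro hj
        rw [basicFunction_eq_termStep, hL j (Nat.lt_succ_of_le hj)]
        exact termStep_sub_le (by positivity) (fun k hk => ih k hk (hk.le.trans hj))
          fun k hk => (hB k (hk.trans_le hj)).le
    refine (key i le_rfl).trans (le_of_eq ?_)
    rw [pow_add, mul_assoc, ← mul_pow]
    norm_num
  · intro i x _ m
    obtain ⟨g, -, hg⟩ := hstep
    choose c hc using fun j => exists_ratOf_btwn
      (lt_add_of_pos_right (codedBump X j x) (by positivity : (0 : ℝ) < 2⁻¹ ^ (m + i)))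
    set B := (List.range i).map c with hB
    have hL : ∀ n, ∃ L : List ℕ, L.length = n ∧ ∀ j < n, (ratOf (L.getD j 0) : ℝ) =
        _root_.termStep (fun k => (ratOf (L.getD k 0) : ℝ))
          (fun k => (ratOf (B.getD k 0) : ℝ)) j := by
      intro n
      induction n with
      | zero => exact ⟨[], rfl, by simp⟩
      | succ n ih =>
        obtain ⟨L, rfl, hL⟩ := ih
        have hcongr : ∀ j ≤ L.length, _root_.termStep
            (fun k => (ratOf ((L ++ [g ((L, B), L.length)]).getD k 0) : ℝ))
            (fun k => (ratOf (B.getD k 0) : ℝ)) j =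
          _root_.termStep (fun k => (ratOf (L.getD k 0) : ℝ))
            (fun k => (ratOf (B.getD k 0) : ℝ)) j := fun j hj => by
          -- With `δ = 0` the error estimate says that the value at `j` depends only on entries
          -- before `j`, so appending an entry does not disturb it.
          have := termStep_sub_le (v := fun k => (ratOf ((L ++ [g ((L, B), L.length)]).getD k 0) : ℝ))
            (w := fun k => (ratOf (L.getD k 0) : ℝ)) (b := fun k => (ratOf (B.getD k 0) : ℝ))
            (b' := fun k => (ratOf (B.getD k 0) : ℝ)) (j := j) le_rfl
            (fun k hk => by rw [List.getD_append _ _ _ _ (hk.trans_le hj)]; simp)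
            (fun k hk => by simp)
          rw [zero_mul] at this
          exact sub_eq_zero.1 (abs_nonpos_iff.1 this)
        refine ⟨L ++ [g ((L, B), L.length)], by simp, fun j hj => ?_⟩
        rcases (Nat.lt_succ_iff.1 hj).lt_or_eq with hlt | rfl
        · rw [hcongr j hlt.le, List.getD_append _ _ _ _ hlt, hL j hlt]
        · rw [hcongr _ le_rfl, List.getD_append_right _ _ _ _ le_rfl]
          simp [← hg]
    obtain ⟨L, -, hL⟩ := hL (i + 1)
    refine ⟨_, (L, B), ⟨rfl, hL⟩, fun j hj => ?_⟩
    simp only [hB, List.getD_map_range hj]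
    rw [abs_sub_comm, abs_of_pos (by linarith [(hc j).1])]
    linarith [(hc j).2]

end

/-! ## Integrals of basic functions and the distance of measures -/

section

variable {X : Type*} [ComputableMetricSpace X]

theorem continuous_codedBump (k : ℕ) : Continuous (codedBump X k) := by
  have : codedBump X k = fun x => max 0 (min 1 (((posRatOf k.unpair.2.unpair.1 : ℝ) +
      (posRatOf k.unpair.2.unpair.2 : ℝ) - dist (basic k.unpair.1) x) *
      ((posRatOf k.unpair.2.unpair.2 : ℚ≥0) : ℝ)⁻¹)) := funext fun x => codedBump_eq k x
  rw [this]
  fun_prop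

theorem continuous_basicFunction (j : ℕ) : Continuous (basicFunction X j) := by
  induction j using Nat.strong_induction_on with
  | _ j ih =>
    have : basicFunction X j = fun x =>
        termStep (fun k => basicFunction X k x) (fun k => codedBump X k x) j :=
      funext fun x => basicFunction_eq_termStep j x
    rw [this]
    rcases j with _ | n
    · simpa [termStep] using continuous_const
    have hn : n / 5 < n + 1 := by omega
    have ha := ih _ (lt_of_le_of_lt (Nat.unpair_left_le (n / 5)) hn)
    have hb := ih _ (lt_of_le_of_lt (Nat.unpair_right_le (n / 5)) hn)
    simp only [termStep, Nat.add_one_ne_zero, if_false, Nat.add_sub_cancel]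
    split_ifs
    · exact continuous_codedBump _
    · exact ha.max hb
    · exact ha.min hb
    · exact ha.add hb
    · exact continuous_const.mul hb

variable [MeasurableSpace X] [BorelSpace X]

theorem integrable_basicFunction (j : ℕ) (μ : Measure X) [IsFiniteMeasure μ] :
    Integrable (basicFunction X j) μ :=
  .of_bound (continuous_basicFunction j).aestronglyMeasurable (2 ^ j)
    (Eventually.of_forall fun x => abs_basicFunction_le j x)

theorem integral_basicMeasure {f : X → ℝ} (hf : Continuous f) {C : ℝ} (hC : ∀ x, |f x| ≤ C)
    (l : List ℕ) : ∫ x, f x ∂(basicMeasure X l : Measure X) =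
      ∑ i ∈ Finset.range l.length, (posRatOf (l.getD i 0).unpair.1 : ℝ) *
        f (basic (l.getD i 0).unpair.2) := by
  have hint : ∀ (μ : Measure X) [IsFiniteMeasure μ], Integrable f μ := fun μ _ =>
    .of_bound hf.aestronglyMeasurable C (Eventually.of_forall hC)
  induction l with
  | nil => simp [basicMeasure]
  | cons k l ih =>
    have h1 : (basicMeasure X (k :: l) : Measure X) =
        ((posRatOf k.unpair.1 : ℚ≥0) : ℝ≥0) • Measure.dirac (basic k.unpair.2 : X) +
          (basicMeasure X l : Measure X) := by
      simp only [basicMeasure, List.map_cons, List.sum_cons, FiniteMeasure.toMeasure_add,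
        FiniteMeasure.toMeasure_smul]
      rfl
    rw [h1, integral_add_measure (hint _) (hint _), integral_smul_nnreal_measure, integral_dirac,
      ih, List.length_cons, Finset.sum_range_succ', add_comm]
    congr 1

theorem rc_integral_basicMeasure {Z : Type*} [MetricPresentation Z] {A : Set Z} :
    RC A fun (p : List ℕ × ℕ) (_ : Z) =>
      ∫ x, basicFunction X p.2 x ∂(basicMeasure X p.1 : Measure X) := by
  have h1 : RC A fun (p : (List ℕ × ℕ) × ℕ) (_ : Z) =>
      (posRatOf (p.1.1.getD p.2 0).unpair.1 : ℝ) *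
        basicFunction X p.1.2 (basic (p.1.1.getD p.2 0).unpair.2) :=
    .mul (.const (by fun_prop)) ((RC.re_basic rc_basicFunction).comp
      (u := fun p : (List ℕ × ℕ) × ℕ => (p.1.2, (p.1.1.getD p.2 0).unpair.2)) (by fun_prop))
  exact (RC.sum (h := fun (p : List ℕ × ℕ) i _ => (posRatOf (p.1.getD i 0).unpair.1 : ℝ) *
    basicFunction X p.2 (basic (p.1.getD i 0).unpair.2)) h1 (n := fun p => p.1.length)
    (by fun_prop)).congr fun p z _ =>
      integral_basicMeasure (continuous_basicFunction _) (abs_basicFunction_le _) _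

/-- Code `0` denotes the constant `1`, so the total mass is itself an integral of a basic function
and normalisation is a quotient of two such integrals. -/
theorem integral_normalize {X : Type*} [ComputableMetricSpace X] [MeasurableSpace X] [Nonempty X]
    {μ : FiniteMeasure X} (hμ : μ ≠ 0) (f : X → ℝ) :
    ∫ x, f x ∂(μ.normalize : Measure X) =
      (∫ x, f x ∂(μ : Measure X)) / ∫ x, basicFunction X 0 x ∂(μ : Measure X) := by
  rw [FiniteMeasure.toMeasure_normalize_eq_of_nonzero _ hμ, integral_smul_nnreal_measure,
    NNReal.smul_def, smul_eq_mul, div_eq_inv_mul]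
  congr 1
  have : basicFunction X 0 = fun _ => 1 := by
    funext x; simp [basicFunction_eq_termStep, termStep]
  rw [this, integral_const, smul_eq_mul, mul_one]
  rw [NNReal.coe_inv]
  rfl

theorem integral_basicFunction_zero {X : Type*} [ComputableMetricSpace X] [MeasurableSpace X]
    (μ : Measure X) :
    ∫ x, basicFunction X 0 x ∂μ = μ.real Set.univ := by
  have : basicFunction X 0 = fun _ => 1 := by
    funext x; simp [basicFunction_eq_termStep, termStep]
  rw [this, integral_const, smul_eq_mul, mul_one]

theorem basicMeasure_cons_mass_pos (k : ℕ) (l : List ℕ) :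
    0 < ∫ x, basicFunction X 0 x ∂(basicMeasure X (k :: l) : Measure X) := by
  rw [integral_basicMeasure (continuous_basicFunction _) (abs_basicFunction_le _)]
  refine Finset.sum_pos (fun i _ => ?_) ⟨0, by simp⟩
  rw [basicFunction_eq_termStep]
  simpa [termStep] using posRatOf_pos _

theorem basicMeasure_cons_ne_zero (k : ℕ) (l : List ℕ) : basicMeasure X (k :: l) ≠ 0 := by
  intro h
  have := basicMeasure_cons_mass_pos (X := X) k l
  simp [h] at this

theorem RC.div_pos {α Z : Type*} [Primcodable α] [MetricPresentation Z] {A : Set Z}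
    {f g : α → Z → ℝ} (hf : RC A f) (hg : RC A g) (hpos : ∀ a, ∀ x ∈ A, 0 < g a x) :
    RC A fun a x => f a x / g a x := by
  have hf' := hf.comp (u := fun p : α × ℕ => p.1) (by fun_prop)
  have hg' := hg.comp (u := fun p : α × ℕ => p.1) (by fun_prop)
  have hq : RC A fun (p : α × ℕ) (_ : Z) => (ratOf p.2 : ℝ) := .const (by fun_prop)
  refine ⟨((hq.mul hg').lt hf').congr fun p x hx => lt_div_iff₀ (hpos _ _ hx),
    ((hq.mul hg').lt hf'.neg).congr fun p x hx => ?_⟩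
  beta_reduce
  rw [← neg_div, lt_div_iff₀ (hpos _ _ hx)]

theorem rc_integral_basic_probabilityMeasure {Z : Type*} [MetricPresentation Z] {A : Set Z} :
    RC A fun (p : ℕ × ℕ) (_ : Z) => ∫ x, basicFunction X p.2 x
      ∂((MetricPresentation.basic p.1 : ProbabilityMeasure X) : Measure X) := by
  have hI := rc_integral_basicMeasure (X := X) (A := A)
  refine ((hI.comp (u := fun p : ℕ × ℕ => (p.1.unpair.1 :: Denumerable.ofNat (List ℕ) p.1.unpair.2,
      p.2)) (by fun_prop)).div_pos
    (hI.comp (u := fun p : ℕ × ℕ => (p.1.unpair.1 :: Denumerable.ofNat (List ℕ) p.1.unpair.2, 0))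
      (by fun_prop)) fun p x _ => basicMeasure_cons_mass_pos _ _).congr fun p x _ => ?_
  exact @integral_normalize X _ _ ⟨basic 0⟩ _ (basicMeasure_cons_ne_zero _ _) _

end

/-! ### The distance of measures as a series of integrals -/

section MeasureDist

variable {X : Type*} [MetricPresentation X] [MeasurableSpace X]

/-- The summands of the distance of two measures. -/
noncomputable def distTerm (μ ν : Measure X) (i : ℕ) : ℝ :=
  (2 : ℝ)⁻¹ ^ i *
    (1 - Real.exp (-|(∫ x, basicFunction X i x ∂μ) - ∫ x, basicFunction X i x ∂ν|))

theorem distTerm_nonneg (μ ν : Measure X) (i : ℕ) : 0 ≤ distTerm μ ν i := by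
  refine mul_nonneg (by positivity) (sub_nonneg.2 (Real.exp_le_one_iff.2 ?_))
  simp

theorem distTerm_le (μ ν : Measure X) (i : ℕ) : distTerm μ ν i ≤ 2⁻¹ ^ i :=
  mul_le_of_le_one_right (by positivity) (sub_le_self _ (Real.exp_pos _).le)

theorem summable_inv_two_pow : Summable fun i : ℕ => (2 : ℝ)⁻¹ ^ i :=
  summable_geometric_of_lt_one (by norm_num) (by norm_num)

theorem summable_distTerm (μ ν : Measure X) : Summable (distTerm μ ν) :=
  .of_nonneg_of_le (distTerm_nonneg μ ν) (distTerm_le μ ν) summable_inv_two_pow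

theorem measureDist_eq (μ ν : Measure X) : measureDist μ ν = ∑' i, distTerm μ ν i := rfl

theorem distTerm_le_measureDist (μ ν : Measure X) (i : ℕ) : distTerm μ ν i ≤ measureDist μ ν :=
  (summable_distTerm μ ν).le_tsum i fun j _ => distTerm_nonneg μ ν j

theorem measureDist_self (μ : Measure X) : measureDist μ μ = 0 := by
  simp [measureDist]

theorem measureDist_comm (μ ν : Measure X) : measureDist μ ν = measureDist ν μ := by
  simp only [measureDist, abs_sub_comm]

/-- Termwise this is the triangle inequality for absolute values together with `(1 - exp (-|a|)) *
(1 - exp (-|b|)) ≥ 0`. -/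
theorem measureDist_triangle (μ ν ρ : Measure X) :
    measureDist μ ρ ≤ measureDist μ ν + measureDist ν ρ := by
  simp only [measureDist_eq]
  rw [← (summable_distTerm μ ν).tsum_add (summable_distTerm ν ρ)]
  refine (summable_distTerm μ ρ).tsum_le_tsum (fun i => ?_)
    ((summable_distTerm μ ν).add (summable_distTerm ν ρ))
  simp only [distTerm]
  rw [← mul_add]
  refine mul_le_mul_of_nonneg_left ?_ (by positivity)
  set a := (∫ x, basicFunction X i x ∂μ) - ∫ x, basicFunction X i x ∂ν with ha
  set b := (∫ x, basicFunction X i x ∂ν) - ∫ x, basicFunction X i x ∂ρ with hb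
  have hab : (∫ x, basicFunction X i x ∂μ) - ∫ x, basicFunction X i x ∂ρ = a + b := by
    rw [ha, hb]; ring
  rw [hab]
  have h1 : Real.exp (-|a|) * Real.exp (-|b|) ≤ Real.exp (-|a + b|) := by
    rw [← Real.exp_add]
    exact Real.exp_le_exp.2 (by linarith [abs_add_le a b])
  have h2 : Real.exp (-|a|) ≤ 1 := Real.exp_le_one_iff.2 (by simp)
  have h3 : Real.exp (-|b|) ≤ 1 := Real.exp_le_one_iff.2 (by simp)
  nlinarith [mul_nonneg (sub_nonneg.2 h2) (sub_nonneg.2 h3)]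

theorem measureDist_sub_sum (μ ν : Measure X) (N : ℕ) :
    |measureDist μ ν - ∑ i ∈ Finset.range N, distTerm μ ν i| ≤ 2 * 2⁻¹ ^ N := by
  rw [measureDist_eq, ← (summable_distTerm μ ν).sum_add_tsum_nat_add N, add_sub_cancel_left,
    abs_of_nonneg (tsum_nonneg fun i => distTerm_nonneg μ ν _)]
  have h1 : Summable fun i : ℕ => (2 : ℝ)⁻¹ ^ (i + N) := (summable_nat_add_iff N).2
    summable_inv_two_pow
  refine (((summable_nat_add_iff N).2 (summable_distTerm μ ν)).tsum_le_tsum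
    (fun i => distTerm_le μ ν _) h1).trans (le_of_eq ?_)
  simp only [pow_add]
  rw [tsum_mul_right, tsum_geometric_of_lt_one (by norm_num) (by norm_num)]
  norm_num

theorem tendsto_measureDist {μ : ℕ → Measure X} {ν : Measure X}
    (h : ∀ i, Tendsto (fun n => ∫ x, basicFunction X i x ∂(μ n)) atTop
      (𝓝 (∫ x, basicFunction X i x ∂ν))) :
    Tendsto (fun n => measureDist (μ n) ν) atTop (𝓝 0) := by
  rw [← measureDist_self ν]
  simp only [measureDist_eq]
  refine tendsto_tsum_of_dominated_convergence (bound := fun i => (2 : ℝ)⁻¹ ^ i)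
    summable_inv_two_pow (fun i => ?_) (Eventually.of_forall fun n i => ?_)
  · have hc : Continuous fun y : ℝ => (2 : ℝ)⁻¹ ^ i *
        (1 - Real.exp (-|y - ∫ x, basicFunction X i x ∂ν|)) := by fun_prop
    exact (hc.tendsto _).comp (h i)
  · rw [Real.norm_of_nonneg (distTerm_nonneg _ _ _)]
    exact distTerm_le _ _ _

/-- The `i`-th summand alone gives `1 - exp (-y) < ε` with `ε = 2⁻⁽ᵐ⁺¹⁾ ≤ 1 / 2`. Since `exp (-y) *
(1 + y) ≤ 1`, this forces `y ≤ ε / (1 - ε) ≤ 2 * ε`. -/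
theorem abs_integral_sub_le {μ ν : Measure X} {i m : ℕ}
    (h : measureDist μ ν < 2⁻¹ ^ (i + m + 1)) :
    |(∫ x, basicFunction X i x ∂μ) - ∫ x, basicFunction X i x ∂ν| ≤ 2⁻¹ ^ m := by
  set y := |(∫ x, basicFunction X i x ∂μ) - ∫ x, basicFunction X i x ∂ν| with hy
  have hy0 : 0 ≤ y := abs_nonneg _
  have h1 : (2 : ℝ)⁻¹ ^ i * (1 - Real.exp (-y)) < 2⁻¹ ^ i * 2⁻¹ ^ (m + 1) := by
    rw [← pow_add, ← add_assoc]
    exact (distTerm_le_measureDist μ ν i).trans_lt h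
  have h2 : 1 - Real.exp (-y) < 2⁻¹ ^ (m + 1) := lt_of_mul_lt_mul_left h1 (by positivity)
  have h3 : Real.exp (-y) * (1 + y) ≤ 1 := by
    rw [Real.exp_neg, inv_mul_le_iff₀ (Real.exp_pos y)]
    linarith [Real.add_one_le_exp y]
  have h4 : (2 : ℝ)⁻¹ ^ (m + 1) ≤ 2⁻¹ := by
    simpa using inv_two_pow_anti (Nat.le_add_left 1 m)
  have h5 : (2 : ℝ)⁻¹ ^ m = 2 * 2⁻¹ ^ (m + 1) := by rw [pow_succ]; ring
  rw [h5]
  nlinarith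

theorem RC.of_lim {α Z : Type*} [Primcodable α] [MetricPresentation Z] {A : Set Z}
    {f : α → Z → ℝ} {h : α → ℕ → Z → ℝ} (hh : RC A fun (p : α × ℕ) z => h p.1 p.2 z)
    (H : ∀ a, ∀ x ∈ A, ∀ N, |f a x - h a N x| ≤ 2 * 2⁻¹ ^ N) : RC A f := by
  refine .of_approx (P := fun a m q x => |h a (m + 2) x - ratOf q| < 2⁻¹ ^ (m + 1)) ?_ ?_ ?_
  · exact ((hh.comp (u := fun p : α × ℕ × ℕ => (p.1, p.2.1 + 2)) (by fun_prop)).sub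
      (.const (by fun_prop))).abs.lt (.const (by fun_prop))
  · intro a x hx m q hq
    have h1 := abs_le.1 (H a x hx (m + 2))
    have h2 := abs_lt.1 hq
    have h5 : (2 : ℝ)⁻¹ ^ m = 2 * 2⁻¹ ^ (m + 2) + 2⁻¹ ^ (m + 1) := by
      rw [pow_succ, pow_succ]; ring
    rw [h5, abs_le]
    constructor <;> linarith
  · intro a x _ m
    obtain ⟨q, h1, h2⟩ := exists_ratOf_btwn
      (lt_add_of_pos_right (h a (m + 2) x) (by positivity : (0 : ℝ) < 2⁻¹ ^ (m + 1)))
    refine ⟨q, ?_⟩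
    rw [abs_lt]
    constructor <;> linarith

theorem rc_measureDist {α Z : Type*} [Primcodable α] [MetricPresentation Z] {A : Set Z}
    {μ ν : α → Z → Measure X}
    (hμ : RC A fun (p : α × ℕ) z => ∫ x, basicFunction X p.2 x ∂(μ p.1 z))
    (hν : RC A fun (p : α × ℕ) z => ∫ x, basicFunction X p.2 x ∂(ν p.1 z)) :
    RC A fun a z => measureDist (μ a z) (ν a z) := by
  have h1 : RC A fun (p : α × ℕ) z => distTerm (μ p.1 z) (ν p.1 z) p.2 :=
    (RC.const (by fun_prop)).mul (hμ.sub hν).abs.one_sub_exp_neg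
  have h2 : RC A fun (p : α × ℕ) z =>
      ∑ i ∈ Finset.range p.2, distTerm (μ p.1 z) (ν p.1 z) i :=
    .sum (h := fun (p : α × ℕ) i z => distTerm (μ p.1 z) (ν p.1 z) i)
      (h1.comp (u := fun q : (α × ℕ) × ℕ => (q.1.1, q.2)) (by fun_prop)) (by fun_prop)
  exact .of_lim (h := fun a N z => ∑ i ∈ Finset.range N, distTerm (μ a z) (ν a z) i) h2
    fun a x _ N => measureDist_sub_sum _ _ N

end MeasureDist

/-! ## Density of the basic measures -/

section

variable {X : Type*} [ComputableMetricSpace X] [MeasurableSpace X] [BorelSpace X]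

/-- By density, the nearest of the first `N + 1` basic points converges to `x`; dominated
convergence applies, and the integral of the simple function is the displayed sum. -/
theorem tendsto_integral_nearestPt {f : X → ℝ} (hf : Continuous f) {C : ℝ} (hC : ∀ x, |f x| ≤ C)
    (μ : Measure X) [IsFiniteMeasure μ] :
    Tendsto (fun N => ∑ k ∈ Finset.range (N + 1), μ.real
      (SimpleFunc.nearestPtInd (basic : ℕ → X) N ⁻¹' {k}) * f (basic k)) atTop
      (𝓝 (∫ x, f x ∂μ)) := by
  have h1 : ∀ N, ∫ x, f (SimpleFunc.nearestPt (basic : ℕ → X) N x) ∂μ =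
      ∑ k ∈ Finset.range (N + 1), μ.real
        (SimpleFunc.nearestPtInd (basic : ℕ → X) N ⁻¹' {k}) * f (basic k) := by
    intro N
    have h2 : ∀ x, f (SimpleFunc.nearestPt (basic : ℕ → X) N x) =
        ∑ k ∈ Finset.range (N + 1), (SimpleFunc.nearestPtInd (basic : ℕ → X) N ⁻¹' {k}).indicator
          (fun _ => f (basic k)) x := by
      intro x
      rw [Finset.sum_eq_single (SimpleFunc.nearestPtInd (basic : ℕ → X) N x)]
      · simp [SimpleFunc.nearestPt]
      · intro k _ hk
        exact Set.indicator_of_notMem (fun h => hk (by simpa using h.symm)) _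
      · intro h
        exact absurd (Finset.mem_range.2 (Nat.lt_succ_of_le (SimpleFunc.nearestPtInd_le _ N x))) h
    have hm : ∀ k, MeasurableSet (SimpleFunc.nearestPtInd (basic : ℕ → X) N ⁻¹' {k}) := fun k =>
      SimpleFunc.measurableSet_fiber _ _
    simp only [h2]
    rw [integral_finsetSum _ fun k _ => (integrable_const _).indicator (hm k)]
    refine Finset.sum_congr rfl fun k _ => ?_
    rw [integral_indicator_const _ (hm k), smul_eq_mul]
  simp only [← h1]
  refine tendsto_integral_of_dominated_convergence (fun _ => C) (fun N => ?_)
    (integrable_const _) (fun N => Eventually.of_forall fun x => hC _)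
    (Eventually.of_forall fun x => (hf.tendsto _).comp (SimpleFunc.tendsto_nearestPt
      (ComputableMetricSpace.dense x)))
  exact (hf.measurable.comp (SimpleFunc.measurable _)).aestronglyMeasurable

/-- The mass of each cell of nearest points is moved to its basic point and rounded to a rational.
The codes are kept nonempty so that the same sequence can be normalised for probability measures. -/
theorem exists_basicMeasure_tendsto (μ : Measure X) [IsFiniteMeasure μ] :
    ∃ l : ℕ → ℕ × List ℕ, ∀ i, Tendsto (fun n => ∫ x, basicFunction X i x
      ∂(basicMeasure X ((l n).1 :: (l n).2) : Measure X)) atTop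
      (𝓝 (∫ x, basicFunction X i x ∂μ)) := by
  set w : ℕ → ℕ → ℝ := fun N k =>
    μ.real (SimpleFunc.nearestPtInd (basic : ℕ → X) N ⁻¹' {k}) with hw
  -- Weights must be positive even for null cells, hence rounding upwards; the `N + 1` errors add up
  -- to less than `2⁻ᴺ`.
  choose q hq using fun N k : ℕ => exists_posRatOf_btwn (x := w N k) measureReal_nonneg
    (lt_add_of_pos_right (w N k) (by positivity : (0 : ℝ) < 2⁻¹ ^ N * ((N : ℝ) + 1)⁻¹))
  set L : ℕ → List ℕ := fun N => (List.range (N + 1)).map fun k => Nat.pair (q N k) k with hL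
  have hLcons : ∀ N, ∃ p : ℕ × List ℕ, L N = p.1 :: p.2 := fun N =>
    ⟨(_, _), by rw [hL]; simp only [List.range_succ_eq_map, List.map_cons]; rfl⟩
  choose l hl using hLcons
  refine ⟨l, fun i => ?_⟩
  simp only [← hl]
  have h1 := tendsto_integral_nearestPt (continuous_basicFunction i) (abs_basicFunction_le i) μ
  have h2 : ∀ N, |(∫ x, basicFunction X i x ∂(basicMeasure X (L N) : Measure X)) -
      ∑ k ∈ Finset.range (N + 1), w N k * basicFunction X i (basic k)| ≤ 2 ^ i * 2⁻¹ ^ N := by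
    intro N
    have h3 : ∫ x, basicFunction X i x ∂(basicMeasure X (L N) : Measure X) =
        ∑ k ∈ Finset.range (N + 1), (posRatOf (q N k) : ℝ) * basicFunction X i (basic k) := by
      rw [integral_basicMeasure (continuous_basicFunction _) (abs_basicFunction_le _)]
      simp only [hL, List.length_map, List.length_range]
      refine Finset.sum_congr rfl fun k hk => ?_
      rw [List.getD_map_range (Finset.mem_range.1 hk), Nat.unpair_pair]
    rw [h3, ← Finset.sum_sub_distrib]
    refine (Finset.abs_sum_le_sum_abs _ _).trans ?_
    have h4 : ∀ k ∈ Finset.range (N + 1), |(posRatOf (q N k) : ℝ) * basicFunction X i (basic k) -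
        w N k * basicFunction X i (basic k)| ≤ 2⁻¹ ^ N * ((N : ℝ) + 1)⁻¹ * 2 ^ i := by
      intro k _
      rw [← sub_mul, abs_mul]
      refine mul_le_mul ?_ (abs_basicFunction_le _ _) (abs_nonneg _) (by positivity)
      rw [abs_of_pos (by linarith [(hq N k).1])]
      linarith [(hq N k).2]
    refine (Finset.sum_le_sum h4).trans (le_of_eq ?_)
    rw [Finset.sum_const, Finset.card_range, nsmul_eq_mul]
    push_cast
    field_simp
  have h5 : Tendsto (fun N : ℕ => (2 : ℝ) ^ i * 2⁻¹ ^ N) atTop (𝓝 0) := by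
    simpa using (tendsto_pow_atTop_nhds_zero_of_lt_one (r := (2 : ℝ)⁻¹) (by norm_num)
      (by norm_num)).const_mul (2 ^ i)
  have h6 := squeeze_zero_norm (f := fun N =>
    (∫ x, basicFunction X i x ∂(basicMeasure X (L N) : Measure X)) -
      ∑ k ∈ Finset.range (N + 1), w N k * basicFunction X i (basic k)) h2 h5
  have h7 := h6.add h1
  rw [zero_add] at h7
  exact h7.congr fun N => sub_add_cancel _ _

end

/-! ## Presentations of spaces of measures -/

/-- The space `M` is presented as a space of finite measures on `X`, with the distance
`measureDist` and basic points for which the integrals of the basic functions are computable. -/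
structure IsMeasurePres {X M : Type*} [MetricPresentation X] [MeasurableSpace X]
    [MetricPresentation M] (c : M → Measure X) : Prop where
  d_eq (μ ν : M) : d μ ν = measureDist (c μ) (c ν)
  rc_basic : RC (X := ℕ) Set.univ fun (p : ℕ × ℕ) _ =>
    ∫ x, basicFunction X p.2 x ∂(c (basic p.1))
  exists_tendsto (μ : M) : ∃ n : ℕ → ℕ, ∀ i, Tendsto
    (fun k => ∫ x, basicFunction X i x ∂(c (basic (n k)))) atTop
    (𝓝 (∫ x, basicFunction X i x ∂(c μ)))

/-- Bounds that do not depend on the point are r.e. outright, so the space carrying the family is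
immaterial. -/
theorem RC.lift {α Y Z : Type*} [Primcodable α] [MetricPresentation Y] [EffPres Y]
    [MetricPresentation Z] {A : Set Z}
    {f : α → ℝ} (h : RC (X := Y) Set.univ fun a _ => f a) : RC A fun a (_ : Z) => f a :=
  (RC.re_basic h).comp (u := fun a => (a, 0)) (by fun_prop)

namespace IsMeasurePres

variable {X M Z : Type*} [MetricPresentation X] [MeasurableSpace X] [MetricPresentation M]
  [MetricPresentation Z] {A : Set Z} {c : M → Measure X}

theorem effPres (h : IsMeasurePres c) : EffPres M := by
  have hd : RC (X := ℕ) Set.univ fun (p : ℕ × ℕ) _ => d (basic p.1 : M) (basic p.2) := by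
    refine (rc_measureDist (μ := fun (p : ℕ × ℕ) _ => c (basic p.1))
      (ν := fun (p : ℕ × ℕ) _ => c (basic p.2)) ?_ ?_).congr fun p _ _ => h.d_eq _ _
    · exact h.rc_basic.comp (u := fun p : (ℕ × ℕ) × ℕ => (p.1.1, p.2)) (by fun_prop)
    · exact h.rc_basic.comp (u := fun p : (ℕ × ℕ) × ℕ => (p.1.2, p.2)) (by fun_prop)
  refine ⟨fun x => ?_, fun x y => ?_, fun x y z => ?_, fun μ ε hε => ?_, ?_, ?_⟩
  · rw [h.d_eq, measureDist_self]
  · rw [h.d_eq, h.d_eq, measureDist_comm]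
  · rw [h.d_eq, h.d_eq, h.d_eq]
    exact measureDist_triangle _ _ _
  · obtain ⟨n, hn⟩ := h.exists_tendsto μ
    obtain ⟨k, hk⟩ := ((tendsto_measureDist hn).eventually_lt_const hε).exists
    exact ⟨n k, by rwa [h.d_eq]⟩
  · have h1 : SD (X := ℕ) Set.univ fun (p : (ℕ × ℕ) × ℕ) _ =>
        d (basic p.1.1 : M) (basic p.1.2) < ratOf p.2 :=
      (hd.comp (u := fun p : (ℕ × ℕ) × ℕ => p.1) (by fun_prop)).lt (.const (by fun_prop))
    exact h1.re_basic.comp (f := fun p => (p, 0)) (by fun_prop)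
  · have h1 : SD (X := ℕ) Set.univ fun (p : (ℕ × ℕ) × ℕ) _ =>
        (ratOf p.2 : ℝ) < d (basic p.1.1 : M) (basic p.1.2) :=
      RC.lt (.const (by fun_prop))
        (hd.comp (u := fun p : (ℕ × ℕ) × ℕ => p.1) (by fun_prop))
    exact h1.re_basic.comp (f := fun p => (p, 0)) (by fun_prop)

/-- A basic measure at distance less than `2⁻⁽ⁱ⁺ᵐ⁺²⁾` determines the `i`-th integral up to
`2⁻⁽ᵐ⁺¹⁾`; a rational approximation uses the other half of the error. -/
theorem rc_integral (h : IsMeasurePres c) {B : Set M} :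
    RC B fun i (μ : M) => ∫ x, basicFunction X i x ∂(c μ) := by
  have := h.effPres
  have hb := h.rc_basic.lift (A := B)
  refine .of_approx (P := fun i m q μ => ∃ n : ℕ,
    μ ∈ basicBall M (Nat.pair n (radCode (i + (m + 1) + 1))) ∧
    |(∫ x, basicFunction X i x ∂(c (basic n))) - ratOf q| < 2⁻¹ ^ (m + 1)) ?_ ?_ ?_
  · refine .ex <| .and (.ball (by fun_prop)) (RC.lt (.abs (.sub ?_ (.const (by fun_prop))))
      (.const (by fun_prop)))
    exact hb.comp (u := fun p : (ℕ × ℕ × ℕ) × ℕ => (p.2, p.1.1)) (by fun_prop)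
  · rintro i μ - m q ⟨n, h1, h2⟩
    rw [mem_basicBall_pair, posRatOf_radCode, h.d_eq, measureDist_comm] at h1
    have h3 := abs_le.1 (abs_integral_sub_le h1)
    have h4 := abs_lt.1 h2
    have h5 : (2 : ℝ)⁻¹ ^ m = 2⁻¹ ^ (m + 1) + 2⁻¹ ^ (m + 1) := by rw [pow_succ]; ring
    rw [h5, abs_le]
    constructor <;> linarith
  · intro i μ _ m
    obtain ⟨n, hn⟩ := EffPres.exists_basic μ
      (by positivity : (0 : ℝ) < 2⁻¹ ^ (i + (m + 1) + 1))
    obtain ⟨q, h1, h2⟩ := exists_ratOf_btwn (lt_add_of_pos_right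
      (∫ x, basicFunction X i x ∂(c (basic n))) (by positivity : (0 : ℝ) < 2⁻¹ ^ (m + 1)))
    refine ⟨q, n, by rwa [mem_basicBall_pair, posRatOf_radCode], ?_⟩
    rw [abs_lt]
    constructor <;> linarith

/-- Converse of `rc_integral`: the integrals determine the distances to basic measures through a
series with a computable rate of convergence. -/
theorem sdMap (h : IsMeasurePres c) {m : Z → M}
    (hm : RC A fun i z => ∫ x, basicFunction X i x ∂(c (m z))) : SDMap A m := by
  have h1 : RC A fun n z => measureDist (c (basic n)) (c (m z)) := by
    refine rc_measureDist h.rc_basic.lift ?_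
    exact hm.comp (u := fun p : ℕ × ℕ => p.2) (by fun_prop)
  refine SD.congr ((h1.comp (u := fun b : ℕ => b.unpair.1) (by fun_prop)).lt
    (.const (q := fun b : ℕ => (posRatOf b.unpair.2 : ℝ)) (by fun_prop))) fun b z _ => ?_
  rw [mem_basicBall, h.d_eq]

end IsMeasurePres

section

variable {X : Type*} [ComputableMetricSpace X] [MeasurableSpace X] [BorelSpace X]

theorem isMeasurePres_finiteMeasure :
    IsMeasurePres (X := X) (M := FiniteMeasure X) fun μ => (μ : Measure X) where
  d_eq _ _ := rfl
  rc_basic := rc_integral_basicMeasure.comp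
    (u := fun p : ℕ × ℕ => (Denumerable.ofNat (List ℕ) p.1, p.2)) (by fun_prop)
  exists_tendsto μ := by
    obtain ⟨l, hl⟩ := exists_basicMeasure_tendsto (μ : Measure X)
    refine ⟨fun n => Encodable.encode ((l n).1 :: (l n).2), fun i => (hl i).congr fun n => ?_⟩
    simp only [MetricPresentation.basic, Denumerable.ofNat_encode]

theorem isMeasurePres_probabilityMeasure :
    IsMeasurePres (X := X) (M := ProbabilityMeasure X) fun μ => (μ : Measure X) where
  d_eq _ _ := rfl
  rc_basic := rc_integral_basic_probabilityMeasure
  exists_tendsto μ := by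
    have : Nonempty X := ⟨basic 0⟩
    obtain ⟨l, hl⟩ := exists_basicMeasure_tendsto (μ : Measure X)
    refine ⟨fun n => Nat.pair (l n).1 (Encodable.encode (l n).2), fun i => ?_⟩
    have h0 : ∫ x, basicFunction X 0 x ∂(μ : Measure X) = 1 := by
      rw [integral_basicFunction_zero]; simp
    have := (hl i).div (hl 0) (by rw [h0]; exact one_ne_zero)
    rw [h0, div_one] at this
    refine this.congr fun n => ?_
    simp only [MetricPresentation.basic, Nat.unpair_pair, Denumerable.ofNat_encode]
    exact (integral_normalize (basicMeasure_cons_ne_zero _ _) _).symm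

instance MetricPresentation.instFiniteMeasure_effPres : EffPres (FiniteMeasure X) :=
  isMeasurePres_finiteMeasure.effPres

instance MetricPresentation.instProbabilityMeasure_effPres : EffPres (ProbabilityMeasure X) :=
  isMeasurePres_probabilityMeasure.effPres

end

/-! ## Semicomputability of integrals -/

section

variable {α Y X : Type*} [Primcodable α] [MetricPresentation Y] [ComputableMetricSpace X]

theorem isOpen_basicBall (b : ℕ) : IsOpen (basicBall X b) :=
  isOpen_lt (continuous_const.dist continuous_id) continuous_const

theorem SD.isOpen_section {A : Set Y} {U : α → Y × X → Prop} (h : SD (A ×ˢ Set.univ) U) (a : α)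
    {y : Y} (hy : y ∈ A) : IsOpen {x | U a (y, x)} := by
  obtain ⟨R, -, h⟩ := h
  have : {x | U a (y, x)} = ⋃ l ∈ {l | R (a, l)}, ⋂ b ∈ {b | b ∈ l},
      {x : X | y ∈ basicBall Y (Nat.pair b.unpair.1.unpair.1 b.unpair.2) ∧
        x ∈ basicBall X (Nat.pair b.unpair.1.unpair.2 b.unpair.2)} := by
    ext x
    simp only [Set.mem_ofPred_eq, h a (y, x) ⟨hy, trivial⟩, nb, Set.mem_iUnion, Set.mem_iInter,
      exists_prop, mem_basicBall_prod]
  rw [this]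
  exact isOpen_biUnion fun l _ => Set.Finite.isOpen_biInter (List.finite_toSet l)
    fun b _ => isOpen_const.and (isOpen_basicBall _)

theorem Lo.lowerSemicontinuous_section {A : Set Y} {u : α → Y × X → ℝ}
    (h : Lo (A ×ˢ Set.univ) u) (a : α) {y : Y} (hy : y ∈ A) :
    LowerSemicontinuous fun x => u a (y, x) := by
  intro x q hq
  obtain ⟨k, h1, h2⟩ := exists_ratOf_btwn hq
  filter_upwards [(SD.isOpen_section h (a, k) hy).mem_nhds h2] with z hz
  exact h1.trans hz

end

/-! ### Codes of basic functions -/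

/-- The code of the bump function with code `k`. -/
def bumpTerm (k : ℕ) : ℕ := 5 * k + 1

/-- The code of the maximum. -/
def maxTerm (k l : ℕ) : ℕ := 5 * Nat.pair k l + 2

/-- The code of a rational multiple. -/
def smulTerm (q k : ℕ) : ℕ := 5 * Nat.pair q k + 5

section

variable {X : Type*} [MetricPresentation X]

theorem basicFunction_bumpTerm (k : ℕ) (x : X) :
    basicFunction X (bumpTerm k) x = codedBump X k x := by
  rw [basicFunction_eq_termStep, bumpTerm, termStep]
  simp

theorem basicFunction_maxTerm (k l : ℕ) (x : X) : basicFunction X (maxTerm k l) x =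
    max (basicFunction X k x) (basicFunction X l x) := by
  rw [basicFunction_eq_termStep, maxTerm, termStep]
  have h1 : (5 * Nat.pair k l + 2 - 1) % 5 = 1 := by omega
  have h2 : (5 * Nat.pair k l + 2 - 1) / 5 = Nat.pair k l := by omega
  simp only [h1, h2, Nat.unpair_pair]
  simp

theorem basicFunction_smulTerm (q k : ℕ) (x : X) : basicFunction X (smulTerm q k) x =
    ratOf q * basicFunction X k x := by
  rw [basicFunction_eq_termStep, smulTerm, termStep]
  have h1 : (5 * Nat.pair q k + 5 - 1) % 5 = 4 := by omega
  have h2 : (5 * Nat.pair q k + 5 - 1) / 5 = Nat.pair q k := by omega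
  simp only [h1, h2, Nat.unpair_pair]
  simp

/-- The code of the maximum of `0` and the functions `q * f`, where `f` is the bump function with
code `k`, for the pairs `(q, k)` of a list. -/
def maxBumpTerm (E : List (ℕ × ℕ)) : ℕ :=
  E.foldr (fun e r => maxTerm (smulTerm e.1 (bumpTerm e.2)) r) (smulTerm 0 0)

theorem primrec_maxBumpTerm : Primrec maxBumpTerm := by
  unfold maxBumpTerm
  refine Primrec.list_foldr (h := fun (_ : List (ℕ × ℕ)) p =>
    maxTerm (smulTerm p.1.1 (bumpTerm p.1.2)) p.2) Primrec.id (Primrec.const _) ?_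
  refine Primrec.to₂ (f := fun q : List (ℕ × ℕ) × ((ℕ × ℕ) × ℕ) =>
    maxTerm (smulTerm q.2.1.1 (bumpTerm q.2.1.2)) q.2.2) ?_
  unfold maxTerm smulTerm bumpTerm
  fun_prop

theorem basicFunction_maxBumpTerm_nil (x : X) : basicFunction X (maxBumpTerm []) x = 0 := by
  rw [maxBumpTerm, List.foldr_nil, basicFunction_smulTerm]
  simp [ratOf]

theorem basicFunction_maxBumpTerm_cons (e : ℕ × ℕ) (E : List (ℕ × ℕ)) (x : X) :
    basicFunction X (maxBumpTerm (e :: E)) x =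
      max (ratOf e.1 * codedBump X e.2 x) (basicFunction X (maxBumpTerm E) x) := by
  rw [maxBumpTerm, List.foldr_cons, basicFunction_maxTerm, basicFunction_smulTerm,
    basicFunction_bumpTerm]
  rfl

theorem basicFunction_maxBumpTerm_le {E : List (ℕ × ℕ)} {x : X} {y : ℝ} (hy : 0 ≤ y)
    (h : ∀ e ∈ E, ratOf e.1 * codedBump X e.2 x ≤ y) :
    basicFunction X (maxBumpTerm E) x ≤ y := by
  induction E with
  | nil => rwa [basicFunction_maxBumpTerm_nil]
  | cons e E ih =>
    rw [basicFunction_maxBumpTerm_cons]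
    exact max_le (h e (by simp)) (ih fun e' he' => h e' (by simp [he']))

theorem le_basicFunction_maxBumpTerm {E : List (ℕ × ℕ)} {e : ℕ × ℕ} (he : e ∈ E) (x : X) :
    ratOf e.1 * codedBump X e.2 x ≤ basicFunction X (maxBumpTerm E) x := by
  induction E with
  | nil => simp at he
  | cons e' E ih =>
    rw [basicFunction_maxBumpTerm_cons]
    rcases List.mem_cons.1 he with rfl | he
    · exact le_max_left _ _
    · exact (ih he).trans (le_max_right _ _)

theorem basicFunction_maxBumpTerm_nonneg (E : List (ℕ × ℕ)) (x : X) :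
    0 ≤ basicFunction X (maxBumpTerm E) x := by
  induction E with
  | nil => rw [basicFunction_maxBumpTerm_nil]
  | cons e E ih =>
    rw [basicFunction_maxBumpTerm_cons]
    exact ih.trans (le_max_right _ _)

theorem d_lt_of_codedBump_pos {k : ℕ} {x : X} (h : 0 < codedBump X k x) :
    d (basic k.unpair.1) x <
      (posRatOf k.unpair.2.unpair.1 : ℝ) + (posRatOf k.unpair.2.unpair.2 : ℝ) := by
  rw [codedBump_eq] at h
  rcases lt_max_iff.1 h with h | h
  · exact absurd h (lt_irrefl _)
  · have h1 := (lt_min_iff.1 h).2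
    have h2 := (mul_pos_iff_of_pos_right (inv_pos.2 (posRatOf_pos _))).1 h1
    linarith

theorem codedBump_eq_one {k : ℕ} {x : X}
    (h : d (basic k.unpair.1) x ≤ (posRatOf k.unpair.2.unpair.1 : ℝ)) : codedBump X k x = 1 := by
  have hp := posRatOf_pos k.unpair.2.unpair.2
  rw [codedBump_eq, min_eq_left, max_eq_right zero_le_one]
  rw [← div_eq_mul_inv, le_div_iff₀ hp]
  linarith

end

section

variable {α Z X : Type*} [Primcodable α] [MetricPresentation Z]
  [ComputableMetricSpace X] [MeasurableSpace X] [BorelSpace X] {A : Set Z}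

/-- From below, `u` is exhausted by finite maxima of functions `k * f` with `f` a bump function and
`k` rational, where enumerated data confirm `k < u` wherever `f > 0`. Such maxima are again basic
functions, so their integrals are computable by hypothesis, and they converge to the integral of `u`
by dominated convergence. -/
theorem Lo.integral {u : α → Z × X → ℝ} (hu : Lo (A ×ˢ Set.univ) u)
    (hu0 : ∀ a, ∀ z ∈ A, ∀ x, 0 ≤ u a (z, x)) (hub : ∀ a, ∀ z ∈ A, ∃ C, ∀ x, u a (z, x) ≤ C)
    {m : Z → Measure X} (hfin : ∀ z ∈ A, IsFiniteMeasure (m z))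
    (hm : RC A fun i z => ∫ x, basicFunction X i x ∂(m z)) :
    Lo A fun a z => ∫ x, u a (z, x) ∂(m z) := by
  have hsc := fun a z (hz : z ∈ A) => hu.lowerSemicontinuous_section a hz
  have hint : ∀ a, ∀ z ∈ A, Integrable (fun x => u a (z, x)) (m z) := fun a z hz => by
    obtain ⟨C, hC⟩ := hub a z hz
    have := hfin z hz
    refine .of_bound (hsc a z hz).measurable.aestronglyMeasurable C
      (Eventually.of_forall fun x => ?_)
    rw [Real.norm_of_nonneg (hu0 a z hz x)]
    exact hC x
  obtain ⟨R, hR, H⟩ := hu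
  -- An entry consists of a list of product balls on which `u` exceeds the rational, the rational,
  -- and a bump function. The bump is supported in the second components of the balls by a formal
  -- inclusion of radii, and `z` must lie in the first components.
  set Val : α → Z → List ℕ × (ℕ × ℕ) → Prop := fun a z e =>
    R ((a, e.2.1), e.1) ∧ ∀ j < e.1.length,
      d (basic (e.1.getD j 0).unpair.1.unpair.2 : X) (basic e.2.2.unpair.1) <
        (posRatOf (e.1.getD j 0).unpair.2 : ℝ) - ((posRatOf e.2.2.unpair.2.unpair.1 : ℝ) +
          (posRatOf e.2.2.unpair.2.unpair.2 : ℝ)) ∧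
      z ∈ basicBall Z (Nat.pair (e.1.getD j 0).unpair.1.unpair.1 (e.1.getD j 0).unpair.2)
    with hVal
  have hValSD : SD A fun (p : α × (List ℕ × (ℕ × ℕ))) z => Val p.1 z p.2 := by
    refine .and (.of_re (hR.comp (f := fun p : α × (List ℕ × (ℕ × ℕ)) =>
      ((p.1, p.2.2.1), p.2.1)) (by fun_prop))) (.forall_lt ?_ (by fun_prop))
    exact .and (.of_re (EffPres.re_dist_lt' X (by fun_prop) (by fun_prop) (by fun_prop)))
      (.ball (by fun_prop))
  have hentry : ∀ a, ∀ z ∈ A, ∀ e, Val a z e → ∀ x,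
      ratOf e.2.1 * codedBump X e.2.2 x ≤ u a (z, x) := by
    intro a z hz e he x
    have hu0' := hu0 a z hz x
    rcases (codedBump_nonneg e.2.2 x).eq_or_lt with h0 | h0
    · rw [← h0, mul_zero]; exact hu0'
    · have h1 := d_lt_of_codedBump_pos h0
      have h2 : (z, x) ∈ nb (Z × X) e.1 := by
        intro b hb
        obtain ⟨j, hj, rfl⟩ := List.getElem_of_mem hb
        have h3 := he.2 j hj
        rw [List.getD_eq_getElem _ _ hj] at h3
        rw [mem_basicBall_prod]
        refine ⟨h3.2, ?_⟩
        rw [mem_basicBall_pair]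
        have := EffPres.d_triangle (basic e.1[j].unpair.1.unpair.2) (basic e.2.2.unpair.1) x
        linarith [h3.1]
      have h3 : (ratOf e.2.1 : ℝ) < u a (z, x) :=
        (H (a, e.2.1) (z, x) ⟨hz, trivial⟩).2 ⟨e.1, he.1, h2⟩
      rcases le_total 0 (ratOf e.2.1 : ℝ) with hk | hk
      · exact (mul_le_of_le_one_right hk (codedBump_le_one _ _)).trans h3.le
      · exact (mul_nonpos_of_nonpos_of_nonneg hk h0.le).trans hu0'
  have hSD : SD A fun (p : α × ℕ) z => ∃ E : List (List ℕ × (ℕ × ℕ)),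
      (∀ j < E.length, Val p.1 z (E.getD j ([], 0, 0))) ∧
      (ratOf p.2 : ℝ) < ∫ x, basicFunction X (maxBumpTerm (E.map Prod.snd)) x ∂(m z) := by
    refine .ex <| .and (.forall_lt ?_ (by fun_prop)) ?_
    · exact hValSD.comp (f := fun q : ((α × ℕ) × List (List ℕ × (ℕ × ℕ))) × ℕ =>
        (q.1.1.1, q.1.2.getD q.2 ([], 0, 0))) (by fun_prop)
    · refine Lo.lt (f := fun (q : (α × ℕ) × List (List ℕ × (ℕ × ℕ))) z => ∫ x, basicFunction X
        (maxBumpTerm (q.2.map Prod.snd)) x ∂(m z)) (hm.1.comp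
        (u := fun q : (α × ℕ) × List (List ℕ × (ℕ × ℕ)) => maxBumpTerm (q.2.map Prod.snd)) ?_)
        (by fun_prop)
      exact primrec_maxBumpTerm.comp (Primrec.list_map Primrec.snd (Primrec.snd.comp Primrec.snd).to₂)
  refine SD.congr hSD fun ⟨a, q⟩ z hz => ⟨fun hq => ?_, ?_⟩
  · classical
    simp only at hq
    have := hfin z hz
    obtain ⟨C, hC⟩ := hub a z hz
    -- All valid entries with code below `n`. The list is chosen classically; only the existence of
    -- a suitable finite list is searched for effectively.
    set E : ℕ → List (List ℕ × (ℕ × ℕ)) := fun n => (List.range n).filterMap fun i =>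
      (Encodable.decode i : Option (List ℕ × (ℕ × ℕ))).filter fun e => decide (Val a z e) with hE
    have hEval : ∀ n, ∀ e ∈ E n, Val a z e := by
      intro n e he
      simp only [hE, List.mem_filterMap, List.mem_range, Option.filter_eq_some_iff] at he
      obtain ⟨i, -, -, h⟩ := he
      simpa using h
    have hEmem : ∀ e, Val a z e → ∀ n, Encodable.encode e < n → e ∈ E n := by
      intro e he n hn
      simp only [hE, List.mem_filterMap, List.mem_range, Option.filter_eq_some_iff]
      exact ⟨_, hn, Encodable.encodek e, by simpa using he⟩
    have hEu : ∀ n x, basicFunction X (maxBumpTerm ((E n).map Prod.snd)) x ≤ u a (z, x) := by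
      intro n x
      refine basicFunction_maxBumpTerm_le (hu0 a z hz x) fun e he => ?_
      obtain ⟨e', he', rfl⟩ := List.mem_map.1 he
      exact hentry a z hz e' (hEval n e' he') x
    have hlim : ∀ x, Tendsto (fun n => basicFunction X (maxBumpTerm ((E n).map Prod.snd)) x) atTop
        (𝓝 (u a (z, x))) := by
      intro x
      refine tendsto_order.2 ⟨fun b hb => ?_, fun b hb => Eventually.of_forall fun n =>
        (hEu n x).trans_lt hb⟩
      rcases lt_or_ge b 0 with hb0 | hb0
      · exact Eventually.of_forall fun n => hb0.trans_le (basicFunction_maxBumpTerm_nonneg _ _)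
      obtain ⟨k, hk1, hk2⟩ := exists_ratOf_btwn hb
      obtain ⟨l, hl, hxl⟩ := (H (a, k) (z, x) ⟨hz, trivial⟩).1 hk2
      have hxl' := fun b (hb : b ∈ l) => mem_basicBall_prod.1 (hxl b hb)
      obtain ⟨δ, hδ, hδl⟩ : ∃ δ > 0, ∀ b ∈ l, d (basic b.unpair.1.unpair.2) x + δ <
          (posRatOf b.unpair.2 : ℝ) := by
        have : ∀ᶠ δ in 𝓝[>] (0 : ℝ), ∀ b ∈ l.toFinset, d (basic b.unpair.1.unpair.2) x + δ <
            (posRatOf b.unpair.2 : ℝ) := by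
          refine (Finset.eventually_all _).2 fun b hb => nhdsWithin_le_nhds ?_
          have := (hxl' b (List.mem_toFinset.1 hb)).2
          rw [mem_basicBall_pair] at this
          filter_upwards [gt_mem_nhds (sub_pos.2 this)] with δ hδ
          linarith
        obtain ⟨δ, h1, h2⟩ := (this.and self_mem_nhdsWithin).exists
        exact ⟨δ, h2, fun b hb => h1 b (List.mem_toFinset.2 hb)⟩
      -- The slack `δ` is split in three: distance from `x` to the centre, inner radius and width.
      -- The inner radius exceeds the distance, so the bump function is `1` at `x`.
      obtain ⟨c, hc⟩ := EffPres.exists_basic x (ε := δ / 3) (by positivity)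
      obtain ⟨r, hr1, hr2⟩ := exists_posRatOf_btwn (EffPres.d_nonneg _ _) hc
      obtain ⟨s, -, hs⟩ := exists_posRatOf_btwn le_rfl (by positivity : (0 : ℝ) < δ / 3)
      have hv : Val a z (l, k, Nat.pair c (Nat.pair r s)) := by
        refine ⟨hl, fun j hj => ?_⟩
        have hmem : l.getD j 0 ∈ l := by simp [List.getD_eq_getElem?_getD, hj]
        refine ⟨?_, (hxl' _ hmem).1⟩
        simp only [Nat.unpair_pair]
        have h1 := EffPres.d_triangle (basic (l.getD j 0).unpair.1.unpair.2) x (basic c)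
        rw [EffPres.d_comm x] at h1
        linarith [hδl _ hmem]
      filter_upwards [eventually_gt_atTop (Encodable.encode (l, k, Nat.pair c (Nat.pair r s)))]
        with n hn
      have h1 := le_basicFunction_maxBumpTerm
        (List.mem_map_of_mem (f := Prod.snd) (hEmem _ hv n hn)) x
      simp only at h1
      rw [codedBump_eq_one (by simpa using hr1.le), mul_one] at h1
      linarith
    have hI := tendsto_integral_of_dominated_convergence (μ := m z) (fun _ => C)
      (F := fun n x => basicFunction X (maxBumpTerm ((E n).map Prod.snd)) x)
      (f := fun x => u a (z, x))
      (fun n => (continuous_basicFunction _).aestronglyMeasurable) (integrable_const _)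
      (fun n => Eventually.of_forall fun x => by
        rw [Real.norm_of_nonneg (basicFunction_maxBumpTerm_nonneg _ _)]
        exact (hEu n x).trans (hC x)) (Eventually.of_forall hlim)
    obtain ⟨n, hn⟩ := (hI.eventually_const_lt hq).exists
    refine ⟨E n, fun j hj => hEval n _ ?_, hn⟩
    simp [List.getD_eq_getElem?_getD, hj]
  · rintro ⟨E, hE, hq⟩
    simp only at hE hq ⊢
    have := hfin z hz
    refine hq.trans_le (integral_mono (integrable_basicFunction _ _) (hint a z hz) fun x => ?_)
    refine basicFunction_maxBumpTerm_le (hu0 a z hz x) fun e he => ?_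
    obtain ⟨e', he', rfl⟩ := List.mem_map.1 he
    obtain ⟨j, hj, rfl⟩ := List.getElem_of_mem he'
    have := hE j hj
    rw [List.getD_eq_getElem _ _ hj] at this
    exact hentry a z hz _ this x

/-- Both `C + u` and `C - u` are nonnegative and bounded, so `Lo.integral` applies; the contribution
of `C` is a multiple of the total mass, which is computable. -/
theorem RC.integral {u : α → Z × X → ℝ} (hu : RC (A ×ˢ Set.univ) u) {C : α → ℕ} (hC : Primrec C)
    (hub : ∀ a, ∀ z ∈ A, ∀ x, |u a (z, x)| ≤ C a)
    {m : Z → Measure X} (hfin : ∀ z ∈ A, IsFiniteMeasure (m z))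
    (hm : RC A fun i z => ∫ x, basicFunction X i x ∂(m z)) :
    RC A fun a z => ∫ x, u a (z, x) ∂(m z) := by
  have hCq : RC (A ×ˢ Set.univ) fun a (_ : Z × X) => (C a : ℝ) := .const (by fun_prop)
  have hmass : RC A fun (_ : α) z => (m z).real Set.univ :=
    (hm.comp (u := fun _ : α => 0) (by fun_prop)).congr fun a z _ =>
      (integral_basicFunction_zero _).symm
  have hCm : RC A fun a z => -((C a : ℝ) * (m z).real Set.univ) :=
    ((RC.const (by fun_prop)).mul hmass).neg
  have hint : ∀ a, ∀ z ∈ A, Integrable (fun x => u a (z, x)) (m z) := fun a z hz => by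
    have := hfin z hz
    exact .of_bound (hu.1.lowerSemicontinuous_section a hz).measurable.aestronglyMeasurable (C a)
      (Eventually.of_forall fun x => hub a z hz x)
  constructor
  · refine ((Lo.integral (hu.add hCq).1 (fun a z hz x => ?_) (fun a z hz => ⟨2 * C a, fun x => ?_⟩)
      hfin hm).add hCm.1).congr fun a z hz => ?_
    · linarith [(abs_le.1 (hub a z hz x)).1]
    · linarith [(abs_le.1 (hub a z hz x)).2]
    · have := hfin z hz
      rw [integral_add (hint a z hz) (integrable_const _), integral_const, smul_eq_mul]
      ring
  · refine ((Lo.integral (hCq.sub hu).1 (fun a z hz x => ?_) (fun a z hz => ⟨2 * C a, fun x => ?_⟩)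
      hfin hm).add hCm.1).congr fun a z hz => ?_
    · linarith [(abs_le.1 (hub a z hz x)).2]
    · linarith [(abs_le.1 (hub a z hz x)).1]
    · have := hfin z hz
      rw [integral_sub (integrable_const _) (hint a z hz), integral_const, smul_eq_mul]
      ring

end

/-! ## Computable approximation of a semidecidable supremum -/

section

variable {Z : Type*} [MetricPresentation Z]

/-- A continuous function that is positive exactly on part of a finite intersection of basic balls,
where it reaches the value `q` as `m` grows. -/
def hatTerm (q : ℝ) (l : List ℕ) (m : ℕ) (z : Z) : ℝ :=
  max 0 q * max 0 (1 - ∑ i ∈ Finset.range l.length,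
    max 0 (1 - m * ((posRatOf (l.getD i 0).unpair.2 : ℝ) - d (basic (l.getD i 0).unpair.1) z)))

theorem hatTerm_le (q : ℝ) (l : List ℕ) (m : ℕ) (z : Z) : hatTerm q l m z ≤ max 0 q := by
  refine mul_le_of_le_one_right (le_max_left _ _) (max_le zero_le_one (sub_le_self _ ?_))
  exact Finset.sum_nonneg fun i _ => le_max_left _ _

/-- A single violated ball contributes a summand of at least `1`, which annihilates the second
factor. -/
theorem mem_nb_of_hatTerm_pos {q : ℝ} {l : List ℕ} {m : ℕ} {z : Z} (h : 0 < hatTerm q l m z) :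
    0 < q ∧ z ∈ nb Z l := by
  have h1 : 0 < max 0 q := h.trans_le (hatTerm_le _ _ _ _)
  have h2 := (lt_max_iff.1 ((mul_pos_iff_of_pos_left h1).1 h)).resolve_left (lt_irrefl _)
  refine ⟨(lt_max_iff.1 h1).resolve_left (lt_irrefl _), fun b hb => ?_⟩
  obtain ⟨i, hi, rfl⟩ := List.getElem_of_mem hb
  have h3 := (le_max_right _ _).trans (Finset.single_le_sum
    (f := fun i => max 0 (1 - (m : ℝ) * ((posRatOf (l.getD i 0).unpair.2 : ℝ) -
      d (basic (l.getD i 0).unpair.1) z))) (fun i _ => le_max_left _ _) (Finset.mem_range.2 hi))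
  simp only [List.getD_eq_getElem?_getD, hi, List.getElem?_eq_getElem, Option.getD_some] at h2 h3
  rw [mem_basicBall]
  by_contra! hcon
  have h4 : (m : ℝ) * ((posRatOf l[i].unpair.2 : ℝ) - d (basic l[i].unpair.1) z) ≤ 0 :=
    mul_nonpos_of_nonneg_of_nonpos m.cast_nonneg (sub_nonpos.2 hcon)
  linarith

theorem exists_hatTerm_eq {q : ℝ} {l : List ℕ} {z : Z} (hz : z ∈ nb Z l) :
    ∃ m, hatTerm q l m z = max 0 q := by
  have h1 : ∀ᶠ m : ℕ in atTop, ∀ b ∈ l,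
      1 ≤ (m : ℝ) * ((posRatOf b.unpair.2 : ℝ) - d (basic b.unpair.1) z) := by
    have h2 : ∀ b ∈ {b | b ∈ l}, ∀ᶠ m : ℕ in atTop,
        1 ≤ (m : ℝ) * ((posRatOf b.unpair.2 : ℝ) - d (basic b.unpair.1) z) := fun b hb =>
      (tendsto_natCast_atTop_atTop.atTop_mul_const
        (sub_pos.2 (mem_basicBall.1 (hz b hb)))).eventually_ge_atTop 1
    exact (eventually_all_finite (List.finite_toSet l)).2 h2
  obtain ⟨m, hm⟩ := h1.exists
  refine ⟨m, ?_⟩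
  rw [hatTerm, Finset.sum_eq_zero, sub_zero, max_eq_right zero_le_one, mul_one]
  intro i hi
  refine max_eq_left (sub_nonpos.2 (hm _ ?_))
  simp [List.getD_eq_getElem?_getD, Finset.mem_range.1 hi]

theorem rc_hatTerm [EffPres Z] {α : Type*} [Primcodable α] {q : α → ℝ} {l : α → List ℕ} {m : α → ℕ}
    (hq : QComp q) (hl : Primrec l) (hm : Primrec m) {A : Set Z} :
    RC A fun a z => hatTerm (q a) (l a) (m a) z := by
  have h1 : RC A fun (p : α × ℕ) z => d (basic ((l p.1).getD p.2 0).unpair.1) z :=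
    RC.dist.comp (u := fun p : α × ℕ => ((l p.1).getD p.2 0).unpair.1) (by fun_prop)
  have h0 {β : Type _} [Primcodable β] : RC A fun (_ : β) (_ : Z) => (0 : ℝ) := .const .zero
  have hone {β : Type _} [Primcodable β] : RC A fun (_ : β) (_ : Z) => (1 : ℝ) := .const .one
  refine RC.mul (.max h0 (.const hq)) (.max h0 (.sub hone (.sum ?_ (by fun_prop))))
  exact .max h0 (.sub hone (.mul (.const (by fun_prop)) (.sub (.const (by fun_prop)) h1)))

/-- The running maximum of a sequence, started at `0`. -/
def runMax (e : ℕ → ℝ) : ℕ → ℝ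
  | 0 => 0
  | n + 1 => max (runMax e n) (e n)

theorem lt_runMax {e : ℕ → ℝ} {q : ℝ} {n : ℕ} : q < runMax e n ↔ q < 0 ∨ ∃ j < n, q < e j := by
  induction n with
  | zero => simp [runMax]
  | succ n ih =>
    rw [runMax, lt_max_iff, ih]
    constructor
    · rintro ((h | ⟨j, hj, h⟩) | h)
      exacts [.inl h, .inr ⟨j, hj.trans n.lt_succ_self, h⟩, .inr ⟨n, n.lt_succ_self, h⟩]
    · rintro (h | ⟨j, hj, h⟩)
      · exact .inl (.inl h)
      · rcases Nat.lt_succ_iff_lt_or_eq.1 hj with hj | rfl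
        exacts [.inl (.inr ⟨j, hj, h⟩), .inr h]

theorem runMax_lt {e : ℕ → ℝ} {q : ℝ} {n : ℕ} : runMax e n < q ↔ 0 < q ∧ ∀ j < n, e j < q := by
  induction n with
  | zero => simp [runMax]
  | succ n ih => rw [runMax, max_lt_iff, ih, Nat.forall_lt_succ_right, and_assoc]

theorem runMax_mono (e : ℕ → ℝ) : Monotone (runMax e) :=
  monotone_nat_of_le_succ fun _ => le_max_left _ _

theorem le_runMax (e : ℕ → ℝ) (j : ℕ) : e j ≤ runMax e (j + 1) := le_max_right _ _

theorem rc_runMax {A : Set Z} {e : ℕ → Z → ℝ} (he : RC A e) :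
    RC A fun n z => runMax (fun j => e j z) n := by
  constructor
  · refine SD.congr (.or (.of_re (QComp.re_lt (f := fun p : ℕ × ℕ => (ratOf p.2 : ℝ))
      (g := fun _ => 0) (by fun_prop) (by fun_prop))) (.ex (U := fun (a : ℕ × ℕ) (j : ℕ) z => j < a.1 ∧ (ratOf a.2 : ℝ) < e j z) (.and (.of_re (.nat_lt
        (f := fun p : (ℕ × ℕ) × ℕ => p.2) (g := fun p => p.1.1) (by fun_prop) (by fun_prop)))
        (Lo.lt (he.1.comp (u := fun p : (ℕ × ℕ) × ℕ => p.2) (by fun_prop))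
          (q := fun p => (ratOf p.1.2 : ℝ)) (by fun_prop)))))
      fun a z _ => ?_
    exact lt_runMax
  · refine SD.congr (.and (.of_re (QComp.re_lt (f := fun p : ℕ × ℕ => (ratOf p.2 : ℝ))
      (g := fun _ => 0) (by fun_prop) (by fun_prop))) (.forall_lt
        (U := fun (a : ℕ × ℕ) (j : ℕ) z => (ratOf a.2 : ℝ) < -e j z)
        (Lo.lt (he.2.comp (u := fun p : (ℕ × ℕ) × ℕ => p.2) (by fun_prop))
          (q := fun p => (ratOf p.1.2 : ℝ)) (by fun_prop)) (f := fun a => a.1) (by fun_prop)))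
      fun a z _ => ?_
    simp only [lt_neg (a := ((ratOf a.2 : ℚ) : ℝ))]
    rw [runMax_lt, neg_pos]

/-- A semidecidable family of lower bounds is the family of lower bounds of the supremum of a
computable increasing sequence of computable functions. -/
theorem SD.exists_rc_approx [EffPres Z] {U : ℕ → Z → Prop} (hU : SD Set.univ U) :
    ∃ h : ℕ → Z → ℝ, RC Set.univ h ∧ (∀ z, h 0 z = 0) ∧ (∀ z, Monotone fun n => h n z) ∧
      (∀ n z, h n z ≤ n) ∧ (∀ n z, 0 < h n z → ∃ k, U k z ∧ h n z ≤ ratOf k) ∧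
      ∀ k z, U k z → ∃ n, (ratOf k : ℝ) ≤ h n z := by
  classical
  obtain ⟨R, ⟨q, hq, hR⟩, hU⟩ := hU
  -- The index `j` codes a rational `k`, a list `l`, a witness that `l` is enumerated for `k`, and a
  -- steepness `m`.
  set dec : ℕ → (List ℕ × ℕ) × ℕ := fun j => Denumerable.ofNat _ j.unpair.2 with hdec
  have hdecp : Primrec dec := by fun_prop
  set e : ℕ → Z → ℝ := fun j z =>
    (if q ((j.unpair.1, (dec j).1.1), (dec j).1.2) then 1 else 0) *
      hatTerm (ratOf j.unpair.1) (dec j).1.1 (dec j).2 z with he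
  have hind : ∀ j, (if q ((j.unpair.1, (dec j).1.1), (dec j).1.2) then (1 : ℝ) else 0) ≤ 1 := by
    intro j; split_ifs <;> norm_num
  have herc : RC Set.univ e := by
    refine RC.mul (.const (.ite (hq.comp (by fun_prop)) .one .zero)) (rc_hatTerm ?_ ?_ ?_)
    all_goals fun_prop
  have he1 : ∀ j z, 0 < e j z → U j.unpair.1 z ∧ e j z ≤ ratOf j.unpair.1 := by
    intro j z h
    by_cases hqj : q ((j.unpair.1, (dec j).1.1), (dec j).1.2)
    · simp only [he, hqj, if_true, one_mul] at h ⊢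
      obtain ⟨h1, h2⟩ := mem_nb_of_hatTerm_pos h
      exact ⟨(hU _ z trivial).2 ⟨_, (hR _).2 ⟨_, hqj⟩, h2⟩,
        (hatTerm_le _ _ _ _).trans (max_eq_right h1.le).le⟩
    · simp [he, hqj] at h
  refine ⟨fun n z => runMax (fun j => e j z) n, rc_runMax herc, fun z => rfl,
    fun z => runMax_mono _, fun n z => ?_, fun n z hn => ?_, fun k z hk => ?_⟩
  · refine not_lt.1 fun h => ?_
    rcases lt_runMax.1 h with h | ⟨j, hj, h⟩
    · exact absurd h (not_lt.2 n.cast_nonneg)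
    · have h1 := (he1 j z (n.cast_nonneg.trans_lt h)).2
      -- A rational is bounded by its code, hence by the index `j < n`. This computable bound is
      -- what later makes the integrals of the `n`-th approximation computable.
      have h2 := (le_abs_self _).trans (abs_ratOf_le_self j.unpair.1)
      have h3 : (j.unpair.1 : ℝ) ≤ j := by exact_mod_cast Nat.unpair_left_le j
      have h4 : (j : ℝ) < n := by exact_mod_cast hj
      linarith
  · by_contra! hcon
    have : runMax (fun j => e j z) n < runMax (fun j => e j z) n := by
      refine runMax_lt.2 ⟨hn, fun j hj => ?_⟩
      by_cases hj0 : 0 < e j z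
      · exact (he1 j z hj0).2.trans_lt (hcon _ (he1 j z hj0).1)
      · exact (not_lt.1 hj0).trans_lt hn
    exact lt_irrefl _ this
  · obtain ⟨l, hl, hz⟩ := (hU k z trivial).1 hk
    obtain ⟨w, hw⟩ := (hR _).1 hl
    obtain ⟨m, hm⟩ := exists_hatTerm_eq (q := ratOf k) hz
    have hd : dec (Nat.pair k (Encodable.encode ((l, w), m))) = ((l, w), m) := by simp [hdec]
    refine ⟨Nat.pair k (Encodable.encode ((l, w), m)) + 1, le_trans ?_ (le_runMax _ _)⟩
    simp only [he, hd, Nat.unpair_pair, if_pos hw, one_mul, hm]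
    exact le_max_right _ _

end

/-! ## Damped series -/

/-- The factor `1`, lowered continuously to `0` as `v (n + 1) * S (n + 1)` grows from `1` to
`1 + 2 ^ (-n)`. -/
def damping (v S : ℕ → ℝ) (n : ℕ) : ℝ :=
  max 0 (min 1 (1 + 2 ^ n * (1 - v (n + 1) * S (n + 1))))

theorem damping_nonneg (v S : ℕ → ℝ) (n : ℕ) : 0 ≤ damping v S n := le_max_left _ _

theorem damping_le_one (v S : ℕ → ℝ) (n : ℕ) : damping v S n ≤ 1 :=
  max_le zero_le_one (min_le_left _ _)

theorem damping_eq_one {v S : ℕ → ℝ} {n : ℕ} (h : v (n + 1) * S (n + 1) ≤ 1) :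
    damping v S n = 1 := by
  have : (0 : ℝ) ≤ 2 ^ n * (1 - v (n + 1) * S (n + 1)) := mul_nonneg (by positivity) (by linarith)
  rw [damping, min_eq_left (by linarith), max_eq_right zero_le_one]

theorem mul_lt_of_damping_pos {v S : ℕ → ℝ} {n : ℕ} (h : 0 < damping v S n) :
    v (n + 1) * S (n + 1) < 1 + 2⁻¹ ^ n := by
  have h1 := ((lt_min_iff.1 ((lt_max_iff.1 h).resolve_left (lt_irrefl _))).2)
  have h2 : (0 : ℝ) < 2⁻¹ ^ n := by positivity
  have h3 := mul_pos h2 h1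
  rw [mul_add, ← mul_assoc, ← mul_pow, inv_mul_cancel₀ two_ne_zero, one_pow] at h3
  linarith

/-- The partial sums of the increments of `S` damped by `v`. -/
def dampedSum (v S f : ℕ → ℝ) (N : ℕ) : ℝ :=
  ∑ n ∈ Finset.range N, damping v S n * (f (n + 1) - f n)

theorem dampedSum_mono {v S f : ℕ → ℝ} (hf : Monotone f) : Monotone (dampedSum v S f) :=
  monotone_nat_of_le_succ fun n => by
    rw [dampedSum, dampedSum, Finset.sum_range_succ]
    exact le_add_of_nonneg_right
      (mul_nonneg (damping_nonneg _ _ _) (sub_nonneg.2 (hf n.le_succ)))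

theorem dampedSum_eq {v S f : ℕ → ℝ} (hf : f 0 = 0) (h : ∀ n, v n * S n ≤ 1) (N : ℕ) :
    dampedSum v S f N = f N := by
  simp only [dampedSum, damping_eq_one (h _), one_mul]
  rw [Finset.sum_range_sub, hf, sub_zero]

/-- After stage `N`, an increment counts only if `v (M + 1) * S (M + 1) < 1 + 2⁻ᴹ`. This is below `D
* v N ≤ D * v (M + 1)`, so `S (M + 1) < D`. Hence at most the part of `S` between `S N` and `D` is
added. -/
theorem dampedSum_le {v S : ℕ → ℝ} (hv : Monotone v) (hv0 : v 0 = 0) (hS : Monotone S) {N : ℕ}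
    {D : ℝ} (hD : 1 + 2⁻¹ ^ N < D * v N) (M : ℕ) :
    dampedSum v S S M ≤ dampedSum v S S N + max 0 (D - S N) := by
  have hpos : (0 : ℝ) < 2⁻¹ ^ N := by positivity
  have hvN : 0 < v N := (hv0 ▸ hv N.zero_le).lt_of_ne fun h => by
    rw [← h, mul_zero] at hD
    linarith
  have hD0 : 0 < D := (mul_pos_iff_of_pos_right hvN).1 (by linarith)
  rcases le_total M N with hMN | hNM
  · exact (dampedSum_mono hS hMN).trans (le_add_of_nonneg_right (le_max_left _ _))
  -- The induction needs the sharper bound that also records how far `S` has come.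
  suffices h : dampedSum v S S M ≤ dampedSum v S S N + max 0 (min (S M) D - S N) from
    h.trans (add_le_add_right (max_le_max_left _ (sub_le_sub_right (min_le_right _ _) _)) _)
  induction M, hNM using Nat.le_induction with
  | base => exact le_add_of_nonneg_right (le_max_left _ _)
  | succ M hNM ih =>
    have hstep : S M ≤ S (M + 1) := hS M.le_succ
    have e : dampedSum v S S (M + 1) =
        dampedSum v S S M + damping v S M * (S (M + 1) - S M) := by
      rw [dampedSum, dampedSum, Finset.sum_range_succ]
    rw [e]
    rcases (damping_nonneg v S M).eq_or_lt with h0 | h0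
    · rw [← h0, zero_mul, add_zero]
      refine ih.trans ?_
      gcongr
    · have h1 := mul_lt_of_damping_pos h0
      have h2 : (2 : ℝ)⁻¹ ^ M ≤ 2⁻¹ ^ N := inv_two_pow_anti hNM
      have h3 : v N ≤ v (M + 1) := hv (by omega)
      have h4 : D * v N ≤ D * v (M + 1) := mul_le_mul_of_nonneg_left h3 hD0.le
      have h5 : S (M + 1) < D := by
        refine lt_of_mul_lt_mul_left (a := v (M + 1)) ?_ (hvN.le.trans h3)
        linarith
      have h6 : damping v S M * (S (M + 1) - S M) ≤ S (M + 1) - S M :=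
        mul_le_of_le_one_left (sub_nonneg.2 hstep) (damping_le_one _ _ _)
      have h7 : S N ≤ S M := hS hNM
      rw [min_eq_left (by linarith), max_eq_right (by linarith)] at ih
      rw [min_eq_left (by linarith), max_eq_right (by linarith)]
      linarith

/-- A rational `k` between `1 / D` and `2 / (D + I)` satisfies `k * D > 1` and `k * I < 1`,
including the case `I = 0`; then `v` reaches `k`. -/
theorem exists_lt_mul_of_lt {v : ℕ → ℝ} (hv : Monotone v) {I D : ℝ} (hI : 0 ≤ I) (hD : I < D)
    (h : ∀ k, (0 : ℝ) < ratOf k → ratOf k * I < 1 → ∃ n, (ratOf k : ℝ) ≤ v n) :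
    ∃ N, 1 + 2⁻¹ ^ N < D * v N := by
  have hD0 : 0 < D := hI.trans_lt hD
  obtain ⟨k, h1, h2⟩ := exists_ratOf_btwn (x := D⁻¹) (y := 2 / (D + I)) (by
    rw [inv_eq_one_div, div_lt_div_iff₀ hD0 (by linarith)]; linarith)
  have hk0 : (0 : ℝ) < ratOf k := (inv_pos.2 hD0).trans h1
  rw [lt_div_iff₀ (by linarith)] at h2
  have h3 : 1 < D * ratOf k := by
    have := mul_lt_mul_of_pos_left h1 hD0
    rwa [mul_inv_cancel₀ hD0.ne'] at this
  obtain ⟨n, hn⟩ := h k hk0 (by linarith [mul_add (ratOf k : ℝ) D I, mul_comm (ratOf k : ℝ) D])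
  obtain ⟨j, hj⟩ := exists_inv_two_pow_lt (sub_pos.2 h3)
  refine ⟨max n j, ?_⟩
  have h4 : (2 : ℝ)⁻¹ ^ (max n j) ≤ 2⁻¹ ^ j := inv_two_pow_anti (le_max_right _ _)
  have h5 : D * ratOf k ≤ D * v (max n j) :=
    mul_le_mul_of_nonneg_left (hn.trans (hv (le_max_left _ _))) hD0.le
  linarith

theorem iSup_ofReal_eq_of_hat {h : ℕ → ℝ} {U : ℕ → Prop} {s : ℝ≥0∞}
    (hU : ∀ k, U k ↔ (0 : ℝ) < ratOf k ∧ ENNReal.ofReal (ratOf k) < s)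
    (h1 : ∀ n, 0 < h n → ∃ k, U k ∧ h n ≤ ratOf k)
    (h2 : ∀ k, U k → ∃ n, (ratOf k : ℝ) ≤ h n) : ⨆ n, ENNReal.ofReal (h n) = s := by
  refine le_antisymm (iSup_le fun n => ?_) (le_of_forall_lt fun c hc => ?_)
  · rcases le_or_gt (h n) 0 with hn | hn
    · simp [ENNReal.ofReal_of_nonpos hn]
    · obtain ⟨k, hk, hle⟩ := h1 n hn
      exact (ENNReal.ofReal_le_ofReal hle).trans ((hU k).1 hk).2.le
  · obtain ⟨q, hq0, hcq, hqs⟩ := ENNReal.lt_iff_exists_rat_btwn.1 hc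
    obtain ⟨k, hk⟩ := exists_ratOf q
    have hpos : (0 : ℝ) < q := by
      by_contra! hle
      rw [Real.toNNReal_of_nonpos hle] at hcq
      exact not_lt_zero hcq
    obtain ⟨n, hn⟩ := h2 k ((hU k).2 (by rw [hk]; exact ⟨hpos, hqs⟩))
    rw [hk] at hn
    exact hcq.trans_le ((ENNReal.ofReal_le_ofReal hn).trans
      (le_iSup (fun n => ENNReal.ofReal (h n)) n))

theorem lintegral_iSup_ofReal {X : Type*} [MeasurableSpace X] {μ : Measure X} {h : ℕ → X → ℝ}
    (hm : ∀ n, Measurable (h n)) (hi : ∀ n, Integrable (h n) μ) (h0 : ∀ n x, 0 ≤ h n x)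
    (hmono : ∀ x, Monotone fun n => h n x) :
    ∫⁻ x, ⨆ n, ENNReal.ofReal (h n x) ∂μ = ⨆ n, ENNReal.ofReal (∫ x, h n x ∂μ) := by
  rw [lintegral_iSup (fun n => (hm n).ennreal_ofReal)
    fun i j hij x => ENNReal.ofReal_le_ofReal (hmono x hij)]
  exact iSup_congr fun n => (ofReal_integral_eq_lintegral_ofReal (hi n)
    (Eventually.of_forall fun x => h0 n x)).symm

/-! ## Extension of integrable lower semicomputable functions -/

section

variable {Z X : Type*} [MetricPresentation Z] [ComputableMetricSpace X] [MeasurableSpace X]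
  [BorelSpace X]

/-- The positive rationals `k` with `z ∉ K` or `k * I z < 1` are semidecidable. The second condition
is meaningful only on `K`, but off `K` the first one already holds, so an arbitrary extension of it
does no harm. -/
theorem exists_rc_inverse_approx [EffPres Z] {K : Set Z} (hK : SD Set.univ fun (_ : Unit) z => z ∉ K)
    {I : Z → ℝ} (hI : RC K fun (_ : Unit) z => I z) :
    ∃ v : ℕ → Z → ℝ, RC Set.univ v ∧ (∀ z, v 0 z = 0) ∧ (∀ z, Monotone fun n => v n z) ∧
      (∀ z ∈ K, ∀ n, ∀ y, 0 ≤ y → y ≤ I z → v n z * y ≤ 1) ∧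
      ∀ z k, (0 : ℝ) < ratOf k → (z ∈ K → ratOf k * I z < 1) → ∃ n, (ratOf k : ℝ) ≤ v n z := by
  have hI' : RC K fun (_ : ℕ) z => I z := hI.comp (u := fun _ : ℕ => ()) (by fun_prop)
  have h1 : SD K fun (k : ℕ) z => (ratOf k : ℝ) * I z < 1 :=
    ((RC.const (q := fun k : ℕ => (ratOf k : ℝ)) (by fun_prop)).mul hI').lt (.const .one)
  obtain ⟨V, hV, hVK⟩ := h1.exists_univ
  have hU : SD Set.univ fun (k : ℕ) z => (0 : ℝ) < ratOf k ∧ (z ∉ K ∨ V k z) :=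
    (SD.of_re (.congr (QComp.re_lt (f := fun _ : ℕ => (0 : ℝ)) (g := fun k => (ratOf k : ℝ))
      (by fun_prop) (by fun_prop)) fun _ => Iff.rfl)).and
      ((hK.comp (f := fun _ : ℕ => ()) (by fun_prop)).or hV)
  obtain ⟨v, hv, hv0, hvm, -, hs, hc⟩ := hU.exists_rc_approx
  refine ⟨v, hv, hv0, hvm, fun z hz n y hy hyI => ?_, fun z k hk hkz => hc k z ⟨hk, ?_⟩⟩
  · rcases le_or_gt (v n z) 0 with hn | hn
    · exact (mul_nonpos_of_nonpos_of_nonneg hn hy).trans zero_le_one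
    · obtain ⟨k, ⟨hk0, hk⟩, hle⟩ := hs n z hn
      have h2 := (hVK k z hz).2 (hk.resolve_left (not_not.2 hz))
      exact (mul_le_mul hle hyI hy hk0.le).trans h2.le
  · by_cases hz : z ∈ K
    · exact .inr ((hVK k z hz).1 (hkz hz))
    · exact .inl hz

theorem rc_damping {v S : ℕ → Z → ℝ} (hv : RC Set.univ v) (hS : RC Set.univ S) :
    RC Set.univ fun n z => damping (fun i => v i z) (fun i => S i z) n := by
  have hone : RC (Set.univ : Set Z) fun (_ : ℕ) _ => (1 : ℝ) := .const .one
  have hv' := hv.comp (u := fun n : ℕ => n + 1) (by fun_prop)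
  have hS' := hS.comp (u := fun n : ℕ => n + 1) (by fun_prop)
  exact .max (.const .zero) (.min hone (.add hone
    (.mul (.const (.pow .two (by fun_prop))) (.sub hone (.mul hv' hS')))))

theorem rc_dampedSum {v S : ℕ → Z → ℝ} {Y : Type*} [MetricPresentation Y] {p : Y → Z}
    {f : ℕ → Y → ℝ} (hv : RC Set.univ v) (hS : RC Set.univ S) (hp : SDMap Set.univ p)
    (hf : RC Set.univ f) : RC Set.univ fun n y =>
      dampedSum (fun i => v i (p y)) (fun i => S i (p y)) (fun i => f i y) n := by
  have hd := (rc_damping hv hS).subst hp (Set.mapsTo_univ _ _)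
  exact .sum (.mul (hd.comp (u := fun a : ℕ × ℕ => a.2) (by fun_prop))
    (.sub (hf.comp (u := fun a : ℕ × ℕ => a.2 + 1) (by fun_prop))
      (hf.comp (u := fun a : ℕ × ℕ => a.2) (by fun_prop)))) (by fun_prop)

/-- A function that is lower semicomputable on a co-c.e. closed set of parameters, with computable
integrals there, agrees there with such a function defined for all parameters. -/
theorem exists_integrable_extension [EffPres Z] {K : Set Z} (hK : SD Set.univ fun (_ : Unit) z => z ∉ K)
    {m : Z → Measure X} [∀ z, IsFiniteMeasure (m z)]
    (hm : RC Set.univ fun i z => ∫ x, basicFunction X i x ∂(m z)) {s : Z × X → ℝ≥0∞}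
    (hs : SD (K ×ˢ Set.univ) fun (k : ℕ) p =>
      (0 : ℝ) < ratOf k ∧ ENNReal.ofReal (ratOf k) < s p)
    (hfin : ∀ z ∈ K, ∫⁻ x, s (z, x) ∂(m z) < ∞)
    (hI : RC K fun (_ : Unit) z => (∫⁻ x, s (z, x) ∂(m z)).toReal) :
    ∃ w : ℕ → Z × X → ℝ, RC Set.univ w ∧ (∀ n p, 0 ≤ w n p) ∧
      (∀ z, ∫⁻ x, ⨆ n, ENNReal.ofReal (w n (z, x)) ∂(m z) < ∞) ∧
      (RC Set.univ fun (_ : Unit) z =>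
        (∫⁻ x, ⨆ n, ENNReal.ofReal (w n (z, x)) ∂(m z)).toReal) ∧
      ∀ z ∈ K, ∀ x, ⨆ n, ENNReal.ofReal (w n (z, x)) = s (z, x) := by
  -- The approximations `h` make sense for all parameters, but off `K` their supremum is unrelated
  -- to `s` and may have infinite integral.
  obtain ⟨U, hU, hUK⟩ := hs.exists_univ
  obtain ⟨h, hrc, h0, hmono, hle, hsound, hcomp⟩ := hU.exists_rc_approx
  have hnn : ∀ n p, 0 ≤ h n p := fun n p => (h0 p).symm.le.trans (hmono p n.zero_le)
  have habs : ∀ n p, |h n p| ≤ n := fun n p => (abs_of_nonneg (hnn n p)).trans_le (hle n p)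
  have hsup : ∀ z ∈ K, ∀ x, ⨆ n, ENNReal.ofReal (h n (z, x)) = s (z, x) := fun z hz x =>
    iSup_ofReal_eq_of_hat (fun k => (hUK k (z, x) ⟨hz, trivial⟩).symm)
      (fun n => hsound n _) fun k => hcomp k _
  have hrc' : RC (Set.univ ×ˢ Set.univ) h := hrc.mono (Set.subset_univ _)
  have hmeas : ∀ z n, Measurable fun x => h n (z, x) := fun z n =>
    (hrc'.1.lowerSemicontinuous_section n trivial).measurable
  have hint : ∀ z n, Integrable (fun x => h n (z, x)) (m z) := fun z n =>
    .of_bound (hmeas z n).aestronglyMeasurable n (Eventually.of_forall fun x => habs n _)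
  set S : ℕ → Z → ℝ := fun n z => ∫ x, h n (z, x) ∂(m z) with hSdef
  have hSrc : RC Set.univ S := RC.integral hrc' (C := fun n => n) (by fun_prop)
    (fun n z _ x => habs n _) (fun z _ => inferInstance) hm
  have hSmono : ∀ z, Monotone fun n => S n z := fun z i j hij =>
    integral_mono (hint z i) (hint z j) fun x => hmono _ hij
  have hS0 : ∀ z, S 0 z = 0 := fun z => by simp [hSdef, h0]
  have hSnn : ∀ n z, 0 ≤ S n z := fun n z => integral_nonneg fun x => hnn n _
  have hSle : ∀ z ∈ K, ∀ n, S n z ≤ (∫⁻ x, s (z, x) ∂(m z)).toReal := fun z hz n => by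
    rw [← ENNReal.ofReal_le_iff_le_toReal (hfin z hz).ne, hSdef,
      ofReal_integral_eq_lintegral_ofReal (hint z n) (Eventually.of_forall fun x => hnn n _)]
    refine lintegral_mono fun x => ?_
    rw [← hsup z hz x]
    exact le_iSup (fun n => ENNReal.ofReal (h n (z, x))) n
  obtain ⟨v, hvrc, hv0, hvm, hvK, hvc⟩ := exists_rc_inverse_approx hK hI
  have hvS : ∀ z ∈ K, ∀ n, v n z * S n z ≤ 1 := fun z hz n =>
    hvK z hz n _ (hSnn n z) (hSle z hz n)
  -- The damping factors depend on the parameter only, so integrating `w` turns the increments of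
  -- `h` into those of `S`; the result is `W`.
  set w : ℕ → Z × X → ℝ := fun n p =>
    dampedSum (fun i => v i p.1) (fun i => S i p.1) (fun i => h i p) n with hw
  set W : ℕ → Z → ℝ := fun n z =>
    dampedSum (fun i => v i z) (fun i => S i z) (fun i => S i z) n with hW
  have hwrc : RC Set.univ w := rc_dampedSum hvrc hSrc SDMap.fst hrc
  have hWrc : RC Set.univ W := rc_dampedSum hvrc hSrc SDMap.id hSrc
  have hwm : ∀ p, Monotone fun n => w n p := fun p => dampedSum_mono (hmono p)
  have hWm : ∀ z, Monotone fun n => W n z := fun z => dampedSum_mono (hSmono z)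
  have hw0 : ∀ n p, 0 ≤ w n p := fun n p => by
    simpa [hw, dampedSum] using hwm p n.zero_le
  have hW0 : ∀ z, W 0 z = 0 := fun z => by simp [hW, dampedSum]
  have hwK : ∀ z ∈ K, ∀ n x, w n (z, x) = h n (z, x) := fun z hz n x =>
    dampedSum_eq (h0 _) (hvS z hz) n
  have hWK : ∀ z ∈ K, ∀ n, W n z = S n z := fun z hz n => dampedSum_eq (hS0 _) (hvS z hz) n
  have hwK' : ∀ z ∈ K, ∀ x, ⨆ n, ENNReal.ofReal (w n (z, x)) = s (z, x) := fun z hz x => by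
    simp only [hwK z hz, hsup z hz x]
  have hterm : ∀ z n, Integrable (fun x => damping (fun i => v i z) (fun i => S i z) n *
      (h (n + 1) (z, x) - h n (z, x))) (m z) := fun z n =>
    ((hint z _).sub (hint z n)).const_mul _
  have hwint : ∀ z n, Integrable (fun x => w n (z, x)) (m z) := fun z n =>
    integrable_finsetSum _ fun i _ => hterm z i
  have hwW : ∀ z n, ∫ x, w n (z, x) ∂(m z) = W n z := fun z n => by
    simp only [hw, hW, dampedSum]
    rw [integral_finsetSum _ fun i _ => hterm z i]
    refine Finset.sum_congr rfl fun i _ => ?_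
    rw [integral_const_mul, integral_sub (hint z _) (hint z _)]
  set G : Z → ℝ≥0∞ := fun z => ∫⁻ x, ⨆ n, ENNReal.ofReal (w n (z, x)) ∂(m z)
  have hGW : ∀ z, G z = ⨆ n, ENNReal.ofReal (W n z) := fun z => by
    change ∫⁻ x, ⨆ n, ENNReal.ofReal (w n (z, x)) ∂(m z) = _
    rw [lintegral_iSup_ofReal (fun n => ((hwrc.mono (Set.subset_univ _)).1
      |>.lowerSemicontinuous_section (A := Set.univ) n trivial).measurable) (hwint z)
      (fun n x => hw0 n _) fun x => hwm _]
    simp only [hwW]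
  have hGle : ∀ z N D, 1 + 2⁻¹ ^ N < D * v N z → G z ≤ ENNReal.ofReal (W N z +
      max 0 (D - S N z)) := fun z N D hD => by
    rw [hGW]
    exact iSup_le fun M => ENNReal.ofReal_le_ofReal
      (dampedSum_le (hvm z) (hv0 z) (hSmono z) hD M)
  have hBnn : ∀ z N D, 0 ≤ W N z + max 0 (D - S N z) := fun z N D =>
    add_nonneg ((hW0 z).symm.le.trans (hWm z N.zero_le)) (le_max_left _ _)
  have hGfin : ∀ z, G z < ∞ := fun z => by
    -- Any `D` above the integral of `s` works, here that integral plus one. Off `K` the requirement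
    -- on `k` is vacuous.
    obtain ⟨N, hN⟩ := exists_lt_mul_of_lt (hvm z) ENNReal.toReal_nonneg (lt_add_one _)
      fun k hk hkJ => hvc z k hk fun _ => hkJ
    exact (hGle z N _ hN).trans_lt ENNReal.ofReal_lt_top
  have hGK : ∀ z ∈ K, G z = ∫⁻ x, s (z, x) ∂(m z) := fun z hz =>
    lintegral_congr fun x => hwK' z hz x
  have hWG : ∀ z n, W n z ≤ (G z).toReal := fun z n => by
    rw [← ENNReal.ofReal_le_iff_le_toReal (hGfin z).ne, hGW]
    exact le_iSup (fun n => ENNReal.ofReal (W n z)) n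
  suffices hR : RC Set.univ fun (_ : Unit) z => (G z).toReal from ⟨w, hwrc, hw0, hGfin, hR, hwK'⟩
  constructor
  · refine Lo.of_ex (h := fun (_ : Unit) (n : ℕ) z => W n z)
      (hWrc.1.comp (u := fun p : Unit × ℕ => p.2) (by fun_prop)) fun _ z _ q => ?_
    refine ⟨fun hq => ?_, fun ⟨n, hn⟩ => hn.trans_le (hWG z n)⟩
    by_contra! hcon
    refine absurd hq (not_lt.2 (ENNReal.toReal_le_of_le_ofReal ((hW0 z).symm.le.trans (hcon 0)) ?_))
    rw [hGW]
    exact iSup_le fun n => ENNReal.ofReal_le_ofReal (hcon n)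
  · refine SD.congr (U := fun (a : Unit × ℕ) z => ∃ b : ℕ × ℕ, (1 + 2⁻¹ ^ b.1 <
      (ratOf b.2 : ℝ) * v b.1 z) ∧ W b.1 z + max 0 ((ratOf b.2 : ℝ) - S b.1 z) < -ratOf a.2)
      (.ex (.and (RC.lt (.const (by fun_prop)) (.mul (.const (by fun_prop))
          (hvrc.comp (u := fun a : (Unit × ℕ) × (ℕ × ℕ) => a.2.1) (by fun_prop))))
        (RC.lt (.add (hWrc.comp (u := fun a : (Unit × ℕ) × (ℕ × ℕ) => a.2.1) (by fun_prop))
          (.max (.const .zero) (.sub (.const (by fun_prop))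
          (hSrc.comp (u := fun a : (Unit × ℕ) × (ℕ × ℕ) => a.2.1) (by fun_prop)))))
          (.const (by fun_prop))))) fun a z _ => ?_
    rw [lt_neg]
    generalize -((ratOf a.2 : ℚ) : ℝ) = q
    constructor
    · intro hq
      by_cases hz : z ∈ K
      · simp only [hGK z hz] at hq
        -- On `K` there is no damping, so `W N = S N` and the bound equals `D`, which may be any
        -- rational above the integral.
        obtain ⟨k, hk1, hk2⟩ := exists_ratOf_btwn hq
        obtain ⟨N, hN⟩ := exists_lt_mul_of_lt (hvm z) ENNReal.toReal_nonneg hk1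
          fun k hk hkJ => hvc z k hk fun _ => hkJ
        refine ⟨(N, k), hN, ?_⟩
        have h1 := hSle z hz N
        rw [hWK z hz, max_eq_right (by linarith)]
        simpa using hk2
      -- Off `K` the sequence `v` is unbounded, so every `D > 0` is admissible; the bound exceeds
      -- the integral by at most `D`.
      · obtain ⟨k, hk1, hk2⟩ := exists_ratOf_btwn (sub_pos.2 hq)
        obtain ⟨N, hN⟩ := exists_lt_mul_of_lt (hvm z) le_rfl hk1
          fun k hk hkJ => hvc z k hk fun h => absurd h hz
        refine ⟨(N, k), hN, ?_⟩
        have h1 : max 0 ((ratOf k : ℝ) - S N z) ≤ ratOf k :=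
          max_le hk1.le (sub_le_self _ (hSnn N z))
        have h2 := hWG z N
        simp only at h1 h2 hk2 ⊢
        linarith
    · rintro ⟨⟨N, k⟩, h1, h2⟩
      exact (ENNReal.toReal_le_of_le_ofReal (hBnn z N _) (hGle z N _ h1)).trans_lt h2

end

/-! ## Lower semicomputable functions through computable families -/

/-- Truncating the approximations at `0` does not change the supremum, because `t` is nonnegative.
-/
theorem LowerSemicomputable.exists_rc {X : Type*} [MetricPresentation X] [EffPres X]
    {t : X → ℝ≥0∞} (ht : LowerSemicomputable t) :
    ∃ g : ℕ → X → ℝ, RC Set.univ g ∧ ∀ x, t x = ⨆ n, ENNReal.ofReal (g n x) := by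
  obtain ⟨g, hg, ht⟩ := ht
  refine ⟨fun n x => g (n, x), hg.sdMap.rc.section_nat.comp (u := fun n : ℕ => ((), n))
    (by fun_prop), fun x => EReal.coe_ennreal_injective ?_⟩
  rw [Monotone.map_ciSup_of_continuousAt continuous_coe_ennreal_ereal.continuousAt
    EReal.coe_ennreal_strictMono.monotone (OrderTop.bddAbove _)]
  simp only [EReal.coe_ennreal_ofReal, EReal.coe_strictMono.monotone.map_max, EReal.coe_zero]
  rw [← iSup_sup, ← ht, sup_of_le_left (EReal.coe_ennreal_nonneg _)]

theorem LowerSemicomputable.of_rc {X : Type*} [MetricPresentation X] [EffPres X] {t : X → ℝ≥0∞}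
    {g : ℕ → X → ℝ} (hg : RC Set.univ g) (h0 : ∀ n x, 0 ≤ g n x)
    (ht : ∀ x, t x = ⨆ n, ENNReal.ofReal (g n x)) : LowerSemicomputable t := by
  refine ⟨fun p => g p.1 p.2, hg.unsection_nat.sdMap.computableMapOn, fun x => ?_⟩
  rw [ht, Monotone.map_ciSup_of_continuousAt continuous_coe_ennreal_ereal.continuousAt
    EReal.coe_ennreal_strictMono.monotone (OrderTop.bddAbove _)]
  simp only [EReal.coe_ennreal_ofReal, max_eq_left (h0 _ _)]

theorem LowerSemicomputable.sd {X : Type*} [MetricPresentation X] [EffPres X] {t : X → ℝ≥0∞}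
    (ht : LowerSemicomputable t) : SD Set.univ fun (k : ℕ) x =>
      (0 : ℝ) < ratOf k ∧ ENNReal.ofReal (ratOf k) < t x := by
  obtain ⟨g, hg, ht⟩ := ht.exists_rc
  refine SD.congr (.and (.of_re (QComp.re_lt (f := fun _ : ℕ => (0 : ℝ))
    (g := fun k : ℕ => (ratOf k : ℝ)) (by fun_prop) (by fun_prop)))
    (.ex (U := fun (k n : ℕ) x => (ratOf k : ℝ) < g n x) (RC.lt (.const (by fun_prop))
      (hg.comp (u := fun p : ℕ × ℕ => p.2) (by fun_prop))))) fun k x _ => and_congr_right fun hk => ?_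
  rw [ht, lt_iSup_iff]
  refine exists_congr fun n => ⟨fun h => ?_, fun h => ?_⟩
  · exact (ENNReal.ofReal_lt_ofReal_iff_of_nonneg hk.le).1 h
  · exact (ENNReal.ofReal_lt_ofReal_iff_of_nonneg hk.le).2 h

section

variable {A X Y : Type*} [MetricPresentation A] [EffPres A] [MetricPresentation X] [EffPres X]
  [MetricPresentation Y] [EffPres Y]

theorem SDMap.prodAssoc : SDMap Set.univ fun p : (A × X) × Y => (p.1.1, p.1.2, p.2) := by
  have h1 : SDMap Set.univ fun p : (A × X) × Y => p.1 := SDMap.fst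
  have h2 : SDMap Set.univ fun p : (A × X) × Y => p.2 := SDMap.snd
  exact .prodMk (SDMap.fst.comp h1 (Set.mapsTo_univ _ _))
    (.prodMk (SDMap.snd.comp h1 (Set.mapsTo_univ _ _)) h2)

theorem SDMap.prodAssoc_symm : SDMap Set.univ fun p : A × X × Y => ((p.1, p.2.1), p.2.2) := by
  have h1 : SDMap Set.univ fun p : A × X × Y => p.1 := SDMap.fst
  have h2 : SDMap Set.univ fun p : A × X × Y => p.2 := SDMap.snd
  exact .prodMk (.prodMk h1 (SDMap.fst.comp h2 (Set.mapsTo_univ _ _)))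
    (SDMap.snd.comp h2 (Set.mapsTo_univ _ _))

end

theorem LowerSemicomputable.measurable_section {A X Y : Type*} [MetricPresentation A] [EffPres A]
    [MetricPresentation X] [EffPres X] [ComputableMetricSpace Y] [MeasurableSpace Y] [BorelSpace Y]
    {t : A × X × Y → ℝ≥0∞} (ht : LowerSemicomputable t) (a : A) (x : X) :
    Measurable fun y => t (a, x, y) := by
  obtain ⟨g, hg, ht⟩ := ht.exists_rc
  simp only [ht]
  refine .iSup fun n => Measurable.ennreal_ofReal ?_
  have h := (hg.subst SDMap.prodAssoc (Set.mapsTo_univ _ _)).mono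
    (Set.subset_univ ((Set.univ : Set (A × X)) ×ˢ (Set.univ : Set Y)))
  exact (h.1.lowerSemicontinuous_section n (y := (a, x)) trivial).measurable

/-! ## Randomness conservation -/

/-- Sections of semidecidable sets are open, so preimages of arbitrarily small basic balls are open.
-/
theorem continuous_of_sdMap {𝔸 𝕏 𝕐 : Type*} [ComputableMetricSpace 𝔸] [ComputableMetricSpace 𝕏]
    [MeasurableSpace 𝕏] [ComputableMetricSpace 𝕐] {K : Set (𝔸 × ProbabilityMeasure 𝕏)}
    {T : 𝔸 → ProbabilityMeasure 𝕏 → 𝕏 → 𝕐}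
    (hT : SDMap {p | p.1 ∈ K} fun p : (𝔸 × ProbabilityMeasure 𝕏) × 𝕏 => T p.1.1 p.1.2 p.2)
    {p : 𝔸 × ProbabilityMeasure 𝕏} (hp : p ∈ K) : Continuous (T p.1 p.2) := by
  have hT' : SD (K ×ˢ Set.univ) fun (b : ℕ) (p : (𝔸 × ProbabilityMeasure 𝕏) × 𝕏) =>
      T p.1.1 p.1.2 p.2 ∈ basicBall 𝕐 b := SD.mono hT fun p hp => hp.1
  refine continuous_iff_continuousAt.2 fun x => Metric.nhds_basis_ball.tendsto_right_iff.2
    fun ε hε => ?_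
  obtain ⟨b, hb, hr⟩ := EffPres.exists_ball (T p.1 p.2 x) (half_pos hε)
  filter_upwards [(hT'.isOpen_section b hp).mem_nhds hb] with y hy
  have h1 : dist (basic b.unpair.1 : 𝕐) _ < _ := mem_basicBall.1 hb
  have h2 : dist (basic b.unpair.1 : 𝕐) _ < _ := mem_basicBall.1 hy
  have h3 := dist_triangle_left (T p.1 p.2 y) (T p.1 p.2 x) (basic b.unpair.1)
  exact Metric.mem_ball.2 (by linarith)

/-! ### Finite measures as parameters and the pullback of tests -/

section

variable {𝔸 𝕏 𝕐 : Type*} [ComputableMetricSpace 𝔸]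
  [ComputableMetricSpace 𝕏] [MeasurableSpace 𝕏] [BorelSpace 𝕏]
  [ComputableMetricSpace 𝕐] [MeasurableSpace 𝕐] [BorelSpace 𝕐]
  {K : Set (𝔸 × ProbabilityMeasure 𝕏)}

/-- The set `K`, as a set of parameters with finite measures. -/
def finiteMeasureParams (K : Set (𝔸 × ProbabilityMeasure 𝕏)) : Set (𝔸 × FiniteMeasure 𝕏) :=
  {z | ∃ μ : ProbabilityMeasure 𝕏, z.2 = μ.toFiniteMeasure ∧ (z.1, μ) ∈ K}

theorem rc_integral_snd {B : Set (𝔸 × FiniteMeasure 𝕏)} :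
    RC B fun i z => ∫ x, basicFunction 𝕏 i x ∂(z.2 : Measure 𝕏) :=
  ((isMeasurePres_finiteMeasure.rc_integral (B := Set.univ)).subst SDMap.snd
    (Set.mapsTo_univ _ _)).mono (Set.subset_univ _)

/-- A parameter is excluded if its total mass differs from `1` or if it lies in an enumerated ball
of the complement of `K`. The distance to the probability measure at the centre is defined for every
finite measure, and a misjudgement by the second test is impossible when the mass is `1` and
irrelevant otherwise. -/
theorem sd_compl_finiteMeasureParams (hK : EffectivelyClosed K) :
    SD Set.univ fun (_ : Unit) z => z ∉ finiteMeasureParams K := by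
  obtain ⟨S, hS, hKS⟩ := hK
  have hmass : RC (Set.univ : Set (𝔸 × FiniteMeasure 𝕏)) fun (_ : Unit) z =>
      ∫ x, basicFunction 𝕏 0 x ∂(z.2 : Measure 𝕏) :=
    rc_integral_snd.comp (u := fun _ : Unit => 0) (by fun_prop)
  have hd1 : RC (Set.univ : Set (𝔸 × FiniteMeasure 𝕏)) fun (c : ℕ) z =>
      d (basic c : 𝔸) z.1 := (RC.dist (A := Set.univ)).subst SDMap.fst (Set.mapsTo_univ _ _)
  have hd2 : RC (Set.univ : Set (𝔸 × FiniteMeasure 𝕏)) fun (c : ℕ) z =>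
      measureDist ((basic c : ProbabilityMeasure 𝕏) : Measure 𝕏) (z.2 : Measure 𝕏) :=
    rc_measureDist isMeasurePres_probabilityMeasure.rc_basic.lift
      (rc_integral_snd.comp (u := fun p : ℕ × ℕ => p.2) (by fun_prop))
  have hone : RC (Set.univ : Set (𝔸 × FiniteMeasure 𝕏)) fun (_ : Unit) _ => (1 : ℝ) := .const .one
  refine SD.congr (.or (.or (hmass.lt hone) (hone.lt hmass))
    (.ex (U := fun (_ : Unit) (b : ℕ) (z : 𝔸 × FiniteMeasure 𝕏) => b ∈ S ∧
      (d (basic b.unpair.1.unpair.1 : 𝔸) z.1 < (posRatOf b.unpair.2 : ℝ) ∧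
      measureDist ((basic b.unpair.1.unpair.2 : ProbabilityMeasure 𝕏) : Measure 𝕏)
        (z.2 : Measure 𝕏) < (posRatOf b.unpair.2 : ℝ)))
      (.and (.of_re ((RE.of_computablePred hS).comp (f := fun p : Unit × ℕ => p.2) (by fun_prop)))
        (.and (RC.lt (hd1.comp (u := fun p : Unit × ℕ => p.2.unpair.1.unpair.1) (by fun_prop))
            (.const (by fun_prop)))
          (RC.lt (hd2.comp (u := fun p : Unit × ℕ => p.2.unpair.1.unpair.2) (by fun_prop))
            (.const (by fun_prop))))))) fun _ z _ => ?_
  rw [integral_basicFunction_zero]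
  by_cases h1 : (z.2 : Measure 𝕏).real Set.univ = 1
  · obtain ⟨μ, hμ⟩ : ∃ μ : ProbabilityMeasure 𝕏, z.2 = μ.toFiniteMeasure :=
      ⟨⟨z.2, ⟨by rw [← ENNReal.toReal_eq_one_iff]; exact h1⟩⟩, rfl⟩
    have hz : z ∉ finiteMeasureParams K ↔ (z.1, μ) ∈ Kᶜ := by
      refine not_congr ⟨?_, fun h => ⟨_, hμ, h⟩⟩
      rintro ⟨ν, hν, h⟩
      rwa [ProbabilityMeasure.toMeasure_injective
        (congrArg FiniteMeasure.toMeasure (hμ.symm.trans hν))]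
    rw [hz, hKS]
    simp only [h1, lt_irrefl, false_or, Set.mem_iUnion, exists_prop]
    refine exists_congr fun b => and_congr_right fun _ => ?_
    rw [hμ, mem_basicBall_prod, mem_basicBall_pair, mem_basicBall_pair]
    rfl
  · refine iff_of_true ?_ (.inl (lt_or_gt_of_ne h1))
    rintro ⟨μ, h, -⟩
    exact h1 (by rw [h]; simp)

noncomputable section

/-- The parameter of `K` that belongs to an element of `finiteMeasureParams K`. -/
def probParam [Nonempty 𝕏] (z : 𝔸 × FiniteMeasure 𝕏) : 𝔸 × ProbabilityMeasure 𝕏 :=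
  (z.1, z.2.normalize)

variable [Nonempty 𝕏]

theorem probParam_toFiniteMeasure {𝔸 𝕏 : Type*} [MeasurableSpace 𝕏] [Nonempty 𝕏] (a : 𝔸)
    (μ : ProbabilityMeasure 𝕏) : probParam (a, μ.toFiniteMeasure) = (a, μ) := by
  simp [probParam]

theorem probParam_mem {𝔸 𝕏 : Type*} [MeasurableSpace 𝕏] [Nonempty 𝕏]
    {K : Set (𝔸 × ProbabilityMeasure 𝕏)} {z : 𝔸 × FiniteMeasure 𝕏} (hz : z ∈ finiteMeasureParams K) :
    probParam z ∈ K := by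
  obtain ⟨a, ν⟩ := z
  obtain ⟨μ, rfl, hμ⟩ := hz
  rwa [probParam_toFiniteMeasure]

/-- On these parameters the mass is `1`, so normalisation leaves all integrals unchanged. -/
theorem sdMap_probParam : SDMap (finiteMeasureParams K) (probParam (𝔸 := 𝔸) (𝕏 := 𝕏)) := by
  refine .prodMk (SD.mono SDMap.fst (Set.subset_univ _)) ?_
  refine isMeasurePres_probabilityMeasure.sdMap (rc_integral_snd.congr ?_)
  rintro i ⟨a, ν⟩ ⟨μ, rfl, hμ⟩
  simp

variable {T : 𝔸 → ProbabilityMeasure 𝕏 → 𝕏 → 𝕐}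

variable (T) in
/-- The map `T`, with finite measures as parameters. -/
def paramMap (z : 𝔸 × FiniteMeasure 𝕏) : 𝕏 → 𝕐 := T (probParam z).1 (probParam z).2

theorem sdMap_paramMap {𝕐 : Type*} [ComputableMetricSpace 𝕐]
    {T : 𝔸 → ProbabilityMeasure 𝕏 → 𝕏 → 𝕐}
    (hT : SDMap {p | p.1 ∈ K} fun p : (𝔸 × ProbabilityMeasure 𝕏) × 𝕏 => T p.1.1 p.1.2 p.2) :
    SDMap (finiteMeasureParams K ×ˢ Set.univ) fun p => paramMap T p.1 p.2 :=
  hT.comp (.prodMk (sdMap_probParam.comp (SD.mono SDMap.fst (Set.subset_univ _)) fun _ hp => hp.1)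
    (SD.mono SDMap.snd (Set.subset_univ _))) fun _ hp => probParam_mem hp.1

theorem measurable_paramMap
    (hT : SDMap {p | p.1 ∈ K} fun p : (𝔸 × ProbabilityMeasure 𝕏) × 𝕏 => T p.1.1 p.1.2 p.2)
    {z : 𝔸 × FiniteMeasure 𝕏} (hz : z ∈ finiteMeasureParams K) : Measurable (paramMap T z) :=
  (continuous_of_sdMap hT (probParam_mem hz)).measurable

/-- The integrals of basic functions against the image measure are integrals of their compositions
with `T`, which are computable and bounded by `2 ^ i`. -/
theorem sdMap_pushforward
    (hT : SDMap {p | p.1 ∈ K} fun p : (𝔸 × ProbabilityMeasure 𝕏) × 𝕏 => T p.1.1 p.1.2 p.2) :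
    SDMap (finiteMeasureParams K) fun z => z.2.map (paramMap T z) := by
  refine isMeasurePres_finiteMeasure.sdMap (RC.congr (RC.integral (X := 𝕏)
    (u := fun i p => basicFunction 𝕐 i (paramMap T p.1 p.2)) (C := fun i => 2 ^ i)
    (m := fun z => (z.2 : Measure 𝕏))
    ((rc_basicFunction (A := Set.univ)).subst (sdMap_paramMap hT) (Set.mapsTo_univ _ _))
    (by fun_prop) (fun i z _ x => ?_) (fun z _ => inferInstance) rc_integral_snd) fun i z hz => ?_)
  · exact_mod_cast abs_basicFunction_le i (paramMap T z x)
  · exact integral_map (measurable_paramMap hT hz).aemeasurable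
      (continuous_basicFunction i).aestronglyMeasurable

/-- Tests for the image measures pull back to tests. -/
theorem exists_pullback_test (hK : EffectivelyClosed K)
    (hT : SDMap {p | p.1 ∈ K} fun p : (𝔸 × ProbabilityMeasure 𝕏) × 𝕏 => T p.1.1 p.1.2 p.2)
    {t : (𝔸 × ProbabilityMeasure 𝕏) × FiniteMeasure 𝕐 × 𝕐 → ℝ≥0∞}
    (ht : IsUniformSchnorrTest t) :
    ∃ t' : 𝔸 × FiniteMeasure 𝕏 × 𝕏 → ℝ≥0∞, IsUniformSchnorrTest t' ∧
      ∀ a μ, (a, μ) ∈ K → ∀ x, t' (a, μ.toFiniteMeasure, x) =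
        t ((a, μ), μ.toFiniteMeasure.map (T a μ), T a μ x) := by
  set ν : 𝔸 × FiniteMeasure 𝕏 → FiniteMeasure 𝕐 := fun z => z.2.map (paramMap T z) with hν
  set s : (𝔸 × FiniteMeasure 𝕏) × 𝕏 → ℝ≥0∞ := fun p =>
    t (probParam p.1, ν p.1, paramMap T p.1 p.2) with hs
  have hfst : SDMap (finiteMeasureParams K ×ˢ Set.univ) fun p : (𝔸 × FiniteMeasure 𝕏) × 𝕏 => p.1 :=
    SD.mono SDMap.fst (Set.subset_univ _)
  have hsd : SD (finiteMeasureParams K ×ˢ Set.univ) fun (k : ℕ) p =>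
      (0 : ℝ) < ratOf k ∧ ENNReal.ofReal (ratOf k) < s p :=
    ht.lowerSemicomputable.sd.subst (.prodMk (sdMap_probParam.comp hfst fun p hp => hp.1)
      (.prodMk ((sdMap_pushforward hT).comp hfst fun p hp => hp.1) (sdMap_paramMap hT)))
      (Set.mapsTo_univ _ _)
  -- Change of variables: the integral of the pulled-back function is the integral of the test at a
  -- computable parameter, hence finite and computable.
  have hint : ∀ z ∈ finiteMeasureParams K, ∫⁻ x, s (z, x) ∂(z.2 : Measure 𝕏) =
      ∫⁻ y, t (probParam z, ν z, y) ∂(ν z : Measure 𝕐) := fun z hz => by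
    have h := lintegral_map (μ := (z.2 : Measure 𝕏))
      (ht.lowerSemicomputable.measurable_section (probParam z) (ν z)) (measurable_paramMap hT hz)
    exact h.symm
  have hI : RC (finiteMeasureParams K) fun (_ : Unit) z =>
      (∫⁻ x, s (z, x) ∂(z.2 : Measure 𝕏)).toReal :=
    (ht.computable_integral.sdMap.rc.subst (.prodMk sdMap_probParam (sdMap_pushforward hT))
      (Set.mapsTo_univ _ _)).congr fun _ z hz => by rw [hint z hz]
  -- Everything is known over `K` only; the extension supplies a test for all oracles and finite
  -- measures that is unchanged over `K`.
  obtain ⟨w, hw, hw0, hfin, hrc, hws⟩ := exists_integrable_extension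
    (m := fun z => (z.2 : Measure 𝕏)) (sd_compl_finiteMeasureParams hK) rc_integral_snd hsd
    (fun z hz => (hint z hz).trans_lt (ht.integral_lt_top _ _)) hI
  refine ⟨fun p => ⨆ n, ENNReal.ofReal (w n ((p.1, p.2.1), p.2.2)),
    ⟨.of_rc (hw.subst SDMap.prodAssoc_symm (Set.mapsTo_univ _ _)) (fun n p => hw0 n _)
      fun _ => rfl, fun a μ => hfin (a, μ), hrc.sdMap.computableMapOn⟩, fun a μ hμ x => ?_⟩
  refine (hws (a, μ.toFiniteMeasure) ⟨μ, rfl, hμ⟩ x).trans ?_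
  simp only [hs, hν, paramMap, probParam_toFiniteMeasure]

end

end

theorem mainTheorem6
    {𝔸 𝕏 𝕐 : Type*} [ComputableMetricSpace 𝔸]
    [ComputableMetricSpace 𝕏] [MeasurableSpace 𝕏] [BorelSpace 𝕏]
    [ComputableMetricSpace 𝕐] [MeasurableSpace 𝕐] [BorelSpace 𝕐]
    (K : Set (𝔸 × ProbabilityMeasure 𝕏)) (hK : EffectivelyClosed K)
    (T : 𝔸 → ProbabilityMeasure 𝕏 → 𝕏 → 𝕐)
    (hT : ComputableMapOn
      (fun p : (𝔸 × ProbabilityMeasure 𝕏) × 𝕏 => T p.1.1 p.1.2 p.2) {p | p.1 ∈ K}) :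
    ∀ (a : 𝔸) (μ : ProbabilityMeasure 𝕏), (a, μ) ∈ K →
      Continuous (T a μ) ∧
      ∀ x : 𝕏, x ∈ SR a μ.toFiniteMeasure →
        T a μ x ∈ SR (a, μ) (μ.toFiniteMeasure.map (T a μ)) := by
  intro a μ hμ
  have : Nonempty 𝕏 := ⟨basic 0⟩
  refine ⟨continuous_of_sdMap hT.sdMap hμ, fun x hx t ht => ?_⟩
  obtain ⟨t', ht', h⟩ := exists_pullback_test hK hT.sdMap ht
  rw [← h a μ hμ x]
  exact hx t' ht'
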